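/- **H-functions.** Let $0\le n\le p$, $1\le m\le q$, $a_j,b_j\in\mathbb C$, $\alpha_j,\beta_j>0$, and $$\theta(\xi)=\frac{\prod_{j=1}^m\Gamma(b_j-\beta_j\xi)\prod_{j=1}^n\Gamma(1-a_j+\alpha_j\xi)}{\prod_{j=m+1}^q\Gamma(1-b_j+\beta_j\xi)\prod_{j=n+1}^p\Gamma(a_j-\alpha_j\xi)},\qquad H^{m,n}_{p,q}[z]=\frac1{2\pi i}\int_{L}\theta(\xi)z^\xi\,d\xi .$$ Here $L$ is an (indented, if necessary) contour with the poles of $\Gamma(b_j-\beta_j\xi)$, $j\le m$, on its right and those of $\Gamma(1-a_j+\alpha_j\xi)$, $j\le n$, on its left; it is of one of two shapes: (V) from $-i\infty$ to $+i\infty$ along a vertical line, or (L) a loop beginning and ending at $+\infty$. The usual existence conditions at $z\ne0$ are: the two families of poles are disjoint, and, in case (V), $a^*:=\sum_{j\le n}\alpha_j-\sum_{j>n}\alpha_j+\sum_{j\le m}\beta_j-\sum_{j>m}\beta_j>0$ and $|\arg z|<\tfrac\pi2a^*$; in case (L), either $\Delta:=\sum_j\beta_j-\sum_j\alpha_j>0$,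 or $\Delta=0$ and $|z|<\prod_j\alpha_j^{-\alpha_j}\prod_j\beta_j^{\beta_j}$. Powers have their principal values. For $-\infty<a<x<\infty$ and $\alpha>0$ define $$(I^{\gamma,\mu}_{a+}f)(x)=\frac{(x-a)^{-\mu-\gamma}}{\Gamma(\mu)}\int_a^x\frac{t^\gamma f(t)}{(x-t)^{1-\mu}}\,dt,\qquad (\mathcal H^{w;m,n;\alpha}_{a+;p,q;\beta}f)(x)=\int_a^x(x-t)^{\beta-1}H^{m,n}_{p,q}[w(x-t)^\alpha]f(t)\,dt .$$ For $a<u<x$ (so that $|\frac{x-u}{x-a}|<1$) let $$H^{0,1:m,n;1,1}_{1,1:p,q;1,1}\!\left[\begin{matrix}z_1\\z_2\end{matrix}\,\middle|\,\begin{matrix}(1-\beta;\alpha,1):(a_j,\alpha_j)_{1,p};(1-\mu-\gamma,1)\\(1-\mu-\beta;\alpha,1):(b_j,\beta_j)_{1,q};(0,1)\end{matrix}\right]=\frac1{(2\pi i)^2}\int_{L_1}\!\int_{L_2}\frac{\Gamma(\beta+\alpha\xi+\eta)}{\Gamma(\mu+\beta+\alpha\xi+\eta)}\,\theta(\xi)\,\Gamma(-\eta)\Gamma(\mu+\gamma+\eta)\,z_1^\xi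 z_2^\eta\,d\eta\,d\xi ,$$ where $L_1$ has the same shape as $L$ and separates the same poles, $L_2$ is a loop beginning and ending at $+\infty$ with the poles of $\Gamma(-\eta)$ on its right and those of $\Gamma(\mu+\gamma+\eta)$ on its left, and $\Re(\beta+\alpha\xi+\eta)>0$ on $L_1\times L_2$. **Theorem 1.** Let $\Re(\gamma)>-1$, $\Re(\mu)>0$, $\Re(\beta)>0$, $\mu+\gamma\ne0$, $\alpha>0$, $w\in\mathbb C\setminus\{0\}$, $1\le m\le q$, $0\le n\le p$, $\Re(\beta)+\min_{1\le j\le m}\Re(\alpha b_j/\beta_j)>0$, let $a<x$ be real, and suppose that, for one of the two shapes of contour, $H^{m,n}_{p,q}$ satisfies the usual existence conditions at $w(x-t)^\alpha$ for all $a\le t<x$. Let $\phi:\mathbb R\to\mathbb C$ be a function for which the iterated integral defining $(\mathcal H^{w;m,n;\alpha}_{a+;p,q;\beta}I^{\gamma,\mu}_{a+}\phi)(x)$ converges absolutely. Then $$(\mathcal H^{w;m,n;\alpha}_{a+;p,q;\beta}I^{\gamma,\mu}_{a+}\phi)(x)=\int_a^xu^\gamma(x-u)^{\mu+\beta-1}\frac{(x-a)^{-\mu-\gamma}}{\Gamma(\mu+\gamma)}\,H^{0,1:m,n;1,1}_{1,1:p,q;1,1}\!\left[\begin{matrix}w(x-u)^\alpha\\-\frac{x-u}{x-a}\end{matrix}\,\middle|\,\begin{matrix}(1-\beta;\alpha,1):(a_j,\alpha_j)_{1,p};(1-\mu-\gamma,1)\\(1-\mu-\beta;\alpha,1):(b_j,\beta_j)_{1,q};(0,1)\end{matrix}\right]\phi(u)\,du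 ,$$ and the integral on the right converges absolutely. The assumption on $\phi$ is satisfied whenever, for some $\delta\ge0$ with $\delta>\Re(\gamma)$, the function $u^\gamma(u-a)^{-\delta}(x-u)^{\mu-1}\phi(u)$ is integrable on $(a,x)$. -/

import Mathlib

open MeasureTheory Set

noncomputable section

/-! ### Mellin-Barnes contours -/

/-- The two usual shapes of a Mellin-Barnes contour: a vertical line from `-i∞` to `+i∞`, or a loop
that begins and ends at `+∞`. Both may be indented. -/
inductive ContourKind where
  | vertical
  | loop

/-- A Mellin-Barnes contour. Its main part is the upward line `Re s = c`, respectively the path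
`+∞ - ih → c - ih → c + ih → +∞ + ih`. An indentation that takes the main part to the other
side of a pole differs from the straight path by a circle around that pole, so the indentations are
recorded as finitely many circles with integer multiplicities (counterclockwise is positive). -/
structure MBContour (κ : ContourKind) where
  c : ℝ
  h : ℝ
  h_pos : 0 < h
  k : ℕ
  center : Fin k → ℂ
  radius : Fin k → ℝ
  radius_pos : ∀ i, 0 < radius i
  mult : Fin k → ℤ

/-- The set of points of the contour. -/
def MBContour.support {κ : ContourKind} (L : MBContour κ) : Set ℂ :=
  (match κ with
    | .vertical => {s : ℂ | s.re = L.c}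
    | .loop => {s : ℂ | (s.re = L.c ∧ |s.im| ≤ L.h) ∨ (L.c ≤ s.re ∧ |s.im| = L.h)}) ∪
  ⋃ i, Metric.sphere (L.center i) (L.radius i)

open Classical in
/-- The side of the contour on which a point off the contour lies: `1` on the left and `0` on the
right of the main part, corrected by the windings of the indentations. -/
def MBContour.side {κ : ContourKind} (L : MBContour κ) (s : ℂ) : ℤ :=
  (match κ with
    | .vertical => if s.re < L.c then 1 else 0
    | .loop => if L.c < s.re ∧ |s.im| < L.h then 0 else 1) +
  ∑ i, if s ∈ Metric.ball (L.center i) (L.radius i) then L.mult i else 0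

def MBContour.IsLeft {κ : ContourKind} (L : MBContour κ) (s : ℂ) : Prop :=
  s ∉ L.support ∧ L.side s = 1

def MBContour.IsRight {κ : ContourKind} (L : MBContour κ) (s : ℂ) : Prop :=
  s ∉ L.support ∧ L.side s = 0

/-- The contour integral `∫_L f(s) ds`. -/
def MBContour.integral {κ : ContourKind} (L : MBContour κ) (f : ℂ → ℂ) : ℂ :=
  (match κ with
    | .vertical => Complex.I * ∫ y : ℝ, f (L.c + y * Complex.I)
    | .loop =>
        -(∫ r in Ioi L.c, f (r - L.h * Complex.I))
          + Complex.I * (∫ y in (-L.h)..L.h, f (L.c + y * Complex.I))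
          + ∫ r in Ioi L.c, f (r + L.h * Complex.I)) +
  ∑ i, (L.mult i : ℂ) * ∮ s in C(L.center i, L.radius i), f s

/-! ### The H-function of one variable -/

/-- The orders and parameters of `H^{m,n}_{p,q}[z | (a_j, A_j)_{1,p}; (b_j, B_j)_{1,q}]`. -/
structure FoxData where
  m : ℕ
  n : ℕ
  p : ℕ
  q : ℕ
  m_le : m ≤ q
  n_le : n ≤ p
  a : Fin p → ℂ
  A : Fin p → ℝ
  A_pos : ∀ j, 0 < A j
  b : Fin q → ℂ
  B : Fin q → ℝ
  B_pos : ∀ j, 0 < B j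

/-- The Mellin-Barnes kernel
`∏_{j ≤ m} Γ(b_j - B_j s) ∏_{j ≤ n} Γ(1 - a_j + A_j s) /
  (∏_{j > m} Γ(1 - b_j + B_j s) ∏_{j > n} Γ(a_j - A_j s))`. -/
def FoxData.theta (P : FoxData) (s : ℂ) : ℂ :=
  (∏ j : Fin P.q, if (j : ℕ) < P.m then Complex.Gamma (P.b j - P.B j * s)
    else (Complex.Gamma (1 - P.b j + P.B j * s))⁻¹) *
  ∏ j : Fin P.p, if (j : ℕ) < P.n then Complex.Gamma (1 - P.a j + P.A j * s)
    else (Complex.Gamma (P.a j - P.A j * s))⁻¹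

/-- The poles of `Γ(b_j - B_j s)`, `j ≤ m`. -/
def FoxData.rightPoles (P : FoxData) : Set ℂ :=
  {s | ∃ (j : Fin P.q) (k : ℕ), (j : ℕ) < P.m ∧ s = (P.b j + k) / P.B j}

/-- The poles of `Γ(1 - a_j + A_j s)`, `j ≤ n`. -/
def FoxData.leftPoles (P : FoxData) : Set ℂ :=
  {s | ∃ (j : Fin P.p) (k : ℕ), (j : ℕ) < P.n ∧ s = (P.a j - 1 - k) / P.A j}

/-- The contour separates the two families of poles. -/
def FoxData.Separates (P : FoxData) {κ : ContourKind} (L : MBContour κ) : Prop :=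
  (∀ s ∈ P.rightPoles, L.IsRight s) ∧ ∀ s ∈ P.leftPoles, L.IsLeft s

open Classical in
/-- The Fox H-function `H(z) = (2πi)⁻¹ ∫_L θ(s) z^s ds`, with a contour `L` of the given shape that
separates the poles (its value does not depend on which one). -/
def foxH (κ : ContourKind) (P : FoxData) (z : ℂ) : ℂ :=
  if h : ∃ L : MBContour κ, P.Separates L then
    (2 * Real.pi * Complex.I)⁻¹ * h.choose.integral (fun s => P.theta s * z ^ s)
  else 0

/-- `∑_{j ≤ n} A_j - ∑_{j > n} A_j + ∑_{j ≤ m} B_j - ∑_{j > m} B_j`. -/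
def FoxData.aStar (P : FoxData) : ℝ :=
  (∑ j : Fin P.p, if (j : ℕ) < P.n then P.A j else -P.A j) +
  ∑ j : Fin P.q, if (j : ℕ) < P.m then P.B j else -P.B j

/-- `∑ B_j - ∑ A_j`. -/
def FoxData.bigDelta (P : FoxData) : ℝ := (∑ j, P.B j) - ∑ j, P.A j

/-- `∏ A_j^{-A_j} ∏ B_j^{B_j}`. -/
def FoxData.smallDelta (P : FoxData) : ℝ :=
  (∏ j, P.A j ^ (-P.A j)) * ∏ j, P.B j ^ P.B j

/-- The usual existence conditions for the H-function at `z ≠ 0`: no pole of the first family is a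
pole of the second one, and the Mellin-Barnes integral over a contour of the given shape converges
absolutely because of the standard conditions on the parameters. -/
def FoxData.Exists (κ : ContourKind) (P : FoxData) (z : ℂ) : Prop :=
  z ≠ 0 ∧ Disjoint P.rightPoles P.leftPoles ∧
  match κ with
    | .vertical => 0 < P.aStar ∧ |z.arg| < Real.pi / 2 * P.aStar
    | .loop => 0 < P.bigDelta ∨ (P.bigDelta = 0 ∧ ‖z‖ < P.smallDelta)

/-! ### The H-function of two variables -/

/-- The parameters `(a_j; A_j, A'_j)_{1,p} ; (b_j; B_j, B'_j)_{1,q}` of the H-function of two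
variables that involve both variables; the first `n` of the upper ones are in the numerator. -/
structure FoxCoupling where
  n : ℕ
  p : ℕ
  q : ℕ
  n_le : n ≤ p
  a : Fin p → ℂ
  A : Fin p → ℝ
  A_pos : ∀ j, 0 < A j
  A' : Fin p → ℝ
  A'_pos : ∀ j, 0 < A' j
  b : Fin q → ℂ
  B : Fin q → ℝ
  B_pos : ∀ j, 0 < B j
  B' : Fin q → ℝ
  B'_pos : ∀ j, 0 < B' j

/-- `∏_{j ≤ n} Γ(1 - a_j + A_j ξ + A'_j η) /
  (∏_{j > n} Γ(a_j - A_j ξ - A'_j η) ∏_j Γ(1 - b_j + B_j ξ + B'_j η))`. -/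
def FoxCoupling.theta (C : FoxCoupling) (ξ η : ℂ) : ℂ :=
  (∏ j : Fin C.p, if (j : ℕ) < C.n then Complex.Gamma (1 - C.a j + C.A j * ξ + C.A' j * η)
    else (Complex.Gamma (C.a j - C.A j * ξ - C.A' j * η))⁻¹) *
  ∏ j : Fin C.q, (Complex.Gamma (1 - C.b j + C.B j * ξ + C.B' j * η))⁻¹

/-- Contours for the double Mellin-Barnes integral: each separates the poles that belong to its own
variable, and all poles of the numerator factors `Γ(1 - a_j + A_j ξ + A'_j η)` lie to the left,
because these factors are only evaluated in the right half-plane. -/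
def FoxCoupling.Admissible (C : FoxCoupling) (P₁ P₂ : FoxData) {κ₁ κ₂ : ContourKind}
    (L₁ : MBContour κ₁) (L₂ : MBContour κ₂) : Prop :=
  P₁.Separates L₁ ∧ P₂.Separates L₂ ∧
  ∀ ξ ∈ L₁.support, ∀ η ∈ L₂.support, ∀ j : Fin C.p, (j : ℕ) < C.n →
    0 < (1 - C.a j + C.A j * ξ + C.A' j * η).re

open Classical in
/-- The H-function of two variables
`H^{0,n:m₁,n₁;m₂,n₂}_{p,q:p₁,q₁;p₂,q₂}[z₁, z₂] =
  (2πi)⁻² ∫_{L₁} ∫_{L₂} θ(ξ, η) θ₁(ξ) θ₂(η) z₁^ξ z₂^η dη dξ`. -/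
def foxH₂ (κ₁ κ₂ : ContourKind) (C : FoxCoupling) (P₁ P₂ : FoxData) (z₁ z₂ : ℂ) : ℂ :=
  if h : ∃ L : MBContour κ₁ × MBContour κ₂, C.Admissible P₁ P₂ L.1 L.2 then
    ((2 * Real.pi * Complex.I) ^ 2)⁻¹ *
      h.choose.1.integral (fun ξ => h.choose.2.integral (fun η =>
        C.theta ξ η * P₁.theta ξ * P₂.theta η * z₁ ^ ξ * z₂ ^ η))
  else 0

/-- The coupled parameters `(1 - β; α, 1) ; (1 - μ - β; α, 1)` with orders `0,1 ; 1,1`. -/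
def couplingParams (μ β : ℂ) (α : ℝ) (hα : 0 < α) : FoxCoupling where
  n := 1
  p := 1
  q := 1
  n_le := le_rfl
  a := fun _ => 1 - β
  A := fun _ => α
  A_pos := fun _ => hα
  A' := fun _ => 1
  A'_pos := fun _ => one_pos
  b := fun _ => 1 - μ - β
  B := fun _ => α
  B_pos := fun _ => hα
  B' := fun _ => 1
  B'_pos := fun _ => one_pos

/-- The parameters `(1 - μ - γ, 1) ; (0, 1)` with orders `1,1 ; 1,1`. -/
def secondParams (μ γ : ℂ) : FoxData where
  m := 1
  n := 1
  p := 1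
  q := 1
  m_le := le_rfl
  n_le := le_rfl
  a := fun _ => 1 - μ - γ
  A := fun _ => 1
  A_pos := fun _ => one_pos
  b := fun _ => 0
  B := fun _ => 1
  B_pos := fun _ => one_pos

/-! ### The operators -/

/-- `(I^{γ,μ}_{a+} f)(x) = (x-a)^{-μ-γ} / Γ(μ) ∫_a^x t^γ f(t) / (x-t)^{1-μ} dt`. -/
def saxenaIntegral (a : ℝ) (γ μ : ℂ) (f : ℝ → ℂ) (x : ℝ) : ℂ :=
  ((x - a : ℝ) : ℂ) ^ (-μ - γ) / Complex.Gamma μ *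
    ∫ t in a..x, (t : ℂ) ^ γ * f t / ((x - t : ℝ) : ℂ) ^ (1 - μ)

/-- `(x-t)^{β-1} H^{m,n}_{p,q}[w (x-t)^α]`. -/
def foxKernel (κ : ContourKind) (P : FoxData) (w : ℂ) (α : ℝ) (β : ℂ) (x t : ℝ) : ℂ :=
  ((x - t : ℝ) : ℂ) ^ (β - 1) * foxH κ P (w * (((x - t) ^ α : ℝ) : ℂ))

/-- `(𝓗^{w;m,n;α}_{a+;p,q;β} f)(x) = ∫_a^x (x-t)^{β-1} H^{m,n}_{p,q}[w (x-t)^α] f(t) dt`. -/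
def foxOperator (κ : ContourKind) (P : FoxData) (w : ℂ) (α : ℝ) (β : ℂ) (a : ℝ)
    (f : ℝ → ℂ) (x : ℝ) : ℂ :=
  ∫ t in a..x, foxKernel κ P w α β x t * f t

/-- The composition `𝓗 (I^{γ,μ}_{a+} φ)` is defined at `x` by absolutely convergent integrals. -/
def CompositionConverges (κ : ContourKind) (P : FoxData) (w : ℂ) (α : ℝ) (β γ μ : ℂ) (a x : ℝ)
    (φ : ℝ → ℂ) : Prop :=
  (∀ᵐ t ∂(volume.restrict (Ioo a x)),
    IntegrableOn (fun u : ℝ => (u : ℂ) ^ γ * φ u / ((t - u : ℝ) : ℂ) ^ (1 - μ)) (Ioo a t)) ∧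
  IntegrableOn (fun t : ℝ => foxKernel κ P w α β x t * ((t - a : ℝ) : ℂ) ^ (-μ - γ) *
    ((∫ u in a..t, ‖(u : ℂ) ^ γ * φ u / ((t - u : ℝ) : ℂ) ^ (1 - μ)‖ : ℝ) : ℂ)) (Ioo a x)

/-- The kernel of the composition:
`u^γ (x-u)^{μ+β-1} (x-a)^{-μ-γ} / Γ(μ+γ)` times
`H^{0,1:m,n;1,1}_{1,1:p,q;1,1}[w (x-u)^α, -(x-u)/(x-a)]`. The contour of the second variable is the
loop, the one that belongs to the condition `|(x-u)/(x-a)| < 1`. -/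
def compositionKernel (κ : ContourKind) (P : FoxData) (w : ℂ) (α : ℝ) (hα : 0 < α) (β γ μ : ℂ)
    (a x u : ℝ) : ℂ :=
  (u : ℂ) ^ γ * ((x - u : ℝ) : ℂ) ^ (μ + β - 1) *
    (((x - a : ℝ) : ℂ) ^ (-μ - γ) / Complex.Gamma (μ + γ)) *
    foxH₂ κ .loop (couplingParams μ β α hα) P (secondParams μ γ)
      (w * (((x - u) ^ α : ℝ) : ℂ)) ((-((x - u) / (x - a)) : ℝ) : ℂ)

end

/-!
The left-hand side is an iterated integral over the triangle `a < u < t < x`. Absolute convergence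
allows the order to be interchanged (`integrable_triangle`), and the theorem becomes an identity
between kernels: `∫_u^x (x-t)^{β-1} H[w(x-t)^α] (t-a)^{-μ-γ} (t-u)^{μ-1} dt` has to be expressed by
the H-function of two variables. The substitution `t = x - (x-u)τ` gives `t - a = (x-a)(1 - vτ)` with
`v = (x-u)/(x-a) ∈ (0, 1)`, and reduces this to the Euler integral `foxH₂_eq_integral`,
`H[z, -v] = Γ(μ+γ)/Γ(μ) ∫₀¹ τ^{β-1} (1-τ)^{μ-1} (1-vτ)^{-μ-γ} H[zτ^α] dτ`.

To obtain it, the quotient `Γ(β+αξ+η) / Γ(μ+β+αξ+η)` in the double Mellin-Barnes integral is written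
as `Γ(μ)⁻¹` times a Beta integral over `τ`. On admissible contours `Re (β+αξ+η)` has a positive
minimum, so that integral can be taken out of both contour integrals. The integral over `η` becomes
the Mellin-Barnes integral of a binomial series, `secondParams.integral_theta`, and yields
`(1-vτ)^{-μ-γ}`; the integral over `ξ` is `H[zτ^α]` itself.

The values `foxH` and `foxH₂` are defined by some separating contours, so the argument needs that
separating (and admissible) contours exist, `FoxData.exists_separates` and `exists_admissible`, that
the integrals over them converge absolutely, and that they do not depend on the contour,
`FoxData.Separates.foxH_eq`. Convergence rests on the size of the Gamma function:
`VerticalRate.gamma` compares it with `|Γ(1/2+iy)|² = π / cosh (πy)` in vertical strips, and Stirling's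
formula with the reflection formula gives `HorizontalRate` bounds in horizontal half-strips.
Independence of the contour, and the evaluation by residues of the integral over `η`, use a residue
theorem for circles and rectangles, `exists_hasResidues`, which is proved by subtracting principal
parts. For a contour that is closed by a segment far to the right, the residue at a pole is then
counted with `MBContour.side` minus one.

For the sufficient condition on `φ`, a contour to the right of a line on which `Re (β+αξ) = ε > 0`
shows that `(x-t)^{β-1} H[w(x-t)^α] = O((x-t)^{ε-1})` (`exists_norm_foxKernel_le`). The power
`(t-a)^{-Re(μ+γ)}` is bounded by `(u-a)^{-δ} ((x-u)/(t-u))^ρ` with `0 ≤ ρ < Re μ`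
(`sub_rpow_neg_le`); the remaining integral over `t` is a Beta integral, and Tonelli's theorem applies.
-/

noncomputable section

/-! ### Residues on circles and rectangles -/

open Filter Topology in
/-- The principal part of a meromorphic function at a point. -/
theorem MeromorphicAt.exists_principal_part {f : ℂ → ℂ} {p : ℂ} (hf : MeromorphicAt f p) :
    ∃ (n : ℕ) (c : ℕ → ℂ) (h : ℂ → ℂ), AnalyticAt ℂ h p ∧
      ∀ᶠ z in 𝓝[≠] p, f z = h z + ∑ i ∈ Finset.range n, c i * (z - p) ^ (-(i + 1 : ℤ)) := by
  obtain ⟨n, hn⟩ := hf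
  have key : ∀ (n : ℕ) (f g : ℂ → ℂ), AnalyticAt ℂ g p →
      (∀ᶠ z in 𝓝[≠] p, (z - p) ^ n * f z = g z) →
      ∃ (n : ℕ) (c : ℕ → ℂ) (h : ℂ → ℂ), AnalyticAt ℂ h p ∧
        ∀ᶠ z in 𝓝[≠] p, f z = h z + ∑ i ∈ Finset.range n, c i * (z - p) ^ (-(i + 1 : ℤ)) := by
    clear hn f
    intro n
    induction n with
    | zero =>
      intro f g hg hfg
      exact ⟨0, fun _ => 0, g, hg, by simpa using hfg⟩
    | succ n ih =>
      intro f g hg hfg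
      -- Removing the leading term lowers the order of the pole.
      obtain ⟨m, c, h, hh, hfh⟩ := ih (fun z => f z - g p * (z - p) ^ (-(n + 1 : ℤ))) (dslope g p)
        (by
          obtain ⟨q, hq⟩ := hg
          exact ⟨_, hq.has_fpower_series_dslope_fslope⟩) (by
          filter_upwards [hfg, self_mem_nhdsWithin] with z hz hzp
          have hzp' : z - p ≠ 0 := sub_ne_zero.2 hzp
          rw [dslope_of_ne _ hzp, slope_def_field, ← hz, zpow_neg,
            show (n + 1 : ℤ) = ((n + 1 : ℕ) : ℤ) by push_cast; ring, zpow_natCast]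
          field_simp
          ring)
      refine ⟨max m (n + 1), fun i => (if i < m then c i else 0) + if i = n then g p else 0, h, hh,
        ?_⟩
      filter_upwards [hfh] with z hz
      have : ∑ i ∈ Finset.range (max m (n + 1)),
          ((if i < m then c i else 0) + if i = n then g p else 0) * (z - p) ^ (-(i + 1 : ℤ)) =
          ∑ i ∈ Finset.range m, c i * (z - p) ^ (-(i + 1 : ℤ)) + g p * (z - p) ^ (-(n + 1 : ℤ)) := by
        simp only [add_mul, Finset.sum_add_distrib, ite_mul, zero_mul]
        congr 1
        · rw [← Finset.sum_filter]
          refine Finset.sum_congr ?_ fun _ _ => rfl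
          ext i
          simp only [Finset.mem_filter, Finset.mem_range]
          grind
        · rw [Finset.sum_ite_eq', if_pos]
          simp
      rw [this, ← add_assoc, ← hz]
      ring
  exact key n f _ hn (by filter_upwards with z; rfl)

theorem analyticAt_sub_zpow {p z : ℂ} (h : z ≠ p) (k : ℤ) :
    AnalyticAt ℂ (fun z => (z - p) ^ k) z :=
  AnalyticAt.fun_zpow (by fun_prop) (sub_ne_zero.2 h)

/-- The integral of `f` over the counterclockwise boundary of `[x₀, x₁] × [y₀, y₁]`. -/
def rectIntegral (f : ℂ → ℂ) (x₀ x₁ y₀ y₁ : ℝ) : ℂ :=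
  (∫ x in x₀..x₁, f (x + y₀ * Complex.I)) - (∫ x in x₀..x₁, f (x + y₁ * Complex.I)) +
    Complex.I * (∫ y in y₀..y₁, f (x₁ + y * Complex.I)) -
    Complex.I * (∫ y in y₀..y₁, f (x₀ + y * Complex.I))

/-- The closed rectangle `[x₀, x₁] × [y₀, y₁]`. -/
def closedRect (x₀ x₁ y₀ y₁ : ℝ) : Set ℂ := {s | s.re ∈ Icc x₀ x₁ ∧ s.im ∈ Icc y₀ y₁}

/-- The open rectangle `(x₀, x₁) × (y₀, y₁)`. -/
def openRect (x₀ x₁ y₀ y₁ : ℝ) : Set ℂ := {s | s.re ∈ Ioo x₀ x₁ ∧ s.im ∈ Ioo y₀ y₁}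

section Rect

variable {f g : ℂ → ℂ} {x₀ x₁ y₀ y₁ : ℝ}

theorem rect_sides_continuousOn (hx : x₀ ≤ x₁) (hy : y₀ ≤ y₁)
    (hf : ContinuousOn f (closedRect x₀ x₁ y₀ y₁ \ openRect x₀ x₁ y₀ y₁)) :
    ContinuousOn (fun x : ℝ => f (x + y₀ * Complex.I)) (uIcc x₀ x₁) ∧
    ContinuousOn (fun x : ℝ => f (x + y₁ * Complex.I)) (uIcc x₀ x₁) ∧
    ContinuousOn (fun y : ℝ => f (x₁ + y * Complex.I)) (uIcc y₀ y₁) ∧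
    ContinuousOn (fun y : ℝ => f (x₀ + y * Complex.I)) (uIcc y₀ y₁) := by
  rw [uIcc_of_le hx, uIcc_of_le hy]
  refine ⟨hf.comp (by fun_prop) ?_, hf.comp (by fun_prop) ?_, hf.comp (by fun_prop) ?_,
    hf.comp (by fun_prop) ?_⟩ <;>
  · intro t ht
    simp [closedRect, openRect] at ht ⊢
    grind

theorem rectIntegral_congr (hx : x₀ ≤ x₁) (hy : y₀ ≤ y₁)
    (h : ∀ z ∈ closedRect x₀ x₁ y₀ y₁ \ openRect x₀ x₁ y₀ y₁, f z = g z) :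
    rectIntegral f x₀ x₁ y₀ y₁ = rectIntegral g x₀ x₁ y₀ y₁ := by
  unfold rectIntegral
  congr 1
  · congr 1
    · congr 1 <;>
      · refine intervalIntegral.integral_congr fun t ht => h _ ?_
        rw [uIcc_of_le hx] at ht
        simp [closedRect, openRect] at ht ⊢
        grind
    · congr 1
      refine intervalIntegral.integral_congr fun t ht => h _ ?_
      rw [uIcc_of_le hy] at ht
      simp [closedRect, openRect] at ht ⊢
      grind
  · congr 1
    refine intervalIntegral.integral_congr fun t ht => h _ ?_
    rw [uIcc_of_le hy] at ht
    simp [closedRect, openRect] at ht ⊢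
    grind

theorem rectIntegral_add (hx : x₀ ≤ x₁) (hy : y₀ ≤ y₁)
    (hf : ContinuousOn f (closedRect x₀ x₁ y₀ y₁ \ openRect x₀ x₁ y₀ y₁))
    (hg : ContinuousOn g (closedRect x₀ x₁ y₀ y₁ \ openRect x₀ x₁ y₀ y₁)) :
    rectIntegral (fun z => f z + g z) x₀ x₁ y₀ y₁ =
      rectIntegral f x₀ x₁ y₀ y₁ + rectIntegral g x₀ x₁ y₀ y₁ := by
  obtain ⟨f1, f2, f3, f4⟩ := rect_sides_continuousOn hx hy hf
  obtain ⟨g1, g2, g3, g4⟩ := rect_sides_continuousOn hx hy hg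
  unfold rectIntegral
  rw [intervalIntegral.integral_add f1.intervalIntegrable g1.intervalIntegrable,
    intervalIntegral.integral_add f2.intervalIntegrable g2.intervalIntegrable,
    intervalIntegral.integral_add f3.intervalIntegrable g3.intervalIntegrable,
    intervalIntegral.integral_add f4.intervalIntegrable g4.intervalIntegrable]
  ring

theorem rectIntegral_const_mul (c : ℂ) :
    rectIntegral (fun z => c * f z) x₀ x₁ y₀ y₁ = c * rectIntegral f x₀ x₁ y₀ y₁ := by
  unfold rectIntegral
  simp only [intervalIntegral.integral_const_mul]
  ring

theorem rectIntegral_eq_zero_of_differentiableOn (hx : x₀ ≤ x₁) (hy : y₀ ≤ y₁)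
    (hf : DifferentiableOn ℂ f (closedRect x₀ x₁ y₀ y₁)) : rectIntegral f x₀ x₁ y₀ y₁ = 0 := by
  have := Complex.integral_boundary_rect_eq_zero_of_differentiableOn f ⟨x₀, y₀⟩ ⟨x₁, y₁⟩ (by
    change DifferentiableOn ℂ f (uIcc x₀ x₁ ×ℂ uIcc y₀ y₁)
    rw [uIcc_of_le hx, uIcc_of_le hy]
    exact hf)
  simpa [rectIntegral] using this

theorem hasDerivAt_add_mul_I (c y : ℝ) :
    HasDerivAt (fun t : ℝ => (c + t * Complex.I : ℂ)) Complex.I y := by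
  simpa using ((Complex.ofRealCLM.hasDerivAt (x := y)).mul_const Complex.I).const_add (c : ℂ)

theorem hasDerivAt_ofReal_add (c : ℂ) (x : ℝ) :
    HasDerivAt (fun t : ℝ => (t + c : ℂ)) 1 x := by
  simpa using (Complex.ofRealCLM.hasDerivAt (x := x)).add_const c

/-- A function with a primitive along the vertical segment. -/
theorem integral_vertical_of_hasDerivAt {Φ : ℂ → ℂ} {c y₀ y₁ : ℝ}
    (hΦ : ∀ y ∈ uIcc y₀ y₁, HasDerivAt Φ (f (c + y * Complex.I)) (c + y * Complex.I))
    (hf : ContinuousOn (fun y : ℝ => f (c + y * Complex.I)) (uIcc y₀ y₁)) :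
    Complex.I * ∫ y in y₀..y₁, f (c + y * Complex.I) =
      Φ (c + y₁ * Complex.I) - Φ (c + y₀ * Complex.I) := by
  rw [← intervalIntegral.integral_const_mul,
    intervalIntegral.integral_eq_sub_of_hasDerivAt (f := fun y : ℝ => Φ (c + y * Complex.I))]
  · intro y hy
    have := HasDerivAt.comp y (hΦ y hy) (hasDerivAt_add_mul_I c y)
    rwa [mul_comm] at this
  · exact (continuousOn_const.mul hf).intervalIntegrable

/-- A function with a primitive along the horizontal segment. -/
theorem integral_horizontal_of_hasDerivAt {Φ : ℂ → ℂ} {c : ℂ} {x₀ x₁ : ℝ}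
    (hΦ : ∀ x ∈ uIcc x₀ x₁, HasDerivAt Φ (f (x + c)) (x + c))
    (hf : ContinuousOn (fun x : ℝ => f (x + c)) (uIcc x₀ x₁)) :
    ∫ x in x₀..x₁, f (x + c) = Φ (x₁ + c) - Φ (x₀ + c) := by
  rw [intervalIntegral.integral_eq_sub_of_hasDerivAt (f := fun x : ℝ => Φ (x + c))]
  · intro x hx
    have := HasDerivAt.comp x (hΦ x hx) (hasDerivAt_ofReal_add c x)
    rwa [mul_one] at this
  · exact hf.intervalIntegrable

theorem rectIntegral_eq_zero_of_hasDerivAt {Φ : ℂ → ℂ} (hx : x₀ ≤ x₁) (hy : y₀ ≤ y₁)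
    (hΦ : ∀ z ∈ closedRect x₀ x₁ y₀ y₁ \ openRect x₀ x₁ y₀ y₁, HasDerivAt Φ (f z) z)
    (hf : ContinuousOn f (closedRect x₀ x₁ y₀ y₁ \ openRect x₀ x₁ y₀ y₁)) :
    rectIntegral f x₀ x₁ y₀ y₁ = 0 := by
  obtain ⟨f1, f2, f3, f4⟩ := rect_sides_continuousOn hx hy hf
  unfold rectIntegral
  rw [integral_horizontal_of_hasDerivAt (Φ := Φ) _ f1,
    integral_horizontal_of_hasDerivAt (Φ := Φ) _ f2,
    integral_vertical_of_hasDerivAt (Φ := Φ) _ f3, integral_vertical_of_hasDerivAt (Φ := Φ) _ f4]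
  · ring
  all_goals
    intro t ht
    first | rw [uIcc_of_le hx] at ht | rw [uIcc_of_le hy] at ht
    refine hΦ _ ?_
    simp [closedRect, openRect] at ht ⊢
    grind

/-- The boundary of a rectangle winds once around an interior point: on each side `(z - p)⁻¹` has a
logarithm as a primitive, and the two branches that are used differ by `πi` above and below `p`. -/
theorem rectIntegral_sub_inv {p : ℂ} (hp : p ∈ openRect x₀ x₁ y₀ y₁) :
    rectIntegral (fun z => (z - p)⁻¹) x₀ x₁ y₀ y₁ = 2 * Real.pi * Complex.I := by
  obtain ⟨⟨h1, h2⟩, h3, h4⟩ := hp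
  have hx : x₀ ≤ x₁ := by linarith
  have hy : y₀ ≤ y₁ := by linarith
  have hc : ContinuousOn (fun z => (z - p)⁻¹)
      (closedRect x₀ x₁ y₀ y₁ \ openRect x₀ x₁ y₀ y₁) := by
    refine ContinuousOn.inv₀ (by fun_prop) fun z hz h => hz.2 ?_
    rw [sub_eq_zero.1 h]
    exact ⟨⟨h1, h2⟩, h3, h4⟩
  obtain ⟨f1, f2, f3, f4⟩ := rect_sides_continuousOn hx hy hc
  have hlog : ∀ z : ℂ, z - p ∈ Complex.slitPlane →
      HasDerivAt (fun z => Complex.log (z - p)) (z - p)⁻¹ z := by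
    intro z hz
    simpa using ((hasDerivAt_id' z).sub_const p).clog hz
  have hlog' : ∀ z : ℂ, p - z ∈ Complex.slitPlane →
      HasDerivAt (fun z => Complex.log (p - z)) (z - p)⁻¹ z := by
    intro z hz
    refine (((hasDerivAt_id' z).const_sub p).clog hz).congr_deriv ?_
    rw [← neg_sub p z, inv_neg, neg_div, one_div]
  have e1 : ∀ y : ℝ, ContinuousOn (fun x : ℝ => ((x : ℂ) + y * Complex.I - p)⁻¹) (uIcc x₀ x₁) →
      (∀ x ∈ uIcc x₀ x₁, (x : ℂ) + y * Complex.I - p ∈ Complex.slitPlane) →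
      ∫ x in x₀..x₁, ((x : ℂ) + y * Complex.I - p)⁻¹ =
        Complex.log (x₁ + y * Complex.I - p) - Complex.log (x₀ + y * Complex.I - p) :=
    fun y hf hs => integral_horizontal_of_hasDerivAt (f := fun z => (z - p)⁻¹)
      (Φ := fun z => Complex.log (z - p)) (fun x hx => hlog _ (hs x hx)) hf
  have e2 : Complex.I * ∫ y in y₀..y₁, ((x₁ : ℂ) + y * Complex.I - p)⁻¹ =
      Complex.log (x₁ + y₁ * Complex.I - p) - Complex.log (x₁ + y₀ * Complex.I - p) :=
    integral_vertical_of_hasDerivAt (f := fun z => (z - p)⁻¹)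
      (Φ := fun z => Complex.log (z - p))
      (fun y _ => hlog _ (Or.inl (by simpa using h2))) f3
  have e3 : Complex.I * ∫ y in y₀..y₁, ((x₀ : ℂ) + y * Complex.I - p)⁻¹ =
      Complex.log (p - (x₀ + y₁ * Complex.I)) - Complex.log (p - (x₀ + y₀ * Complex.I)) :=
    integral_vertical_of_hasDerivAt (f := fun z => (z - p)⁻¹)
      (Φ := fun z => Complex.log (p - z))
      (fun y _ => hlog' _ (Or.inl (by simpa using h1))) f4
  unfold rectIntegral
  -- On the left side the branch `log (p - z)` is used, since the others cross its cut.
  rw [e1 y₀ f1 fun x _ => Or.inr (by simpa using (sub_neg.2 h3).ne),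
    e1 y₁ f2 fun x _ => Or.inr (by simpa using (sub_pos.2 h4).ne'), e2, e3]
  have hA : Complex.log (p - (x₀ + y₁ * Complex.I)) =
      Complex.log (x₀ + y₁ * Complex.I - p) - Real.pi * Complex.I := by
    rw [← neg_sub, Complex.log, Complex.log, norm_neg,
      Complex.arg_neg_eq_arg_sub_pi_of_im_pos (by simpa using h4)]
    push_cast
    ring
  have hB : Complex.log (p - (x₀ + y₀ * Complex.I)) =
      Complex.log (x₀ + y₀ * Complex.I - p) + Real.pi * Complex.I := by
    rw [← neg_sub, Complex.log, Complex.log, norm_neg,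
      Complex.arg_neg_eq_arg_add_pi_of_im_neg (by simpa using h3)]
    push_cast
    ring
  simp only [hA, hB]
  ring

theorem rectIntegral_sub_zpow {p : ℂ} (hx : x₀ ≤ x₁) (hy : y₀ ≤ y₁)
    (hp : p ∈ closedRect x₀ x₁ y₀ y₁ → p ∈ openRect x₀ x₁ y₀ y₁) (i : ℕ)
    [Decidable (p ∈ openRect x₀ x₁ y₀ y₁)] :
    rectIntegral (fun z => (z - p) ^ (-(i + 1 : ℤ))) x₀ x₁ y₀ y₁ =
      if i = 0 ∧ p ∈ openRect x₀ x₁ y₀ y₁ then 2 * Real.pi * Complex.I else 0 := by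
  have hne : ∀ z ∈ closedRect x₀ x₁ y₀ y₁ \ openRect x₀ x₁ y₀ y₁, z - p ≠ 0 := by
    intro z hz h
    rw [sub_eq_zero.1 h] at hz
    exact hz.2 (hp hz.1)
  split_ifs with h
  · obtain ⟨rfl, h⟩ := h
    simpa using rectIntegral_sub_inv h
  · by_cases hi : i = 0
    · subst hi
      refine rectIntegral_eq_zero_of_differentiableOn hx hy fun z hz => ?_
      have : z - p ≠ 0 := by
        intro h0
        rw [sub_eq_zero.1 h0] at hz
        exact h ⟨rfl, hp hz⟩
      exact (analyticAt_sub_zpow (sub_ne_zero.1 this) _).differentiableAt.differentiableWithinAt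
    · refine rectIntegral_eq_zero_of_hasDerivAt hx hy
        (Φ := fun z => (-(i : ℂ))⁻¹ * (z - p) ^ (-(i : ℤ))) (fun z hz => ?_) fun z hz => ?_
      · refine ((HasDerivAt.comp z (hasDerivAt_zpow (-(i : ℤ)) (z - p) (Or.inl (hne z hz)))
          ((hasDerivAt_id z).sub_const p)).const_mul ((-(i : ℂ))⁻¹)).congr_deriv ?_
        have hi' : (i : ℂ) ≠ 0 := by exact_mod_cast hi
        push_cast
        rw [show (-(i : ℤ) - 1) = -(i + 1 : ℤ) by ring]
        field_simp
      · exact (analyticAt_sub_zpow (sub_ne_zero.1 (hne z hz)) _).continuousAt.continuousWithinAt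

end Rect

theorem circleIntegral_sub_zpow {p c : ℂ} {r : ℝ} (hr : 0 < r) (hp : p ∉ Metric.sphere c r)
    (i : ℕ)
    [Decidable (p ∈ Metric.ball c r)] :
    (∮ z in C(c, r), (z - p) ^ (-(i + 1 : ℤ))) =
      if i = 0 ∧ p ∈ Metric.ball c r then 2 * Real.pi * Complex.I else 0 := by
  split_ifs with h
  · obtain ⟨rfl, h⟩ := h
    simpa using circleIntegral.integral_sub_inv_of_mem_ball h
  · by_cases hi : i = 0
    · subst hi
      have hne : ∀ z ∈ Metric.closedBall c r, z - p ≠ 0 := by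
        intro z hz h0
        rw [sub_eq_zero.1 h0, ← Metric.ball_union_sphere] at hz
        exact hz.elim (fun h' => h ⟨rfl, h'⟩) hp
      refine Complex.circleIntegral_eq_zero_of_differentiable_on_off_countable hr.le
        countable_empty (fun z hz => ?_) fun z hz => ?_
      · exact (analyticAt_sub_zpow (sub_ne_zero.1 (hne z hz)) _).continuousAt.continuousWithinAt
      · exact (analyticAt_sub_zpow
          (sub_ne_zero.1 (hne z (Metric.ball_subset_closedBall hz.1))) _).differentiableAt
    · exact circleIntegral.integral_sub_zpow_of_ne (by omega) _ _ _

open Classical in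
/-- The function `res` computes the integrals of `f` over all circles and rectangles in `U` that
avoid the finite set `F`: it is a residue function for `f`, whose poles in `U` lie in `F`. -/
structure HasResidues (f : ℂ → ℂ) (U : Set ℂ) (F : Finset ℂ) (res : ℂ → ℂ) : Prop where
  circle : ∀ c r, 0 < r → Metric.closedBall c r ⊆ U → (∀ p ∈ F, p ∉ Metric.sphere c r) →
    (∮ z in C(c, r), f z) =
      2 * Real.pi * Complex.I * ∑ p ∈ F, if p ∈ Metric.ball c r then res p else 0
  rect : ∀ x₀ x₁ y₀ y₁, x₀ ≤ x₁ → y₀ ≤ y₁ → closedRect x₀ x₁ y₀ y₁ ⊆ U →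
    (∀ p ∈ F, p ∈ closedRect x₀ x₁ y₀ y₁ → p ∈ openRect x₀ x₁ y₀ y₁) →
    rectIntegral f x₀ x₁ y₀ y₁ =
      2 * Real.pi * Complex.I * ∑ p ∈ F, if p ∈ openRect x₀ x₁ y₀ y₁ then res p else 0

open Classical in
/-- The residue theorem for a function with finitely many poles, by induction on their number: a
principal part is subtracted at each step. -/
theorem exists_hasResidues {U : Set ℂ} (F : Finset ℂ) :
    ∀ (f : ℂ → ℂ), (∀ z ∈ U, z ∉ F → DifferentiableAt ℂ f z) →
    (∀ p ∈ F, MeromorphicAt f p) → ∃ res : ℂ → ℂ, HasResidues f U F res := by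
  induction F using Finset.induction_on with
  | empty =>
    intro f hd _
    refine ⟨fun _ => 0, fun c r hr hc _ => ?_, fun x₀ x₁ y₀ y₁ hx hy hc _ => ?_⟩
    · rw [Complex.circleIntegral_eq_zero_of_differentiable_on_off_countable hr.le countable_empty]
      · simp
      · exact fun z hz => (hd z (hc hz) (by simp)).continuousAt.continuousWithinAt
      · exact fun z hz => hd z (hc (Metric.ball_subset_closedBall hz.1)) (by simp)
    · rw [rectIntegral_eq_zero_of_differentiableOn hx hy]
      · simp
      · exact fun z hz => (hd z (hc hz) (by simp)).differentiableWithinAt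
  | insert p F hpF ih =>
    intro f hd hm
    obtain ⟨n, c, h, hh, hfh⟩ := (hm p (Finset.mem_insert_self _ _)).exists_principal_part
    set pp : ℂ → ℂ := fun z => ∑ i ∈ Finset.range n, c i * (z - p) ^ (-(i + 1 : ℤ)) with hpp
    have hppd : ∀ z, z ≠ p → AnalyticAt ℂ pp z := by
      intro z hz
      exact Finset.analyticAt_fun_sum _ fun i _ => analyticAt_const.mul (analyticAt_sub_zpow hz _)
    -- `f` without its principal part at `p`, with the removable singularity removed.
    set g : ℂ → ℂ := Function.update (fun z => f z - pp z) p (h p) with hg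
    have hgne : ∀ z, z ≠ p → g z = f z - pp z := fun z hz => Function.update_of_ne hz _ _
    have hgev : ∀ z, z ≠ p → g =ᶠ[nhds z] fun z => f z - pp z := by
      intro z hz
      filter_upwards [isOpen_ne.mem_nhds hz] with w hw using hgne w hw
    have hgp : g =ᶠ[nhds p] h := by
      rw [Filter.EventuallyEq, ← nhdsNE_sup_pure, Filter.eventually_sup]
      refine ⟨?_, by simp [hg]⟩
      filter_upwards [hfh, self_mem_nhdsWithin] with z hz hzp
      rw [hgne z hzp, hz]
      ring
    obtain ⟨res, ⟨hres1, hres2⟩⟩ := ih g (fun z hz hzF => by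
      by_cases hzp : z = p
      · subst hzp
        exact hh.differentiableAt.congr_of_eventuallyEq hgp
      · exact ((hd z hz (by simp [hzp, hzF])).sub
          (hppd z hzp).differentiableAt).congr_of_eventuallyEq (hgev z hzp)) (fun q hq => by
      have hqp : q ≠ p := fun e => hpF (e ▸ hq)
      exact ((hm q (Finset.mem_insert_of_mem hq)).sub (hppd q hqp).meromorphicAt).congr
        ((hgev q hqp).symm.filter_mono nhdsWithin_le_nhds))
    set r₀ : ℂ := if 0 < n then c 0 else 0 with hr₀
    have hsum : ∀ (P : Prop) [Decidable P], ∑ i ∈ Finset.range n,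
        c i * (if i = 0 ∧ P then 2 * Real.pi * Complex.I else 0) =
        2 * Real.pi * Complex.I * if P then r₀ else 0 := by
      intro P _
      by_cases hP : P
      · simp only [hP, and_true, if_true, mul_ite, mul_zero, Finset.sum_ite_eq', Finset.mem_range,
          hr₀]
        split_ifs <;> ring
      · simp [hP]
    have hupd : ∀ (P : ℂ → Prop) [DecidablePred P],
        (2 * Real.pi * Complex.I * ∑ q ∈ F, if P q then res q else 0) +
          2 * Real.pi * Complex.I * (if P p then r₀ else 0) =
        2 * Real.pi * Complex.I *
          ∑ q ∈ insert p F, if P q then Function.update res p r₀ q else 0 := by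
      intro P _
      rw [Finset.sum_insert hpF, Function.update_self, mul_add, add_comm]
      congr 2
      refine Finset.sum_congr rfl fun q hq => ?_
      rw [Function.update_of_ne (show q ≠ p from fun e => hpF (e ▸ hq))]
    refine ⟨Function.update res p r₀, fun a r hr hc hF => ?_,
      fun x₀ x₁ y₀ y₁ hx hy hc hF => ?_⟩
    · have hp := hF p (Finset.mem_insert_self _ _)
      have hne : ∀ z ∈ Metric.sphere a r, z ≠ p := fun z hz e => hp (e ▸ hz)
      rw [← hupd (fun q => q ∈ Metric.ball a r), ← hres1 a r hr hc fun q hq =>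
        hF q (Finset.mem_insert_of_mem hq), ← hsum]
      simp only [← circleIntegral_sub_zpow hr hp]
      have hcz : ∀ i : ℕ, CircleIntegrable (fun z => c i * (z - p) ^ (-(i + 1 : ℤ))) a r := by
        intro i
        refine ContinuousOn.circleIntegrable hr.le fun z hz => ?_
        exact (continuousAt_const.mul
          (analyticAt_sub_zpow (hne z hz) _).continuousAt).continuousWithinAt
      simp only [← circleIntegral.integral_const_mul]
      rw [← circleIntegral.integral_fun_sum fun i _ => hcz i, ← circleIntegral.integral_add]
      · refine circleIntegral.integral_congr hr.le fun z hz => ?_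
        simp only [hgne z (hne z hz), hpp]
        ring
      · refine ContinuousOn.circleIntegrable hr.le fun z hz => ?_
        refine (ContinuousAt.congr ?_ (hgev z (hne z hz)).symm).continuousWithinAt
        refine ContinuousAt.sub (hd z (hc (Metric.sphere_subset_closedBall hz))
          fun hz' => hF z hz' hz).continuousAt (hppd z (hne z hz)).continuousAt
      · have := CircleIntegrable.sum (Finset.range n) fun i _ => hcz i
        rwa [Finset.sum_fn] at this
    · have hp := hF p (Finset.mem_insert_self _ _)
      have hne : ∀ z ∈ closedRect x₀ x₁ y₀ y₁ \ openRect x₀ x₁ y₀ y₁, z ≠ p :=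
        by
          rintro z hz rfl
          exact hz.2 (hp hz.1)
      rw [← hupd (fun q => q ∈ openRect x₀ x₁ y₀ y₁), ← hres2 x₀ x₁ y₀ y₁ hx hy hc fun q hq =>
        hF q (Finset.mem_insert_of_mem hq), ← hsum]
      simp only [← rectIntegral_sub_zpow hx hy hp, ← rectIntegral_const_mul]
      have hcz : ∀ i : ℕ, ContinuousOn (fun z => c i * (z - p) ^ (-(i + 1 : ℤ)))
          (closedRect x₀ x₁ y₀ y₁ \ openRect x₀ x₁ y₀ y₁) := by
        intro i z hz
        exact (continuousAt_const.mul
          (analyticAt_sub_zpow (hne z hz) _).continuousAt).continuousWithinAt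
      have hs : ∀ m : ℕ, ∑ i ∈ Finset.range m,
          rectIntegral (fun z => c i * (z - p) ^ (-(i + 1 : ℤ))) x₀ x₁ y₀ y₁ =
          rectIntegral (fun z => ∑ i ∈ Finset.range m, c i * (z - p) ^ (-(i + 1 : ℤ)))
            x₀ x₁ y₀ y₁ := by
        intro m
        induction m with
        | zero => simp [rectIntegral]
        | succ m ihm =>
          simp only [Finset.sum_range_succ, ihm]
          rw [← rectIntegral_add hx hy (continuousOn_finsetSum _ fun i _ => hcz i) (hcz m)]
      rw [hs, ← rectIntegral_add hx hy]
      · refine rectIntegral_congr hx hy fun z hz => ?_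
        simp only [hgne z (hne z hz), hpp]
        ring
      · intro z hz
        refine (ContinuousAt.congr ?_ (hgev z (hne z hz)).symm).continuousWithinAt
        refine ContinuousAt.sub (hd z (hc hz.1)
          fun hz' => hz.2 (hF z hz' hz.1)).continuousAt (hppd z (hne z hz)).continuousAt
      · exact continuousOn_finsetSum _ fun i _ => hcz i

/-! ### Integration over Mellin-Barnes contours -/

namespace MBContour

variable {κ : ContourKind} (L : MBContour κ)

/-- The parameter domains of the arcs of a contour: up to three arcs for the main part (the unused
ones have an empty domain), then the circles. -/
def dom : Fin 3 ⊕ Fin L.k → Set ℝ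
  | .inl 0 => match κ with
    | .vertical => univ
    | .loop => Ioi L.c
  | .inl 1 => match κ with
    | .vertical => ∅
    | .loop => Ioc (-L.h) L.h
  | .inl 2 => match κ with
    | .vertical => ∅
    | .loop => Ioi L.c
  | .inr _ => Ioc 0 (2 * Real.pi)

/-- The parametrizations of the arcs of a contour. -/
def path : Fin 3 ⊕ Fin L.k → ℝ → ℂ
  | .inl 0 => match κ with
    | .vertical => fun y => L.c + y * Complex.I
    | .loop => fun r => r - L.h * Complex.I
  | .inl 1 => fun y => L.c + y * Complex.I
  | .inl 2 => fun r => r + L.h * Complex.I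
  | .inr i => circleMap (L.center i) (L.radius i)

/-- The derivatives of the parametrizations `MBContour.path`, with orientation and multiplicity. -/
def speed : Fin 3 ⊕ Fin L.k → ℝ → ℂ
  | .inl 0 => match κ with
    | .vertical => fun _ => Complex.I
    | .loop => fun _ => -1
  | .inl 1 => fun _ => Complex.I
  | .inl 2 => fun _ => 1
  | .inr i => fun θ => L.mult i * (circleMap 0 (L.radius i) θ * Complex.I)

theorem measurableSet_dom (j) : MeasurableSet (L.dom j) := by
  rcases j with j | j
  · fin_cases j <;> cases κ <;> simp [dom]
  · simp [dom]

theorem continuous_path (j) : Continuous (L.path j) := by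
  rcases j with j | j
  · fin_cases j <;> cases κ <;> simp only [path] <;> fun_prop
  · simp only [path]; fun_prop

theorem continuous_speed (j) : Continuous (L.speed j) := by
  rcases j with j | j
  · fin_cases j <;> cases κ <;> simp only [speed] <;> fun_prop
  · simp only [speed]; fun_prop

theorem path_mem_support (j) {x : ℝ} (hx : x ∈ L.dom j) : L.path j x ∈ L.support := by
  have hh := L.h_pos
  rcases j with j | j
  · left
    fin_cases j <;> cases κ <;> simp [dom, path] at hx ⊢
    · exact Or.inr ⟨hx.le, hh.le⟩
    · exact Or.inl (abs_le.2 ⟨hx.1.le, hx.2⟩)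
    · exact Or.inr ⟨hx.le, hh.le⟩
  · right
    exact mem_iUnion.2 ⟨j, circleMap_mem_sphere _ (L.radius_pos j).le _⟩

theorem integral_eq_sum (f : ℂ → ℂ) :
    L.integral f = ∑ j, ∫ x in L.dom j, L.speed j x * f (L.path j x) := by
  have hh := L.h_pos
  rw [Fintype.sum_sum_type, Fin.sum_univ_three]
  simp only [MBContour.integral]
  congr 1
  · cases κ
    · simp [dom, path, speed, integral_const_mul]
    · simp only [dom, path, speed, neg_one_mul, one_mul]
      rw [intervalIntegral.integral_of_le (by linarith), integral_neg, integral_const_mul]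
  · refine Finset.sum_congr rfl fun i _ => ?_
    simp only [dom, path, speed, circleIntegral, deriv_circleMap, mul_assoc, smul_eq_mul]
    rw [intervalIntegral.integral_of_le Real.two_pi_pos.le, integral_const_mul]

/-- Absolute integrability over a contour. -/
def Integrable (f : ℂ → ℂ) : Prop :=
  ∀ j, IntegrableOn (fun x => L.speed j x * f (L.path j x)) (L.dom j)

/-- The integral of `|f|` over a contour. -/
def normIntegral (f : ℂ → ℂ) : ℝ := ∑ j, ∫ x in L.dom j, ‖L.speed j x * f (L.path j x)‖

variable {L}

theorem normIntegral_nonneg (f : ℂ → ℂ) : 0 ≤ L.normIntegral f :=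
  Finset.sum_nonneg fun _ _ => integral_nonneg fun _ => norm_nonneg _

theorem integral_congr {f g : ℂ → ℂ} (h : ∀ s ∈ L.support, f s = g s) :
    L.integral f = L.integral g := by
  simp only [integral_eq_sum]
  refine Finset.sum_congr rfl fun j _ => setIntegral_congr_fun (L.measurableSet_dom j) ?_
  intro x hx
  simp only [h _ (L.path_mem_support j hx)]

theorem integral_const_mul' (c : ℂ) (f : ℂ → ℂ) :
    L.integral (fun s => c * f s) = c * L.integral f := by
  simp only [integral_eq_sum, Finset.mul_sum, ← integral_const_mul]
  refine Finset.sum_congr rfl fun j _ => ?_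
  congr with x
  ring

/-- Domination on the contour by a multiple of an integrable function. -/
theorem norm_integral_le {f g : ℂ → ℂ} {b : ℝ} (hg : L.Integrable g)
    (h : ∀ s ∈ L.support, ‖f s‖ ≤ ‖g s‖ * b) : ‖L.integral f‖ ≤ L.normIntegral g * b := by
  rw [integral_eq_sum, normIntegral, Finset.sum_mul]
  refine (norm_sum_le _ _).trans (Finset.sum_le_sum fun j _ => ?_)
  rw [← integral_mul_const]
  refine norm_integral_le_of_norm_le ((hg j).norm.mul_const b) ?_
  refine ae_restrict_of_forall_mem (L.measurableSet_dom j) fun x hx => ?_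
  rw [norm_mul, norm_mul, mul_assoc]
  exact mul_le_mul_of_nonneg_left (h _ (L.path_mem_support j hx)) (norm_nonneg _)

/-- Fubini's theorem for a contour integral and an integral over a set of reals. -/
theorem integral_integral_swap {F : ℂ → ℝ → ℂ} {g : ℂ → ℂ} {B : ℝ → ℝ} {A : Set ℝ}
    (hA : MeasurableSet A) (hF : Measurable (Function.uncurry F)) (hg : L.Integrable g)
    (hB : IntegrableOn B A) (h : ∀ s ∈ L.support, ∀ t ∈ A, ‖F s t‖ ≤ ‖g s‖ * B t) :
    L.integral (fun s => ∫ t in A, F s t) = ∫ t in A, L.integral fun s => F s t := by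
  have key : ∀ j, MeasureTheory.Integrable
      (Function.uncurry fun (x : ℝ) (t : ℝ) => L.speed j x * F (L.path j x) t)
      ((volume.restrict (L.dom j)).prod (volume.restrict A)) := by
    intro j
    refine MeasureTheory.Integrable.mono' ((hg j).norm.mul_prod hB) ?_ ?_
    · refine Measurable.aestronglyMeasurable ?_
      have h1 : Measurable fun z : ℝ × ℝ => L.speed j z.1 :=
        (L.continuous_speed j).measurable.comp measurable_fst
      have h2 : Measurable fun z : ℝ × ℝ => (L.path j z.1, z.2) :=
        ((L.continuous_path j).measurable.comp measurable_fst).prodMk measurable_snd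
      exact h1.mul (hF.comp h2)
    · rw [Measure.prod_restrict]
      refine ae_restrict_of_forall_mem ((L.measurableSet_dom j).prod hA) ?_
      rintro ⟨x, t⟩ ⟨hx, ht⟩
      simp only [Function.uncurry, norm_mul]
      rw [mul_assoc]
      exact mul_le_mul_of_nonneg_left (h _ (L.path_mem_support j hx) t ht) (norm_nonneg _)
  simp only [integral_eq_sum]
  have key' : ∀ j, MeasureTheory.Integrable
      (fun t => ∫ x in L.dom j, L.speed j x * F (L.path j x) t) (volume.restrict A) :=
    fun j => (key j).integral_prod_right
  rw [integral_finsetSum _ fun j _ => key' j]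
  refine Finset.sum_congr rfl fun j _ => ?_
  rw [← MeasureTheory.integral_integral_swap (key j)]
  simp only [← integral_const_mul]

theorem stronglyMeasurable_integral {F : ℝ → ℂ → ℂ} (hF : Measurable (Function.uncurry F)) :
    StronglyMeasurable fun t => L.integral (F t) := by
  simp only [integral_eq_sum]
  refine Finset.stronglyMeasurable_fun_sum _ fun j _ => ?_
  refine StronglyMeasurable.integral_prod_right (f := fun (t : ℝ) (x : ℝ) =>
    L.speed j x * F t (L.path j x)) ?_
  refine Measurable.stronglyMeasurable ?_
  have h1 : Measurable fun z : ℝ × ℝ => L.speed j z.2 :=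
    (L.continuous_speed j).measurable.comp measurable_snd
  have h2 : Measurable fun z : ℝ × ℝ => (z.1, L.path j z.2) :=
    measurable_fst.prodMk ((L.continuous_path j).measurable.comp measurable_snd)
  exact h1.mul (hF.comp h2)

variable (L)

/-- A contour has a leftmost point. -/
theorem exists_re_le : ∃ s₀ ∈ L.support, ∀ s ∈ L.support, s₀.re ≤ s.re := by
  have hh := L.h_pos
  set g : Option (Fin L.k) → ℂ := fun o => o.elim (L.c : ℂ) fun i => L.center i - L.radius i with hg
  have hmem : ∀ o, g o ∈ L.support := by
    rintro (_ | i)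
    · left
      cases κ <;> simp [hg, hh.le]
    · right
      refine mem_iUnion.2 ⟨i, ?_⟩
      simp [hg, abs_of_pos (L.radius_pos i)]
  obtain ⟨o, ho⟩ := Finite.exists_min fun o => (g o).re
  refine ⟨g o, hmem o, fun s hs => ?_⟩
  rcases hs with hs | hs
  · refine (ho none).trans ?_
    cases κ
    · simp only [mem_ofPred_eq] at hs
      simp [hg, hs]
    · simp only [mem_ofPred_eq] at hs
      rcases hs with hs | hs
      · simp [hg, hs.1]
      · simpa [hg] using hs.1
  · obtain ⟨i, hi⟩ := mem_iUnion.1 hs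
    refine (ho (some i)).trans ?_
    have := Complex.abs_re_le_norm (s - L.center i)
    rw [← dist_eq_norm, mem_sphere_iff_norm.1 hi |> fun h => (dist_eq_norm _ _).trans h] at this
    simp only [Complex.sub_re] at this
    simp only [hg, Option.elim, Complex.sub_re, Complex.ofReal_re]
    linarith [(abs_le.1 this).1]

/-- A real number to the right of all circles and of the left end of a contour. -/
theorem exists_right : ∃ R₀, ∀ R, R₀ ≤ R → L.c < R ∧
    ∀ i, ∀ p ∈ Metric.ball (L.center i) (L.radius i), p.re < R := by
  refine ⟨|L.c| + 1 + ∑ i, (|(L.center i).re| + L.radius i), fun R hR => ?_⟩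
  have h1 : ∀ i, 0 ≤ |(L.center i).re| + L.radius i := fun i => by
    have := L.radius_pos i; positivity
  constructor
  · have := Finset.sum_nonneg fun i (_ : i ∈ Finset.univ) => h1 i
    linarith [le_abs_self L.c]
  · intro i p hp
    have h2 := Finset.single_le_sum (fun i _ => h1 i) (Finset.mem_univ i)
    have h3 := Complex.abs_re_le_norm (p - L.center i)
    rw [Metric.mem_ball, dist_eq_norm] at hp
    simp only [Complex.sub_re] at h3
    linarith [le_abs_self (p.re - (L.center i).re), le_abs_self (L.center i).re, abs_nonneg L.c]

open Classical in
/-- The winding number around `p` of the circles of a contour minus that of the rectangle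
`[c, R] × [-h, h]`. -/
def boxIndex (R h : ℝ) (p : ℂ) : ℤ :=
  -(if p ∈ openRect L.c R (-h) h then 1 else 0) +
    ∑ i, if p ∈ Metric.ball (L.center i) (L.radius i) then L.mult i else 0

/-- The integral over the path `R - ih → c - ih → c + ih → R + ih` and over the circles. -/
def boxIntegral (R h : ℝ) (f : ℂ → ℂ) : ℂ :=
  (Complex.I * (∫ y in (-h)..h, f (L.c + y * Complex.I)) +
    (∫ r in L.c..R, f (r + h * Complex.I)) - ∫ r in L.c..R, f (r - h * Complex.I)) +
  ∑ i, (L.mult i : ℂ) * ∮ s in C(L.center i, L.radius i), f s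

variable {L}

/-- The residue theorem replaces the open path of the box by the segment on `Re s = R` that closes
the rectangle. -/
theorem boxIntegral_eq {f : ℂ → ℂ} {U : Set ℂ} {F : Finset ℂ} {res : ℂ → ℂ}
    (H : HasResidues f U F res) {R h : ℝ} (hR : L.c ≤ R) (hh : 0 ≤ h)
    (hU : closedRect L.c R (-h) h ⊆ U)
    (hU' : ∀ i, Metric.closedBall (L.center i) (L.radius i) ⊆ U)
    (hF : ∀ p ∈ F, p ∈ closedRect L.c R (-h) h → p ∈ openRect L.c R (-h) h)
    (hF' : ∀ p ∈ F, ∀ i, p ∉ Metric.sphere (L.center i) (L.radius i)) :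
    L.boxIntegral R h f = Complex.I * (∫ y in (-h)..h, f (R + y * Complex.I)) +
      2 * Real.pi * Complex.I * ∑ p ∈ F, L.boxIndex R h p * res p := by
  classical
  have h1 := H.rect L.c R (-h) h hR (by linarith) hU hF
  have h2 : ∀ i, (∮ s in C(L.center i, L.radius i), f s) = _ := fun i =>
    H.circle (L.center i) (L.radius i) (L.radius_pos i) (hU' i) fun p hp => hF' p hp i
  have h3 : ∑ p ∈ F, (L.boxIndex R h p : ℂ) * res p =
      -(∑ p ∈ F, if p ∈ openRect L.c R (-h) h then res p else 0) +
      ∑ i, (L.mult i : ℂ) *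
        ∑ p ∈ F, if p ∈ Metric.ball (L.center i) (L.radius i) then res p else 0 := by
    simp only [boxIndex, Finset.mul_sum]
    rw [Finset.sum_comm, ← Finset.sum_neg_distrib, ← Finset.sum_add_distrib]
    refine Finset.sum_congr rfl fun p _ => ?_
    push_cast
    rw [add_mul, Finset.sum_mul]
    congr 1
    · split_ifs <;> simp
    · refine Finset.sum_congr rfl fun i _ => ?_
      split_ifs <;> simp
  have h4 : ∑ i, (L.mult i : ℂ) * (∮ s in C(L.center i, L.radius i), f s) =
      2 * Real.pi * Complex.I * ∑ i, (L.mult i : ℂ) *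
        ∑ p ∈ F, if p ∈ Metric.ball (L.center i) (L.radius i) then res p else 0 := by
    rw [Finset.mul_sum]
    refine Finset.sum_congr rfl fun i _ => ?_
    rw [h2]
    ring
  rw [boxIntegral, h3, h4, mul_add, ← add_assoc]
  congr 1
  rw [mul_neg, ← h1, rectIntegral]
  simp only [Complex.ofReal_neg, neg_mul, ← sub_eq_add_neg]
  ring

end MBContour

/-! ### Independence of the contour -/

section

/-- `f` is meromorphic in the plane and `S` is a locally finite set that contains its poles. -/
structure HasPolesIn (f : ℂ → ℂ) (S : Set ℂ) : Prop where
  finite : ∀ r, (S ∩ Metric.ball 0 r).Finite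
  differentiableAt : ∀ z, z ∉ S → DifferentiableAt ℂ f z
  meromorphicAt : ∀ z, MeromorphicAt f z

theorem HasPolesIn.exists_residues {f : ℂ → ℂ} {S : Set ℂ} (H : HasPolesIn f S) (r : ℝ) :
    ∃ res, HasResidues f (Metric.ball 0 r) (H.finite r).toFinset res := by
  refine exists_hasResidues _ f (fun z hz hzF => H.differentiableAt z fun hzS => hzF ?_)
    fun z _ => H.meromorphicAt z
  simpa using ⟨hzS, by simpa using hz⟩

/-- Vertical lines that avoid the poles are dense, since the set of poles is countable. -/
theorem HasPolesIn.exists_re_ne {f : ℂ → ℂ} {S : Set ℂ} (H : HasPolesIn f S) {R₀ R₁ : ℝ}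
    (h : R₀ < R₁) : ∃ R ∈ Ioo R₀ R₁, ∀ p ∈ S, p.re ≠ R := by
  have hc : S.Countable := by
    have : S = ⋃ n : ℕ, S ∩ Metric.ball 0 n := by
      rw [← inter_iUnion, Metric.iUnion_ball_nat, inter_univ]
    rw [this]
    exact countable_iUnion fun n => (H.finite n).countable
  obtain ⟨R, hR, hR'⟩ := ((hc.image Complex.re).dense_compl ℝ).exists_between h
  exact ⟨R, hR', fun p hp h => hR ⟨p, hp, h⟩⟩

theorem isBounded_closedRect (x₀ x₁ y₀ y₁ : ℝ) : Bornology.IsBounded (closedRect x₀ x₁ y₀ y₁) :=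
  (isCompact_Icc.reProdIm isCompact_Icc).isBounded

namespace MBContour

variable {κ : ContourKind}

theorem boxIndex_vertical (L : MBContour .vertical) {R h : ℝ} {p : ℂ}
    (hR' : ∀ i, ∀ p ∈ Metric.ball (L.center i) (L.radius i), p.re < R) (hp : p ∉ L.support)
    (hpi : |p.im| < h) :
    L.boxIndex R h p = if p.re < R then L.side p - 1 else 0 := by
  have hc : p.re ≠ L.c := fun e => hp (Or.inl e)
  rw [abs_lt] at hpi
  unfold boxIndex side
  simp only [openRect, mem_ofPred_eq, mem_Ioo, hpi, and_true]
  by_cases h1 : p.re < R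
  · rcases lt_or_gt_of_ne hc with h2 | h2
    · simp only [h1, h2, not_lt.2 h2.le, if_true, if_false, false_and]
      ring
    · simp only [h1, h2, not_lt.2 h2.le, if_true, if_false, and_self]
      ring
  · simp only [h1, and_false, if_false, neg_zero, zero_add]
    exact Finset.sum_eq_zero fun i _ => if_neg fun hi => h1 (hR' i p hi)

theorem boxIndex_loop (L : MBContour .loop) {R : ℝ} {p : ℂ}
    (hR' : ∀ i, ∀ p ∈ Metric.ball (L.center i) (L.radius i), p.re < R) :
    L.boxIndex R L.h p = if p.re < R then L.side p - 1 else 0 := by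
  unfold boxIndex side
  simp only [openRect, mem_ofPred_eq, mem_Ioo, ← abs_lt]
  by_cases h1 : p.re < R
  · simp only [h1, and_true, if_true]
    split_ifs <;> ring
  · simp only [h1, and_false, false_and, if_false, neg_zero, zero_add]
    exact Finset.sum_eq_zero fun i _ => if_neg fun hi => h1 (hR' i p hi)

/-- Contours with the same index at every pole have box integrals that differ only by the segments
that close the boxes. -/
theorem boxIntegral_sub_boxIntegral (L L' : MBContour κ) {f : ℂ → ℂ} {S : Set ℂ}
    (H : HasPolesIn f S) {R h h' : ℝ} (hh : 0 ≤ h) (hh' : 0 ≤ h') (hR : L.c ≤ R) (hR' : L'.c ≤ R)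
    (hS : ∀ p ∈ S, p ∈ closedRect L.c R (-h) h → p ∈ openRect L.c R (-h) h)
    (hS' : ∀ p ∈ S, p ∈ closedRect L'.c R (-h') h' → p ∈ openRect L'.c R (-h') h')
    (hL : ∀ p ∈ S, p ∉ L.support) (hL' : ∀ p ∈ S, p ∉ L'.support)
    (hi : ∀ p ∈ S, L.boxIndex R h p = L'.boxIndex R h' p) :
    L.boxIntegral R h f - L'.boxIntegral R h' f =
      Complex.I * ((∫ y in (-h)..h, f (R + y * Complex.I)) -
        ∫ y in (-h')..h', f (R + y * Complex.I)) := by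
  have hb : Bornology.IsBounded ((closedRect L.c R (-h) h ∪ closedRect L'.c R (-h') h') ∪
      ((⋃ i, Metric.closedBall (L.center i) (L.radius i)) ∪
        ⋃ i, Metric.closedBall (L'.center i) (L'.radius i))) := by
    refine ((isBounded_closedRect _ _ _ _).union (isBounded_closedRect _ _ _ _)).union
      (Bornology.IsBounded.union ?_ ?_) <;>
    exact Bornology.isBounded_iUnion.2 fun i => Metric.isBounded_closedBall
  obtain ⟨ρ, hρ⟩ := hb.subset_ball (0 : ℂ)
  simp only [union_subset_iff, iUnion_subset_iff] at hρ
  obtain ⟨res, hres⟩ := H.exists_residues ρ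
  have hmem : ∀ p ∈ (H.finite ρ).toFinset, p ∈ S := fun p hp => by
    rw [Finite.mem_toFinset] at hp
    exact hp.1
  rw [boxIntegral_eq hres hR hh hρ.1.1 hρ.2.1 (fun p hp => hS p (hmem p hp))
      fun p hp i hpi => hL p (hmem p hp) (Or.inr (mem_iUnion.2 ⟨i, hpi⟩)),
    boxIntegral_eq hres hR' hh' hρ.1.2 hρ.2.2 (fun p hp => hS' p (hmem p hp))
      fun p hp i hpi => hL' p (hmem p hp) (Or.inr (mem_iUnion.2 ⟨i, hpi⟩)),
    Finset.sum_congr rfl fun p hp => by rw [hi p (hmem p hp)]]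
  ring

open Filter Topology

/-- The integral over a vertical contour as a limit over boxes that grow in height, with `R` fixed. -/
theorem tendsto_boxIntegral_vertical (L : MBContour .vertical) {f : ℂ → ℂ} (R : ℝ)
    (hint : L.Integrable f)
    (hdecay : ∀ X : ℝ, ∀ ε > 0, ∃ T₀, ∀ s : ℂ, |s.re| ≤ X → T₀ ≤ |s.im| → ‖f s‖ ≤ ε) :
    Tendsto (fun T => L.boxIntegral R T f) atTop (𝓝 (L.integral f)) := by
  have hside : ∀ σ : ℝ → ℝ, (∀ T, |σ T| = |T|) →
      Tendsto (fun T => ∫ r in L.c..R, f (r + σ T * Complex.I)) atTop (𝓝 0) := by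
    intro σ hσ
    refine Metric.tendsto_atTop.2 fun ε hε => ?_
    obtain ⟨T₀, hT₀⟩ := hdecay (max |L.c| |R|) (ε / (|R - L.c| + 1)) (by positivity)
    refine ⟨max T₀ 0, fun T hT => ?_⟩
    rw [dist_zero_right]
    refine (intervalIntegral.norm_integral_le_of_norm_le_const
      (C := ε / (|R - L.c| + 1)) fun r hr => ?_).trans_lt ?_
    · refine hT₀ _ ?_ ?_
      · rcases mem_uIcc.1 (uIoc_subset_uIcc hr) with h | h
        · simpa using abs_le_max_abs_abs h.1 h.2
        · simpa [or_comm] using abs_le_max_abs_abs h.1 h.2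
      · simp only [Complex.add_im, Complex.ofReal_im, Complex.mul_im, Complex.ofReal_re,
          Complex.I_im, mul_one, Complex.I_re, mul_zero, add_zero, zero_add, hσ]
        exact (le_max_left _ _).trans (hT.trans (le_abs_self _))
    · rw [div_mul_eq_mul_div, div_lt_iff₀ (by positivity)]
      nlinarith [abs_nonneg (R - L.c)]
  have h0 : MeasureTheory.Integrable fun y : ℝ => f (L.c + y * Complex.I) := by
    have := hint (.inl 0)
    simp only [dom, path, speed, integrableOn_univ] at this
    refine (this.const_mul (-Complex.I)).congr (ae_of_all _ fun y => ?_)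
    simp only [← mul_assoc, neg_mul, Complex.I_mul_I, neg_neg, one_mul]
  have h1 := (intervalIntegral_tendsto_integral h0 tendsto_neg_atTop_atBot tendsto_id).const_mul
    Complex.I
  have h2 := ((h1.add (hside id fun _ => rfl)).sub (hside (fun T => -T) abs_neg)).add_const
    (∑ i, (L.mult i : ℂ) * ∮ s in C(L.center i, L.radius i), f s)
  simpa only [boxIntegral, integral, add_zero, sub_zero, id, Complex.ofReal_neg, neg_mul,
    ← sub_eq_add_neg] using h2

/-- The integral over a loop as a limit over boxes that grow to the right, with the height of the
loop. -/
theorem tendsto_boxIntegral_loop (L : MBContour .loop) {f : ℂ → ℂ} (hint : L.Integrable f) :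
    Tendsto (fun R => L.boxIntegral R L.h f) atTop (𝓝 (L.integral f)) := by
  have h0 : IntegrableOn (fun r : ℝ => f (r - L.h * Complex.I)) (Ioi L.c) := by
    have := hint (.inl 0)
    simp only [dom, path, speed] at this
    simpa using this.neg
  have h1 : IntegrableOn (fun r : ℝ => f (r + L.h * Complex.I)) (Ioi L.c) := by
    have := hint (.inl 2)
    simpa only [dom, path, speed, one_mul] using this
  have h2 := (((intervalIntegral_tendsto_integral_Ioi _ h1 tendsto_id).const_add
    (Complex.I * (∫ y in (-L.h)..L.h, f (L.c + y * Complex.I)))).sub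
    (intervalIntegral_tendsto_integral_Ioi _ h0 tendsto_id)).add_const
    (∑ i, (L.mult i : ℂ) * ∮ s in C(L.center i, L.radius i), f s)
  refine h2.congr' (by rfl) |>.trans (le_of_eq ?_)
  rw [integral]
  congr 1
  ring

/-- Vertical contours with the same poles on either side have the same integral. -/
theorem integral_eq_of_vertical (L L' : MBContour .vertical) {f : ℂ → ℂ} {S : Set ℂ}
    (H : HasPolesIn f S) (hL : ∀ p ∈ S, p ∉ L.support) (hL' : ∀ p ∈ S, p ∉ L'.support)
    (hside : ∀ p ∈ S, L.side p = L'.side p) (him : ∃ Y, ∀ p ∈ S, |p.im| ≤ Y)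
    (hint : L.Integrable f) (hint' : L'.Integrable f)
    (hdecay : ∀ X : ℝ, ∀ ε > 0, ∃ T₀, ∀ s : ℂ, |s.re| ≤ X → T₀ ≤ |s.im| → ‖f s‖ ≤ ε) :
    L.integral f = L'.integral f := by
  obtain ⟨Y, hY⟩ := him
  obtain ⟨R₁, hR₁⟩ := L.exists_right
  obtain ⟨R₂, hR₂⟩ := L'.exists_right
  obtain ⟨R, ⟨hR, _⟩, hRS⟩ := H.exists_re_ne (lt_add_one (max R₁ R₂))
  have hL1 := hR₁ R ((le_max_left _ _).trans hR.le)
  have hL2 := hR₂ R ((le_max_right _ _).trans hR.le)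
  refine tendsto_nhds_unique (L.tendsto_boxIntegral_vertical R hint hdecay)
    ((L'.tendsto_boxIntegral_vertical R hint' hdecay).congr' ?_)
  filter_upwards [eventually_gt_atTop Y, eventually_ge_atTop 0] with T hT hT0
  have hrect : ∀ M : MBContour .vertical, (∀ p ∈ S, p ∉ M.support) → ∀ p ∈ S,
      p ∈ closedRect M.c R (-T) T → p ∈ openRect M.c R (-T) T := by
    rintro M hM p hp ⟨⟨h1, h2⟩, h3⟩
    exact ⟨⟨lt_of_le_of_ne h1 fun e => hM p hp (Or.inl e.symm), lt_of_le_of_ne h2 (hRS p hp)⟩,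
      abs_lt.1 ((hY p hp).trans_lt hT)⟩
  have := boxIntegral_sub_boxIntegral L L' H hT0 hT0 hL1.1.le hL2.1.le (hrect L hL) (hrect L' hL')
    hL hL' fun p hp => by
      rw [L.boxIndex_vertical hL1.2 (hL p hp) ((hY p hp).trans_lt hT),
        L'.boxIndex_vertical hL2.2 (hL' p hp) ((hY p hp).trans_lt hT), hside p hp]
  rw [sub_self, mul_zero, sub_eq_zero] at this
  exact this.symm

/-- Loops with the same poles on either side have the same integral. Their heights may differ: the
closing segments then differ by parts that lie in the strips where `f` decays. -/
theorem integral_eq_of_loop (L L' : MBContour .loop) {f : ℂ → ℂ} {S : Set ℂ}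
    (H : HasPolesIn f S) (hL : ∀ p ∈ S, p ∉ L.support) (hL' : ∀ p ∈ S, p ∉ L'.support)
    (hside : ∀ p ∈ S, L.side p = L'.side p)
    (hint : L.Integrable f) (hint' : L'.Integrable f)
    (hdecay : ∀ ε > 0, ∃ R₀, ∀ s : ℂ, R₀ ≤ s.re → |s.im| ∈ uIcc L.h L'.h → ‖f s‖ ≤ ε) :
    L.integral f = L'.integral f := by
  obtain ⟨R₁, hR₁⟩ := L.exists_right
  obtain ⟨R₂, hR₂⟩ := L'.exists_right
  have hh := L.h_pos
  have hh' := L'.h_pos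
  have hex : ∀ n : ℕ, ∃ R, max (max R₁ R₂) n < R ∧ ∀ p ∈ S, p.re ≠ R := fun n => by
    obtain ⟨R, ⟨hR, _⟩, hRS⟩ := H.exists_re_ne (lt_add_one (max (max R₁ R₂) (n : ℝ)))
    exact ⟨R, hR, hRS⟩
  choose R hR hRS using hex
  have hRtop : Tendsto R atTop atTop :=
    tendsto_atTop_mono (fun n => (le_max_right _ _).trans (hR n).le) tendsto_natCast_atTop_atTop
  have hrect : ∀ M : MBContour .loop, (∀ p ∈ S, p ∉ M.support) → ∀ n, ∀ p ∈ S,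
      p ∈ closedRect M.c (R n) (-M.h) M.h → p ∈ openRect M.c (R n) (-M.h) M.h := by
    rintro M hM n p hp ⟨⟨h1, h2⟩, h3⟩
    have h3' := abs_le.2 h3
    refine ⟨⟨lt_of_le_of_ne h1 fun e => hM p hp (Or.inl (Or.inl ⟨e.symm, h3'⟩)),
      lt_of_le_of_ne h2 (hRS n p hp)⟩,
      abs_lt.1 (lt_of_le_of_ne h3' fun e => hM p hp (Or.inl (Or.inr ⟨h1, e⟩)))⟩
  have hdiff : ∀ n, L.boxIntegral (R n) L.h f - L'.boxIntegral (R n) L'.h f =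
      Complex.I * ((∫ y in L'.h..L.h, f (R n + y * Complex.I)) +
        ∫ y in (-L.h)..(-L'.h), f (R n + y * Complex.I)) := by
    intro n
    have hL1 := hR₁ (R n) ((le_max_left _ _).trans ((le_max_left _ _).trans (hR n).le))
    have hL2 := hR₂ (R n) ((le_max_right _ _).trans ((le_max_left _ _).trans (hR n).le))
    rw [boxIntegral_sub_boxIntegral L L' H hh.le hh'.le hL1.1.le hL2.1.le (hrect L hL n)
      (hrect L' hL' n) hL hL' fun p hp => by
        rw [L.boxIndex_loop hL1.2, L'.boxIndex_loop hL2.2, hside p hp]]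
    have hcont : Continuous fun y : ℝ => f (R n + y * Complex.I) := by
      refine continuous_iff_continuousAt.2 fun y => ?_
      have : ContinuousAt f (R n + y * Complex.I) :=
        (H.differentiableAt _ fun hy => hRS n _ hy (by simp)).continuousAt
      exact ContinuousAt.comp (f := fun y : ℝ => (R n + y * Complex.I : ℂ)) this (by fun_prop)
    rw [intervalIntegral.integral_interval_sub_interval_comm' (hcont.intervalIntegrable _ _)
      (hcont.intervalIntegrable _ _) (hcont.intervalIntegrable _ _),
      intervalIntegral.integral_symm (-L.h) (-L'.h)]
    ring
  have hz : Tendsto (fun n => L.boxIntegral (R n) L.h f - L'.boxIntegral (R n) L'.h f) atTop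
      (𝓝 0) := by
    refine Metric.tendsto_atTop.2 fun ε hε => ?_
    obtain ⟨R₀, hR₀⟩ := hdecay (ε / (2 * |L.h - L'.h| + 1)) (by positivity)
    obtain ⟨N, hN⟩ := (tendsto_atTop.1 hRtop R₀).exists_forall_of_atTop
    refine ⟨N, fun n hn => ?_⟩
    rw [dist_zero_right, hdiff, norm_mul, Complex.norm_I, one_mul]
    have e1 : ‖∫ y in L'.h..L.h, f (R n + y * Complex.I)‖ ≤
        ε / (2 * |L.h - L'.h| + 1) * |L.h - L'.h| := by
      refine intervalIntegral.norm_integral_le_of_norm_le_const fun y hy => hR₀ _ ?_ ?_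
      · simpa using hN n hn
      · have hy' := uIoc_subset_uIcc hy
        rw [uIcc_comm] at hy'
        have hy0 : 0 ≤ y := (le_min hh.le hh'.le).trans hy'.1
        simpa [abs_of_nonneg hy0] using hy'
    have e2 : ‖∫ y in (-L.h)..(-L'.h), f (R n + y * Complex.I)‖ ≤
        ε / (2 * |L.h - L'.h| + 1) * |-L'.h - -L.h| := by
      refine intervalIntegral.norm_integral_le_of_norm_le_const fun y hy => hR₀ _ ?_ ?_
      · simpa using hN n hn
      · have hy' := uIoc_subset_uIcc hy
        have hy'' : -y ∈ uIcc L.h L'.h := by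
          rw [mem_uIcc] at hy' ⊢
          rcases hy' with h | h
          · exact Or.inr ⟨by linarith [h.2], by linarith [h.1]⟩
          · exact Or.inl ⟨by linarith [h.2], by linarith [h.1]⟩
        have hy0 : 0 ≤ -y := (le_min hh.le hh'.le).trans hy''.1
        rw [← abs_neg, abs_of_nonneg (by simpa using hy0)]
        simpa using hy''
    refine (norm_add_le _ _).trans_lt ((add_le_add e1 e2).trans_lt ?_)
    rw [show -L'.h - -L.h = L.h - L'.h by ring, ← two_mul, ← mul_assoc, mul_comm 2, mul_assoc,
      div_mul_eq_mul_div, div_lt_iff₀ (by positivity)]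
    nlinarith [abs_nonneg (L.h - L'.h)]
  have hlim := ((L.tendsto_boxIntegral_loop hint).comp hRtop).sub
    ((L'.tendsto_boxIntegral_loop hint').comp hRtop)
  exact sub_eq_zero.1 (tendsto_nhds_unique hlim hz)

end MBContour

end

/-! ### The size of the Gamma function -/

section

open Filter Topology Asymptotics

/-- For fixed imaginary part, `|Γ(x + iy)| / Γ(x)` increases with `x > 0`: it is the limit of the
products `∏ (x + j) / |x + j + iy|`. -/
theorem norm_Gamma_mul_le {x₁ x₂ : ℝ} (h₁ : 0 < x₁) (h₂ : x₁ ≤ x₂) (y : ℝ) :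
    ‖Complex.Gamma (x₁ + y * Complex.I)‖ * Real.Gamma x₂ ≤
      ‖Complex.Gamma (x₂ + y * Complex.I)‖ * Real.Gamma x₁ := by
  have key : ∀ x : ℝ, 0 < x → ∀ n : ℕ, n ≠ 0 →
      ‖Complex.GammaSeq (x + y * Complex.I) n‖ = (n : ℝ) ^ x * n.factorial /
        ∏ j ∈ Finset.range (n + 1), ‖((x + j : ℝ) : ℂ) + y * Complex.I‖ := by
    intro x _ n hn
    have hn' : (0 : ℝ) < n := by positivity
    rw [Complex.GammaSeq, norm_div, norm_mul, norm_prod]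
    congr 1
    · congr 1
      · rw [← Complex.ofReal_natCast, Complex.norm_cpow_eq_rpow_re_of_pos hn']
        simp
      · simp
    · refine Finset.prod_congr rfl fun j _ => ?_
      congr 1
      push_cast
      ring
  have hx₂ : 0 < x₂ := h₁.trans_le h₂
  have t1 := ((Complex.GammaSeq_tendsto_Gamma (x₁ + y * Complex.I)).norm).mul
    (Real.GammaSeq_tendsto_Gamma x₂)
  have t2 := ((Complex.GammaSeq_tendsto_Gamma (x₂ + y * Complex.I)).norm).mul
    (Real.GammaSeq_tendsto_Gamma x₁)
  refine le_of_tendsto_of_tendsto t1 t2 ?_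
  filter_upwards [eventually_ne_atTop 0] with n hn
  have hn' : (0 : ℝ) < n := by positivity
  rw [key x₁ h₁ n hn, key x₂ hx₂ n hn, Real.GammaSeq, Real.GammaSeq]
  have hpos : ∀ x : ℝ, 0 < x → ∀ j : ℕ, 0 < ‖((x + j : ℝ) : ℂ) + y * Complex.I‖ := by
    intro x hx j
    refine norm_pos_iff.2 fun h => ?_
    have := congrArg Complex.re h
    simp at this
    have hj : (0 : ℝ) ≤ j := j.cast_nonneg
    linarith
  have hprod : (∏ j ∈ Finset.range (n + 1), ‖((x₂ + j : ℝ) : ℂ) + y * Complex.I‖) *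
      ∏ j ∈ Finset.range (n + 1), (x₁ + j) ≤
      (∏ j ∈ Finset.range (n + 1), ‖((x₁ + j : ℝ) : ℂ) + y * Complex.I‖) *
      ∏ j ∈ Finset.range (n + 1), (x₂ + j) := by
    rw [← Finset.prod_mul_distrib, ← Finset.prod_mul_distrib]
    refine Finset.prod_le_prod (fun j _ => by positivity) fun j _ => ?_
    have hj : (0 : ℝ) ≤ j := j.cast_nonneg
    rw [Complex.norm_add_mul_I, Complex.norm_add_mul_I]
    refine le_of_sq_le_sq ?_ (by positivity)
    rw [mul_pow, mul_pow, Real.sq_sqrt (by positivity), Real.sq_sqrt (by positivity)]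
    have : (x₁ + j) ^ 2 ≤ (x₂ + j) ^ 2 := by gcongr
    nlinarith [sq_nonneg y]
  have p1 := Finset.prod_pos fun j (_ : j ∈ Finset.range (n + 1)) => hpos x₁ h₁ j
  have p2 := Finset.prod_pos fun j (_ : j ∈ Finset.range (n + 1)) => hpos x₂ hx₂ j
  have p3 : 0 < ∏ j ∈ Finset.range (n + 1), (x₁ + j) := Finset.prod_pos fun j _ => by positivity
  have p4 : 0 < ∏ j ∈ Finset.range (n + 1), (x₂ + j) := Finset.prod_pos fun j _ => by positivity
  rw [div_mul_div_comm, div_mul_div_comm, div_le_div_iff₀ (by positivity) (by positivity)]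
  have p5 : 0 < (n : ℝ) ^ x₁ * n.factorial * ((n : ℝ) ^ x₂ * n.factorial) := by positivity
  nlinarith [mul_le_mul_of_nonneg_left hprod p5.le]

/-- By the reflection formula, `|Γ(1/2 + iy)|² = π / cosh (πy)`. -/
theorem norm_Gamma_half (y : ℝ) :
    ‖Complex.Gamma ((1 / 2 : ℝ) + y * Complex.I)‖ ≤
      √(2 * Real.pi) * Real.exp (-(Real.pi / 2) * |y|) := by
  have h := Complex.Gamma_mul_Gamma_one_sub ((1 / 2 : ℝ) + y * Complex.I)
  have h1 : 1 - (((1 / 2 : ℝ) : ℂ) + y * Complex.I) =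
      (starRingEnd ℂ) (((1 / 2 : ℝ) : ℂ) + y * Complex.I) := by
    apply Complex.ext <;> simp
    norm_num
  have h2 : (Real.pi : ℂ) * (((1 / 2 : ℝ) : ℂ) + y * Complex.I) =
      (Real.pi * y : ℝ) * Complex.I + Real.pi / 2 := by
    push_cast
    ring
  rw [h1, Complex.Gamma_conj, Complex.mul_conj, h2, Complex.sin_add_pi_div_two, Complex.cos_mul_I,
    ← Complex.ofReal_cosh, ← Complex.ofReal_div] at h
  have h3 := Complex.ofReal_injective h
  rw [Complex.normSq_eq_norm_sq] at h3
  have h4 : Real.exp (Real.pi * |y|) / 2 ≤ Real.cosh (Real.pi * y) := by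
    rw [← Real.cosh_abs, abs_mul, abs_of_pos Real.pi_pos, Real.cosh_eq]
    have := Real.exp_pos (-(Real.pi * |y|))
    linarith
  refine le_of_sq_le_sq ?_ (by positivity)
  rw [h3, mul_pow, Real.sq_sqrt (by positivity), ← Real.exp_nat_mul,
    div_le_iff₀ (Real.cosh_pos _)]
  calc Real.pi = 2 * Real.pi * Real.exp ((2 : ℕ) * (-(Real.pi / 2) * |y|)) *
        (Real.exp (Real.pi * |y|) / 2) := by
        rw [show ((2 : ℕ) : ℝ) * (-(Real.pi / 2) * |y|) = -(Real.pi * |y|) by push_cast; ring,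
          Real.exp_neg]
        field_simp
    _ ≤ _ := by gcongr

theorem norm_Gamma_le_norm_Gamma_add_nat {s : ℂ} (hs : 1 ≤ |s.im|) (k : ℕ) :
    ‖Complex.Gamma s‖ ≤ ‖Complex.Gamma (s + k)‖ := by
  induction k with
  | zero => simp
  | succ k ih =>
    refine ih.trans ?_
    have h1 : 1 ≤ ‖s + k‖ := hs.trans (by simpa using Complex.abs_im_le_norm (s + k))
    rw [Nat.cast_succ, ← add_assoc, Complex.Gamma_add_one, norm_mul]
    · exact le_mul_of_one_le_left (norm_nonneg _) h1
    · intro h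
      rw [h, norm_zero] at h1
      linarith

theorem norm_Gamma_add_nat_le (y : ℝ) (N : ℕ) :
    ‖Complex.Gamma ((1 / 2 + N : ℝ) + y * Complex.I)‖ ≤
      (N + |y| + 1) ^ N * ‖Complex.Gamma ((1 / 2 : ℝ) + y * Complex.I)‖ := by
  have key : ∀ k ≤ N, ‖Complex.Gamma ((1 / 2 + k : ℝ) + y * Complex.I)‖ ≤
      (N + |y| + 1) ^ k * ‖Complex.Gamma ((1 / 2 : ℝ) + y * Complex.I)‖ := by
    intro k
    induction k with
    | zero => simp
    | succ k ih =>
      intro hk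
      have hk' : (k : ℝ) + 1 ≤ N := by exact_mod_cast hk
      have e : ((1 / 2 + (k + 1 : ℕ) : ℝ) : ℂ) + y * Complex.I =
          ((1 / 2 + k : ℝ) + y * Complex.I) + 1 := by
        push_cast
        ring
      rw [e, Complex.Gamma_add_one, norm_mul, pow_succ', mul_assoc]
      · refine mul_le_mul ?_ (ih (by omega)) (norm_nonneg _) (by positivity)
        refine (norm_add_le _ _).trans ?_
        rw [Complex.norm_real, norm_mul, Complex.norm_real, Complex.norm_I, mul_one,
          Real.norm_eq_abs, Real.norm_eq_abs, abs_of_pos (by positivity)]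
        linarith
      · intro h
        have := congrArg Complex.re h
        simp at this
        have hj : (0 : ℝ) ≤ k := k.cast_nonneg
        linarith
  exact key N le_rfl

/-! ### Decay in vertical strips -/

/-- Convergence to infinity in the vertical strip `|Re s| ≤ X`. -/
def stripFilter (X : ℝ) : Filter ℂ := comap (fun s => |s.im|) atTop ⊓ 𝓟 {s | |s.re| ≤ X}

/-- In every vertical strip, `f` decays at least like `exp (-κ |Im s|)`, up to factors `exp (ε |Im s|)`. -/
def VerticalRate (f : ℂ → ℂ) (κ : ℝ) : Prop :=
  ∀ X, ∀ κ' < κ, f =O[stripFilter X] fun s => Real.exp (-κ' * |s.im|)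

theorem tendsto_abs_im_stripFilter (X : ℝ) :
    Tendsto (fun s : ℂ => |s.im|) (stripFilter X) atTop :=
  tendsto_comap.mono_left inf_le_left

theorem eventually_stripFilter (X : ℝ) : ∀ᶠ s in stripFilter X, |s.re| ≤ X :=
  mem_inf_of_right (mem_principal_self _)

namespace VerticalRate

variable {f g : ℂ → ℂ} {κ κ' : ℝ}

theorem mul (hf : VerticalRate f κ) (hg : VerticalRate g κ') :
    VerticalRate (fun s => f s * g s) (κ + κ') := by
  intro X k hk
  have h := (hf X (κ - (κ + κ' - k) / 2) (by linarith)).mul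
    (hg X (κ' - (κ + κ' - k) / 2) (by linarith))
  refine h.congr_right fun s => ?_
  rw [← Real.exp_add]
  congr 1
  ring

theorem const (c : ℂ) : VerticalRate (fun _ => c) 0 := by
  intro X k hk
  refine IsBigO.of_bound ‖c‖ (Eventually.of_forall fun s => ?_)
  refine le_mul_of_one_le_right (norm_nonneg _) ?_
  rw [Real.norm_eq_abs, Real.abs_exp, Real.one_le_exp_iff]
  exact mul_nonneg (by linarith) (abs_nonneg _)

theorem prod {ι : Type*} (S : Finset ι) {F : ι → ℂ → ℂ} {k : ι → ℝ}
    (h : ∀ i ∈ S, VerticalRate (F i) (k i)) :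
    VerticalRate (fun s => ∏ i ∈ S, F i s) (∑ i ∈ S, k i) := by
  classical
  induction S using Finset.induction_on with
  | empty => simpa using const 1
  | insert i S hi ih =>
    simp only [Finset.prod_insert hi, Finset.sum_insert hi]
    exact (h i (Finset.mem_insert_self _ _)).mul
      (ih fun j hj => h j (Finset.mem_insert_of_mem hj))

theorem congr_rate (hf : VerticalRate f κ) (h : κ = κ') : VerticalRate f κ' := h ▸ hf

theorem comp_affine (hf : VerticalRate f κ) (b : ℂ) {B : ℝ} (hB : B ≠ 0) :
    VerticalRate (fun s => f (b + B * s)) (|B| * κ) := by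
  intro X k hk
  have hB' : 0 < |B| := abs_pos.2 hB
  have him : ∀ s : ℂ, |(b + B * s).im| ≤ |B| * |s.im| + |b.im| ∧
      |B| * |s.im| - |b.im| ≤ |(b + B * s).im| := by
    intro s
    have : (b + B * s).im = b.im + B * s.im := by simp
    rw [this, ← abs_mul]
    constructor
    · linarith [abs_add_le b.im (B * s.im)]
    · have := abs_sub_abs_le_abs_sub (B * s.im) (-b.im)
      rw [abs_neg, sub_neg_eq_add, add_comm (B * s.im)] at this
      exact this
  have ht : Tendsto (fun s : ℂ => b + B * s) (stripFilter X) (stripFilter (|b.re| + |B| * X)) := by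
    refine tendsto_inf.2 ⟨tendsto_comap_iff.2 ?_, tendsto_principal.2 ?_⟩
    · refine tendsto_atTop_mono (fun s => (him s).2) ?_
      exact tendsto_atTop_add_const_right _ _
        ((tendsto_abs_im_stripFilter X).const_mul_atTop hB')
    · filter_upwards [eventually_stripFilter X] with s hs
      have : (b + B * s).re = b.re + B * s.re := by simp
      simp only [this]
      refine (abs_add_le _ _).trans ?_
      rw [abs_mul]
      gcongr
  obtain ⟨q, hq⟩ : ∃ q, q * |B| = k := ⟨k / |B|, div_mul_cancel₀ k hB'.ne'⟩
  have hk' : q < κ := by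
    rw [← hq, mul_comm] at hk
    exact lt_of_mul_lt_mul_left hk hB'.le
  refine ((hf _ _ hk').comp_tendsto ht).trans ?_
  refine IsBigO.of_bound (Real.exp (|q| * |b.im|)) (Eventually.of_forall fun s => ?_)
  simp only [Function.comp, Real.norm_eq_abs, Real.abs_exp]
  rw [← Real.exp_add, Real.exp_le_exp]
  have h1 : -q * |(b + B * s).im| =
      -k * |s.im| + -q * (|(b + B * s).im| - |B| * |s.im|) := by
    rw [← hq]
    ring
  have h2 : -q * (|(b + B * s).im| - |B| * |s.im|) ≤ |q| * |b.im| := by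
    refine (le_abs_self _).trans ?_
    rw [abs_mul, abs_neg]
    refine mul_le_mul_of_nonneg_left (abs_le.2 ⟨?_, ?_⟩) (abs_nonneg _)
    · linarith [(him s).2]
    · linarith [(him s).1]
  linarith

theorem cpow {z : ℂ} (hz : z ≠ 0) : VerticalRate (fun s => z ^ s) (-|z.arg|) := by
  intro X k hk
  refine IsBigO.of_bound (Real.exp (|Real.log ‖z‖| * X)) ?_
  filter_upwards [eventually_stripFilter X] with s hs
  rw [Complex.cpow_def_of_ne_zero hz, Complex.norm_exp, Real.norm_eq_abs, Real.abs_exp,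
    ← Real.exp_add, Real.exp_le_exp, Complex.mul_re, Complex.log_re, Complex.log_im]
  have h1 : Real.log ‖z‖ * s.re ≤ |Real.log ‖z‖| * X := by
    refine (le_abs_self _).trans ?_
    rw [abs_mul]
    gcongr
  have h2 : -(z.arg * s.im) ≤ |z.arg| * |s.im| := by
    rw [← abs_mul]
    exact neg_le_abs _
  have h3 : |z.arg| * |s.im| ≤ -k * |s.im| :=
    mul_le_mul_of_nonneg_right (by linarith) (abs_nonneg _)
  linarith

/-- An integer shift takes the strip to `1 ≤ Re s ≤ N`, where `norm_Gamma_mul_le` compares `Γ` with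
its values on the line `Re s = 1/2 + N`, and these are known by `norm_Gamma_half`. -/
theorem gamma : VerticalRate Complex.Gamma (Real.pi / 2) := by
  intro X k hk
  obtain ⟨K, hK⟩ := exists_nat_ge (|X| + 1)
  set N : ℕ := 2 * K with hN
  have hcont : ContinuousOn Real.Gamma (Icc 1 (N : ℝ)) := fun x hx =>
    (Real.differentiableAt_Gamma fun m h => by
      have : (0 : ℝ) ≤ m := m.cast_nonneg
      linarith [hx.1]).continuousAt.continuousWithinAt
  obtain ⟨M, hM⟩ := isCompact_Icc.exists_bound_of_continuousOn hcont
  have hG : 0 < Real.Gamma (1 / 2 + N) := Real.Gamma_pos_of_pos (by positivity)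
  have hpow : (fun s : ℂ => (N + |s.im| + 1) ^ N) =O[stripFilter X]
      fun s => Real.exp ((Real.pi / 2 - k) * |s.im|) := by
    have h1 := (isLittleO_pow_exp_pos_mul_atTop N (sub_pos.2 hk)).isBigO
    have h2 : Tendsto (fun s : ℂ => N + |s.im| + 1) (stripFilter X) atTop :=
      tendsto_atTop_add_const_right _ _ (tendsto_atTop_add_const_left _ _
        (tendsto_abs_im_stripFilter X))
    refine (h1.comp_tendsto h2).trans ?_
    refine IsBigO.of_bound (Real.exp ((Real.pi / 2 - k) * (N + 1)))
      (Eventually.of_forall fun s => le_of_eq ?_)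
    simp only [Function.comp, Real.norm_eq_abs, Real.abs_exp]
    rw [← Real.exp_add]
    congr 1
    ring
  have hbd : Complex.Gamma =O[stripFilter X] fun s : ℂ =>
      (N + |s.im| + 1) ^ N * Real.exp (-(Real.pi / 2) * |s.im|) := by
    refine IsBigO.of_bound (M / Real.Gamma (1 / 2 + N) * √(2 * Real.pi)) ?_
    filter_upwards [eventually_stripFilter X,
      (tendsto_abs_im_stripFilter X).eventually_ge_atTop 1] with s hs hs1
    have hX := le_abs_self X
    have hs' := abs_le.1 hs
    have hx1 : 1 ≤ s.re + K := by linarith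
    have hx2 : s.re + K ≤ N := by rw [hN]; push_cast; linarith
    have e1 : s + K = ((s.re + K : ℝ) : ℂ) + s.im * Complex.I := by
      conv_lhs => rw [← Complex.re_add_im s]
      push_cast
      ring
    refine (norm_Gamma_le_norm_Gamma_add_nat hs1 K).trans ?_
    have h1 := norm_Gamma_mul_le (x₁ := s.re + K) (x₂ := 1 / 2 + N) (by linarith) (by linarith) s.im
    rw [← le_div_iff₀ hG] at h1
    rw [e1]
    refine h1.trans ?_
    have h2 := (norm_Gamma_add_nat_le s.im N).trans
      (mul_le_mul_of_nonneg_left (norm_Gamma_half s.im) (by positivity))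
    have h3 : Real.Gamma (s.re + K) ≤ M := (le_abs_self _).trans (hM _ ⟨hx1, hx2⟩)
    have h4 : 0 < Real.Gamma (s.re + K) := Real.Gamma_pos_of_pos (by linarith)
    rw [Real.norm_eq_abs, abs_of_nonneg (by positivity), div_mul_eq_mul_div, div_mul_eq_mul_div]
    refine div_le_div_of_nonneg_right ?_ hG.le
    calc _ ≤ (N + |s.im| + 1) ^ N * (√(2 * Real.pi) * Real.exp (-(Real.pi / 2) * |s.im|)) * M := by
          gcongr
      _ = _ := by ring
  refine hbd.trans ((hpow.mul (isBigO_refl _ _)).congr_right fun s => ?_)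
  rw [← Real.exp_add]
  congr 1
  ring

end VerticalRate

theorem norm_sin_le_exp (w : ℂ) : ‖Complex.sin w‖ ≤ Real.exp |w.im| := by
  rw [Complex.sin, norm_div, norm_mul, Complex.norm_I, mul_one, Complex.norm_ofNat]
  have h1 : ‖Complex.exp (-w * Complex.I)‖ ≤ Real.exp |w.im| := by
    rw [Complex.norm_exp, Real.exp_le_exp]
    simpa using le_abs_self w.im
  have h2 : ‖Complex.exp (w * Complex.I)‖ ≤ Real.exp |w.im| := by
    rw [Complex.norm_exp, Real.exp_le_exp]
    simpa using neg_le_abs w.im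
  linarith [norm_sub_le (Complex.exp (-w * Complex.I)) (Complex.exp (w * Complex.I))]

theorem abs_sinh_le_norm_sin (w : ℂ) : |Real.sinh w.im| ≤ ‖Complex.sin w‖ := by
  have h : Real.sinh w.im ^ 2 ≤ ‖Complex.sin w‖ ^ 2 := by
    rw [Complex.sin_eq, ← Complex.normSq_eq_norm_sq, Complex.normSq_apply]
    have h1 := Real.cosh_sq w.im
    have h2 := Real.sin_sq_add_cos_sq w.re
    simp only [← Complex.ofReal_sin, ← Complex.ofReal_cos, ← Complex.ofReal_cosh,
      ← Complex.ofReal_sinh, ← Complex.ofReal_mul, Complex.add_re, Complex.add_im,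
      Complex.mul_re, Complex.mul_im, Complex.ofReal_re, Complex.ofReal_im, Complex.I_re,
      Complex.I_im]
    nlinarith [sq_nonneg (Real.sin w.re), sq_nonneg (Real.sinh w.im)]
  exact abs_le_of_sq_le_sq' h (norm_nonneg _) |> abs_le.2

theorem abs_sin_re_le_norm_sin (w : ℂ) : |Real.sin w.re| ≤ ‖Complex.sin w‖ := by
  have h : Real.sin w.re ^ 2 ≤ ‖Complex.sin w‖ ^ 2 := by
    rw [Complex.sin_eq, ← Complex.normSq_eq_norm_sq, Complex.normSq_apply]
    have h1 := Real.cosh_sq w.im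
    simp only [← Complex.ofReal_sin, ← Complex.ofReal_cos, ← Complex.ofReal_cosh,
      ← Complex.ofReal_sinh, ← Complex.ofReal_mul, Complex.add_re, Complex.add_im,
      Complex.mul_re, Complex.mul_im, Complex.ofReal_re, Complex.ofReal_im, Complex.I_re,
      Complex.I_im]
    nlinarith [sq_nonneg (Real.sin w.re * Real.sinh w.im),
      sq_nonneg (Real.cos w.re * Real.sinh w.im)]
  exact abs_le_of_sq_le_sq' h (norm_nonneg _) |> abs_le.2

theorem sin_pi_mul_ne_zero_of_im_ne_zero {s : ℂ} (hs : s.im ≠ 0) :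
    Complex.sin (Real.pi * s) ≠ 0 := by
  have h1 := abs_sinh_le_norm_sin (Real.pi * s)
  intro h0
  rw [h0, norm_zero] at h1
  have h2 := abs_eq_zero.1 (le_antisymm h1 (abs_nonneg _))
  rw [Real.sinh_eq_zero, Complex.im_ofReal_mul] at h2
  exact (mul_eq_zero.1 h2).elim Real.pi_ne_zero hs

/-- The reflection formula, solved for `1 / Γ`. For `Re s < 1` it also holds at the poles of `Γ`,
where both sides vanish. -/
theorem inv_Gamma_eq {s : ℂ} (hs : s.im ≠ 0 ∨ s.re < 1) :
    (Complex.Gamma s)⁻¹ = (Real.pi : ℂ)⁻¹ * (Complex.sin (Real.pi * s) * Complex.Gamma (1 - s)) := by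
  have hpi : (Real.pi : ℂ) ≠ 0 := by exact_mod_cast Real.pi_ne_zero
  by_cases hsin : Complex.sin (Real.pi * s) = 0
  · have hre := hs.resolve_left fun h => sin_pi_mul_ne_zero_of_im_ne_zero h hsin
    obtain ⟨k, hk⟩ := Complex.sin_eq_zero_iff.1 hsin
    rw [mul_comm] at hk
    have hk' : s = k := mul_right_cancel₀ hpi hk
    have hk0 : k ≤ 0 := by
      rw [hk', Complex.intCast_re] at hre
      have : k < 1 := by exact_mod_cast hre
      omega
    obtain ⟨n, rfl⟩ := Int.exists_eq_neg_ofNat hk0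
    rw [hsin, hk', Int.cast_neg, Int.cast_natCast, Complex.Gamma_neg_nat_eq_zero]
    simp
  have h := Complex.Gamma_mul_Gamma_one_sub s
  have h0 : Complex.Gamma s ≠ 0 := by
    intro h0
    rw [h0, zero_mul] at h
    exact div_ne_zero hpi hsin h.symm
  field_simp
  rw [eq_div_iff hsin] at h
  linear_combination -h

namespace VerticalRate

theorem sin : VerticalRate (fun s => Complex.sin (Real.pi * s)) (-Real.pi) := by
  intro X k hk
  refine IsBigO.of_bound 1 (Eventually.of_forall fun s => ?_)
  rw [one_mul, Real.norm_eq_abs, Real.abs_exp]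
  refine (norm_sin_le_exp _).trans (Real.exp_le_exp.2 ?_)
  simp only [Complex.im_ofReal_mul, abs_mul, abs_of_pos Real.pi_pos]
  exact mul_le_mul_of_nonneg_right (by linarith) (abs_nonneg _)

theorem inv_gamma : VerticalRate (fun s => (Complex.Gamma s)⁻¹) (-(Real.pi / 2)) := by
  have h := ((const (Real.pi : ℂ)⁻¹).mul (sin.mul (gamma.comp_affine 1 (B := -1) (by norm_num))))
  intro X k hk
  refine (h X k (by simp; linarith)).congr' ?_ (by rfl)
  filter_upwards [(tendsto_abs_im_stripFilter X).eventually_gt_atTop 0] with s hs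
  rw [inv_Gamma_eq (Or.inl (abs_pos.1 hs))]
  congr 3
  push_cast
  ring

end VerticalRate

end

/-! ### Stirling's formula with logarithmic error -/

section

open Filter Topology Asymptotics

/-- The tangent inequality for the convex function `x log x - x`. -/
theorem mul_log_sub_self_sub_le {x y : ℝ} (hx : 0 < x) (hy : 0 < y) :
    (y * Real.log y - y) - (x * Real.log x - x) ≤ (y - x) * Real.log y := by
  have h := Real.log_le_sub_one_of_pos (div_pos hy hx)
  rw [Real.log_div hy.ne' hx.ne', le_sub_iff_add_le, le_div_iff₀ hx] at h
  nlinarith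

theorem log_factorial_le {n : ℕ} (hn : n ≠ 0) :
    Real.log n.factorial ≤ n * Real.log n - n + Real.log n / 2 + 1 := by
  have h1 : Stirling.stirlingSeq n ≤ Stirling.stirlingSeq 1 := by
    obtain ⟨m, rfl⟩ := Nat.exists_eq_succ_of_ne_zero hn
    exact Stirling.stirlingSeq'_antitone (Nat.zero_le m)
  have hpos : 0 < Stirling.stirlingSeq n := by
    obtain ⟨m, rfl⟩ := Nat.exists_eq_succ_of_ne_zero hn
    exact Stirling.stirlingSeq'_pos m
  have h2 := Real.log_le_log hpos h1
  have hn' : (n : ℝ) ≠ 0 := by exact_mod_cast hn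
  have e1 : Real.log (Real.exp 1 / √2) = 1 - Real.log 2 / 2 := by
    rw [Real.log_div (by positivity) (by positivity), Real.log_exp, Real.log_sqrt (by positivity)]
  have e2 : Real.log (n / Real.exp 1) = Real.log n - 1 := by
    rw [Real.log_div hn' (by positivity), Real.log_exp]
  rw [Stirling.log_stirlingSeq_formula, Stirling.stirlingSeq_one, e1, e2,
    Real.log_mul (by norm_num) hn'] at h2
  linarith

/-- `Γ` lies between consecutive factorials, for which Stirling's formula is known. -/
theorem abs_log_Gamma_sub_le {x : ℝ} (hx : 2 ≤ x) :
    |Real.log (Real.Gamma x) - (x * Real.log x - x)| ≤ 1 + 2 * Real.log x := by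
  set n := ⌊x⌋₊ with hn
  have hn2 : 2 ≤ n := Nat.le_floor (by exact_mod_cast hx)
  have hn2' : (2 : ℝ) ≤ n := by exact_mod_cast hn2
  have hnx : (n : ℝ) ≤ x := Nat.floor_le (by linarith)
  have hxn : x < n + 1 := Nat.lt_floor_add_one x
  have hlog : Real.log n ≤ Real.log x := Real.log_le_log (by linarith) hnx
  have hlog0 : 0 ≤ Real.log n := Real.log_nonneg (by linarith)
  have hmono := Real.Gamma_strictMonoOn_Ici.monotoneOn
  have h1 : Real.log (Real.Gamma x) ≤ Real.log n.factorial := by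
    rw [← Real.Gamma_nat_eq_factorial]
    refine Real.log_le_log (Real.Gamma_pos_of_pos (by linarith)) ?_
    exact hmono (by simpa using hx) (by simp; linarith) hxn.le
  have h2 : Real.log n.factorial - Real.log n ≤ Real.log (Real.Gamma x) := by
    rw [← Real.Gamma_nat_eq_factorial, Real.Gamma_add_one (by positivity), Real.log_mul
      (by positivity) (Real.Gamma_pos_of_pos (by positivity)).ne', add_sub_cancel_left]
    refine Real.log_le_log (Real.Gamma_pos_of_pos (by positivity)) ?_
    exact hmono (by simpa using hn2') (by simpa using hx) hnx
  have h3 := log_factorial_le (n := n) (by omega)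
  have h4 := Stirling.le_log_factorial_stirling (n := n) (by omega)
  have h5 := mul_log_sub_self_sub_le (x := x) (y := n) (by linarith) (by linarith)
  have h6 := mul_log_sub_self_sub_le (x := n) (y := x) (by linarith) (by linarith)
  have h7 : 0 ≤ Real.log (2 * Real.pi) := Real.log_nonneg (by linarith [Real.pi_gt_three])
  rw [abs_le]
  constructor <;> nlinarith

theorem log_Gamma_affine_isLittleO (b : ℝ) {B : ℝ} (hB : 0 < B) :
    (fun r : ℝ => Real.log (Real.Gamma (b + B * r)) -
      (B * (r * Real.log r) + (B * Real.log B - B) * r)) =o[atTop] fun r => r := by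
  have ht : Tendsto (fun r : ℝ => b + B * r) atTop atTop :=
    tendsto_atTop_add_const_left _ _ (tendsto_id.const_mul_atTop hB)
  have hB' : Tendsto (fun r : ℝ => B * r) atTop atTop := tendsto_id.const_mul_atTop hB
  have hlin : (fun r : ℝ => b + B * r) =O[atTop] fun r => r :=
    (isLittleO_const_id_atTop b).isBigO.add (isBigO_const_mul_self B _ _)
  have h1 : (fun r : ℝ => Real.log (b + B * r)) =o[atTop] fun r => r :=
    (Real.isLittleO_log_id_atTop.comp_tendsto ht).trans_isBigO hlin
  have h2 : (fun r : ℝ => Real.log (B * r)) =o[atTop] fun r => r :=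
    (Real.isLittleO_log_id_atTop.comp_tendsto hB').trans_isBigO (isBigO_const_mul_self B _ _)
  have h3 : (fun r : ℝ => 1 + 2 * Real.log (b + B * r) +
      |b| * (|Real.log (b + B * r)| + |Real.log (B * r)|)) =o[atTop] fun r => r :=
    ((isLittleO_const_id_atTop 1).add (h1.const_mul_left 2)).add
      ((h1.abs_left.add h2.abs_left).const_mul_left _)
  refine (IsBigO.of_bound 1 ?_).trans_isLittleO h3
  filter_upwards [ht.eventually_ge_atTop 2, hB'.eventually_gt_atTop 0, eventually_gt_atTop 0]
    with r hr1 hr2 hr3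
  have e : B * (r * Real.log r) + (B * Real.log B - B) * r =
      B * r * Real.log (B * r) - B * r := by
    rw [Real.log_mul hB.ne' hr3.ne']
    ring
  have h4 := abs_log_Gamma_sub_le hr1
  have h5 := mul_log_sub_self_sub_le (x := b + B * r) (y := B * r) (by linarith) hr2
  have h6 := mul_log_sub_self_sub_le (x := B * r) (y := b + B * r) hr2 (by linarith)
  rw [e, one_mul, Real.norm_eq_abs, Real.norm_eq_abs]
  refine le_trans ?_ (le_abs_self _)
  have h7 : b * Real.log (b + B * r) ≤ |b| * |Real.log (b + B * r)| := by
    rw [← abs_mul]; exact le_abs_self _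
  have h8 : -b * Real.log (B * r) ≤ |b| * |Real.log (B * r)| := by
    rw [← abs_neg b, ← abs_mul]; exact le_abs_self _
  have h9 : 0 ≤ |b| * |Real.log (b + B * r)| := by positivity
  have h10 : 0 ≤ |b| * |Real.log (B * r)| := by positivity
  rw [abs_le] at h4 ⊢
  constructor <;> nlinarith

theorem norm_Gamma_le_Gamma_re {s : ℂ} (hs : 0 < s.re) :
    ‖Complex.Gamma s‖ ≤ Real.Gamma s.re := by
  rw [Complex.Gamma_eq_integral hs, Real.Gamma_eq_integral hs, Complex.GammaIntegral]
  refine norm_integral_le_of_norm_le (Real.GammaIntegral_convergent hs) ?_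
  refine ae_restrict_of_forall_mem measurableSet_Ioi fun x hx => le_of_eq ?_
  rw [norm_mul, Complex.norm_real, Real.norm_eq_abs, Real.abs_exp,
    Complex.norm_cpow_eq_rpow_re_of_pos hx]
  simp

/-! ### Growth along horizontal half-strips -/

/-- Convergence to `+∞` inside the set `A`. -/
def rightFilter (A : Set ℂ) : Filter ℂ := comap Complex.re atTop ⊓ 𝓟 A

/-- Inside `A`, as `r = Re s → +∞`, the function `f` grows at most like `exp (-D r log r + κ r)`,
up to factors `exp (ε r)`. -/
def HorizontalRate (A : Set ℂ) (f : ℂ → ℂ) (D κ : ℝ) : Prop :=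
  ∀ κ', κ < κ' → f =O[rightFilter A] fun s => Real.exp (-D * (s.re * Real.log s.re) + κ' * s.re)

theorem tendsto_re_rightFilter (A : Set ℂ) : Tendsto Complex.re (rightFilter A) atTop :=
  tendsto_comap.mono_left inf_le_left

theorem eventually_rightFilter (A : Set ℂ) : ∀ᶠ s in rightFilter A, s ∈ A :=
  mem_inf_of_right (mem_principal_self _)

namespace HorizontalRate

variable {A : Set ℂ} {f g : ℂ → ℂ} {D D' κ κ' : ℝ}

theorem mul (hf : HorizontalRate A f D κ) (hg : HorizontalRate A g D' κ') :
    HorizontalRate A (fun s => f s * g s) (D + D') (κ + κ') := by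
  intro k hk
  have h := (hf (κ + (k - (κ + κ')) / 2) (by linarith)).mul
    (hg (κ' + (k - (κ + κ')) / 2) (by linarith))
  refine h.congr_right fun s => ?_
  rw [← Real.exp_add]
  congr 1
  ring

theorem of_bound (C : ℝ) (h : ∀ᶠ s in rightFilter A, ‖f s‖ ≤ C) : HorizontalRate A f 0 0 := by
  intro k hk
  refine IsBigO.of_bound |C| ?_
  filter_upwards [h, (tendsto_re_rightFilter A).eventually_ge_atTop 0] with s hs hs0
  refine (hs.trans (le_abs_self _)).trans (le_mul_of_one_le_right (abs_nonneg _) ?_)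
  rw [Real.norm_eq_abs, Real.abs_exp, Real.one_le_exp_iff]
  simpa using mul_nonneg hk.le hs0

theorem const (c : ℂ) : HorizontalRate A (fun _ => c) 0 0 :=
  of_bound ‖c‖ (Eventually.of_forall fun _ => le_rfl)

theorem congr_rate (hf : HorizontalRate A f D κ) (h : D = D') (h' : κ = κ') :
    HorizontalRate A f D' κ' := h ▸ h' ▸ hf

theorem congr' (hf : HorizontalRate A f D κ) (h : ∀ᶠ s in rightFilter A, f s = g s) :
    HorizontalRate A g D κ := fun k hk => (hf k hk).congr' h (by rfl)

theorem prod {ι : Type*} (S : Finset ι) {F : ι → ℂ → ℂ} {d k : ι → ℝ}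
    (h : ∀ i ∈ S, HorizontalRate A (F i) (d i) (k i)) :
    HorizontalRate A (fun s => ∏ i ∈ S, F i s) (∑ i ∈ S, d i) (∑ i ∈ S, k i) := by
  classical
  induction S using Finset.induction_on with
  | empty => simpa using const (A := A) 1
  | insert i S hi ih =>
    simp only [Finset.prod_insert hi, Finset.sum_insert hi]
    exact (h i (Finset.mem_insert_self _ _)).mul
      (ih fun j hj => h j (Finset.mem_insert_of_mem hj))

theorem cpow {H : ℝ} (hA : ∀ s ∈ A, |s.im| ≤ H) {z : ℂ} (hz : z ≠ 0) :
    HorizontalRate A (fun s => z ^ s) 0 (Real.log ‖z‖) := by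
  intro k hk
  refine IsBigO.of_bound (Real.exp (|z.arg| * H)) ?_
  filter_upwards [eventually_rightFilter A, (tendsto_re_rightFilter A).eventually_ge_atTop 0]
    with s hs hs0
  rw [Complex.cpow_def_of_ne_zero hz, Complex.norm_exp, Real.norm_eq_abs, Real.abs_exp,
    ← Real.exp_add, Real.exp_le_exp, Complex.mul_re, Complex.log_re, Complex.log_im]
  have h2 : -(z.arg * s.im) ≤ |z.arg| * H := by
    refine (neg_le_abs _).trans ?_
    rw [abs_mul]
    exact mul_le_mul_of_nonneg_left (hA s hs) (abs_nonneg _)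
  nlinarith [mul_le_mul_of_nonneg_right hk.le hs0]

/-- A bound by `C exp (u (Re s))`, where `u` has the asymptotics of the rate. -/
theorem of_log {u : ℝ → ℝ}
    (hu : (fun r => u r - (-D * (r * Real.log r) + κ * r)) =o[atTop] fun r => r)
    (C : ℝ) (hf : ∀ᶠ s in rightFilter A, ‖f s‖ ≤ C * Real.exp (u s.re)) :
    HorizontalRate A f D κ := by
  intro k hk
  refine IsBigO.of_bound |C| ?_
  have h := (tendsto_re_rightFilter A).eventually (hu.def (sub_pos.2 hk))
  filter_upwards [hf, h, (tendsto_re_rightFilter A).eventually_ge_atTop 0] with s hs h1 h2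
  rw [Real.norm_eq_abs, Real.norm_eq_abs, abs_of_nonneg h2] at h1
  rw [Real.norm_eq_abs, Real.abs_exp]
  refine hs.trans ((mul_le_mul_of_nonneg_right (le_abs_self C) (Real.exp_pos _).le).trans ?_)
  refine mul_le_mul_of_nonneg_left (Real.exp_le_exp.2 ?_) (abs_nonneg _)
  linarith [(abs_le.1 h1).2]

theorem gamma (b : ℂ) {B : ℝ} (hB : 0 < B) :
    HorizontalRate A (fun s => Complex.Gamma (b + B * s)) (-B) (B * Real.log B - B) := by
  refine of_log (u := fun r => Real.log (Real.Gamma (b.re + B * r)))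
    ((log_Gamma_affine_isLittleO b.re hB).congr_left fun r => by ring) 1 ?_
  have ht : Tendsto (fun s : ℂ => b.re + B * s.re) (rightFilter A) atTop :=
    tendsto_atTop_add_const_left _ _ ((tendsto_re_rightFilter A).const_mul_atTop hB)
  filter_upwards [ht.eventually_gt_atTop 0] with s hs
  rw [Real.exp_log (Real.Gamma_pos_of_pos hs), one_mul]
  simpa using norm_Gamma_le_Gamma_re (s := b + B * s) (by simpa using hs)

/-- For `x ≥ 1` the quotient `|Γ(x + iy)| / Γ(x)` is at least `|Γ(1 + iy)|`, which is bounded below for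
bounded `y`; so the lower bound for `|Γ|` reduces to the real axis. -/
theorem inv_gamma {H : ℝ} (hA : ∀ s ∈ A, |s.im| ≤ H) (b : ℂ) {B : ℝ} (hB : 0 < B) :
    HorizontalRate A (fun s => (Complex.Gamma (b + B * s))⁻¹) B (-(B * Real.log B - B)) := by
  have hcont : ContinuousOn (fun y : ℝ => (Complex.Gamma ((1 : ℝ) + y * Complex.I))⁻¹)
      (Icc (-(|b.im| + B * H)) (|b.im| + B * H)) :=
    (Complex.differentiable_one_div_Gamma.continuous.comp (by fun_prop)).continuousOn
  obtain ⟨C, hC⟩ := isCompact_Icc.exists_bound_of_continuousOn hcont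
  refine of_log (u := fun r => -Real.log (Real.Gamma (b.re + B * r)))
    ((log_Gamma_affine_isLittleO b.re hB).neg_left.congr_left fun r => by ring) C ?_
  have ht : Tendsto (fun s : ℂ => b.re + B * s.re) (rightFilter A) atTop :=
    tendsto_atTop_add_const_left _ _ ((tendsto_re_rightFilter A).const_mul_atTop hB)
  filter_upwards [eventually_rightFilter A, ht.eventually_ge_atTop 1] with s hs hs1
  have hG : 0 < Real.Gamma (b.re + B * s.re) := Real.Gamma_pos_of_pos (by linarith)
  rw [Real.exp_neg, Real.exp_log hG]
  have h1 := norm_Gamma_mul_le one_pos hs1 (b.im + B * s.im)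
  have e : b + B * s = ((b.re + B * s.re : ℝ) : ℂ) + (b.im + B * s.im : ℝ) * Complex.I := by
    apply Complex.ext <;> simp
  have hy : |b.im + B * s.im| ≤ |b.im| + B * H := by
    refine (abs_add_le _ _).trans ?_
    rw [abs_mul, abs_of_pos hB]
    gcongr
    exact hA s hs
  have h2 := hC _ (abs_le.1 hy)
  rw [Real.Gamma_one, mul_one, ← e] at h1
  rw [norm_inv] at h2 ⊢
  have h3 : 0 < ‖Complex.Gamma ((1 : ℝ) + (b.im + B * s.im : ℝ) * Complex.I)‖ :=
    norm_pos_iff.2 (Complex.Gamma_ne_zero_of_re_pos (by simp))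
  have h4 : 0 < ‖Complex.Gamma (b + B * s)‖ :=
    norm_pos_iff.2 (Complex.Gamma_ne_zero_of_re_pos (by simp; linarith))
  rw [inv_le_iff_one_le_mul₀ h3] at h2
  rw [inv_le_iff_one_le_mul₀ h4, mul_right_comm, ← div_eq_mul_inv, le_div_iff₀ hG, one_mul]
  have hC0 : 0 ≤ C := by
    by_contra h
    nlinarith
  nlinarith [mul_le_mul_of_nonneg_left h1 hC0]

theorem sin {H : ℝ} (hA : ∀ s ∈ A, |s.im| ≤ H) (b : ℂ) (B : ℝ) :
    HorizontalRate A (fun s => Complex.sin (Real.pi * (b - B * s))) 0 0 := by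
  refine of_bound (Real.exp (Real.pi * (|b.im| + |B| * H))) ?_
  filter_upwards [eventually_rightFilter A] with s hs
  refine (norm_sin_le_exp _).trans (Real.exp_le_exp.2 ?_)
  rw [Complex.im_ofReal_mul, abs_mul, abs_of_pos Real.pi_pos]
  refine mul_le_mul_of_nonneg_left ?_ Real.pi_pos.le
  rw [Complex.sub_im, Complex.im_ofReal_mul]
  refine (abs_sub _ _).trans ?_
  rw [abs_mul]
  gcongr
  exact hA s hs

theorem inv_gamma_sub {H : ℝ} (hA : ∀ s ∈ A, |s.im| ≤ H) (b : ℂ) {B : ℝ} (hB : 0 < B) :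
    HorizontalRate A (fun s => (Complex.Gamma (b - B * s))⁻¹) (-B) (B * Real.log B - B) := by
  have h := ((const (A := A) (Real.pi : ℂ)⁻¹).mul ((sin hA b B).mul (gamma (1 - b) hB)))
  refine (h.congr_rate (by ring) (by ring)).congr' ?_
  have ht : Tendsto (fun s : ℂ => B * s.re) (rightFilter A) atTop :=
    (tendsto_re_rightFilter A).const_mul_atTop hB
  filter_upwards [ht.eventually_gt_atTop b.re] with s hs
  rw [inv_Gamma_eq (Or.inr (by simp; linarith))]
  congr 3
  ring

/-- By reflection, `Γ(b - Bs)` is small where the sine keeps away from its zeros. -/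
theorem gamma_sub {H : ℝ} (hA : ∀ s ∈ A, |s.im| ≤ H) (b : ℂ) {B : ℝ} (hB : 0 < B) {ε : ℝ}
    (hε : 0 < ε) (hA' : ∀ s ∈ A, ε ≤ ‖Complex.sin (Real.pi * (b - B * s))‖) :
    HorizontalRate A (fun s => Complex.Gamma (b - B * s)) B (-(B * Real.log B - B)) := by
  have hsin : HorizontalRate A (fun s => (Complex.sin (Real.pi * (b - B * s)))⁻¹) 0 0 := by
    refine of_bound ε⁻¹ ?_
    filter_upwards [eventually_rightFilter A] with s hs
    rw [norm_inv]
    exact inv_anti₀ hε (hA' s hs)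
  have h := ((const (A := A) (Real.pi : ℂ)).mul (hsin.mul (inv_gamma hA (1 - b) hB)))
  refine (h.congr_rate (by ring) (by ring)).congr' ?_
  have ht : Tendsto (fun s : ℂ => B * s.re) (rightFilter A) atTop :=
    (tendsto_re_rightFilter A).const_mul_atTop hB
  filter_upwards [ht.eventually_gt_atTop b.re] with s hs
  have := inv_Gamma_eq (s := b - B * s) (Or.inr (by simp; linarith))
  rw [← inv_inv (Complex.Gamma (b - B * s)), this, mul_inv, mul_inv, inv_inv]
  congr 4
  ring

end HorizontalRate

end

/-! ### Analytic properties of the Mellin-Barnes kernel -/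

section

open Filter Topology Asymptotics

theorem measurable_Gamma_complex : Measurable Complex.Gamma := by
  have h := Complex.differentiable_one_div_Gamma.continuous.measurable.inv
  exact (funext fun s => by simp : Complex.Gamma = (fun s => (Complex.Gamma s)⁻¹)⁻¹) ▸ h

theorem meromorphicAt_Gamma_comp {g : ℂ → ℂ} (hg : Differentiable ℂ g) (z : ℂ) :
    MeromorphicAt (fun s => Complex.Gamma (g s)) z := by
  have h := ((Complex.differentiable_one_div_Gamma.comp hg).analyticAt z).meromorphicAt.inv
  refine h.congr (Eventually.of_forall fun s => ?_)
  simp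

theorem differentiableAt_Gamma_comp {g : ℂ → ℂ} (hg : Differentiable ℂ g) {z : ℂ}
    (h : ∀ k : ℕ, g z ≠ -k) : DifferentiableAt ℂ (fun s => Complex.Gamma (g s)) z :=
  (Complex.differentiableAt_Gamma _ h).comp z (hg z)

theorem differentiable_inv_Gamma_comp {g : ℂ → ℂ} (hg : Differentiable ℂ g) :
    Differentiable ℂ fun s => (Complex.Gamma (g s))⁻¹ :=
  Complex.differentiable_one_div_Gamma.comp hg

theorem finite_range_inter_ball {u v : ℂ} (hv : v ≠ 0) (r : ℝ) :
    (range (fun k : ℕ => u + k * v) ∩ Metric.ball 0 r).Finite := by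
  obtain ⟨N, hN⟩ := exists_nat_ge ((r + ‖u‖) / ‖v‖)
  refine ((finite_Iio N).image fun k : ℕ => u + k * v).subset ?_
  rintro _ ⟨⟨k, rfl⟩, hk⟩
  refine ⟨k, ?_, rfl⟩
  have hv' : 0 < ‖v‖ := norm_pos_iff.2 hv
  rw [mem_ball_zero_iff] at hk
  have h1 : (k : ℝ) * ‖v‖ < r + ‖u‖ := by
    have h2 : (k : ℝ) * ‖v‖ = ‖(k : ℂ) * v‖ := by simp
    rw [h2, show (k : ℂ) * v = (u + k * v) - u by ring]
    linarith [norm_sub_le (u + k * v) u]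
  rw [← lt_div_iff₀ hv'] at h1
  exact_mod_cast h1.trans_le hN

namespace FoxData

variable (P : FoxData)

/-- All poles of the numerator of the Mellin-Barnes kernel. -/
def poles : Set ℂ := P.rightPoles ∪ P.leftPoles

theorem poles_subset : P.poles ⊆
    (⋃ j, range fun k : ℕ => P.b j / P.B j + k * (1 / P.B j : ℂ)) ∪
      ⋃ j, range fun k : ℕ => (P.a j - 1) / P.A j + k * (-1 / P.A j : ℂ) := by
  rintro s (⟨j, k, _, rfl⟩ | ⟨j, k, _, rfl⟩)
  · refine Or.inl (mem_iUnion.2 ⟨j, k, ?_⟩)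
    simp only
    ring
  · refine Or.inr (mem_iUnion.2 ⟨j, k, ?_⟩)
    simp only
    ring

theorem finite_poles (r : ℝ) : (P.poles ∩ Metric.ball 0 r).Finite := by
  refine Finite.subset ?_ (inter_subset_inter_left _ P.poles_subset)
  rw [union_inter_distrib_right, iUnion_inter, iUnion_inter]
  refine (finite_iUnion fun j => finite_range_inter_ball ?_ r).union
    (finite_iUnion fun j => finite_range_inter_ball ?_ r)
  · have := (P.B_pos j).ne'
    simpa using this
  · have := (P.A_pos j).ne'
    simpa using this

theorem exists_abs_im_lt : ∃ Y, 0 < Y ∧ ∀ p ∈ P.poles, |p.im| < Y := by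
  refine ⟨1 + ((∑ j, |(P.b j).im / P.B j|) + ∑ j, |(P.a j).im / P.A j|), by positivity, ?_⟩
  rintro s (⟨j, k, _, rfl⟩ | ⟨j, k, _, rfl⟩)
  · have h1 := Finset.single_le_sum (fun j _ => abs_nonneg ((P.b j).im / P.B j)) (Finset.mem_univ j)
    have h2 : 0 ≤ ∑ j, |(P.a j).im / P.A j| := by positivity
    simp only [Complex.div_ofReal_im, Complex.add_im, Complex.natCast_im, add_zero]
    linarith
  · have h1 := Finset.single_le_sum (fun j _ => abs_nonneg ((P.a j).im / P.A j)) (Finset.mem_univ j)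
    have h2 : 0 ≤ ∑ j, |(P.b j).im / P.B j| := by positivity
    simp only [Complex.div_ofReal_im, Complex.sub_im, Complex.natCast_im, sub_zero,
      Complex.one_im]
    linarith

theorem measurable_theta : Measurable P.theta := by
  unfold theta
  refine (Finset.measurable_fun_prod _ fun j _ => ?_).mul
    (Finset.measurable_fun_prod _ fun j _ => ?_) <;>
  split_ifs <;>
  first
  | exact measurable_Gamma_complex.comp (by fun_prop)
  | exact (measurable_Gamma_complex.comp (by fun_prop)).inv

theorem hasPolesIn_theta {z : ℂ} (hz : z ≠ 0) :
    HasPolesIn (fun s => P.theta s * z ^ s) P.poles where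
  finite := P.finite_poles
  differentiableAt s hs := by
    have hcpow : DifferentiableAt ℂ (fun s : ℂ => z ^ s) s :=
      DifferentiableAt.const_cpow differentiableAt_id (Or.inl hz)
    refine DifferentiableAt.mul (DifferentiableAt.mul ?_ ?_) hcpow
    · refine DifferentiableAt.fun_finsetProd fun j _ => ?_
      split_ifs with hj
      · refine differentiableAt_Gamma_comp (by fun_prop) fun k hk => hs (Or.inl ⟨j, k, hj, ?_⟩)
        have hB : (P.B j : ℂ) ≠ 0 := by exact_mod_cast (P.B_pos j).ne'
        field_simp
        linear_combination -hk
      · exact differentiable_inv_Gamma_comp (by fun_prop) s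
    · refine DifferentiableAt.fun_finsetProd fun j _ => ?_
      split_ifs with hj
      · refine differentiableAt_Gamma_comp (by fun_prop) fun k hk => hs (Or.inr ⟨j, k, hj, ?_⟩)
        have hA : (P.A j : ℂ) ≠ 0 := by exact_mod_cast (P.A_pos j).ne'
        field_simp
        linear_combination hk
      · exact differentiable_inv_Gamma_comp (by fun_prop) s
  meromorphicAt s := by
    have hcpow : AnalyticAt ℂ (fun s : ℂ => z ^ s) s :=
      Differentiable.analyticAt (fun s => DifferentiableAt.const_cpow differentiableAt_id
        (Or.inl hz)) s
    refine MeromorphicAt.mul (MeromorphicAt.mul ?_ ?_) hcpow.meromorphicAt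
    · refine MeromorphicAt.fun_prod fun j _ => ?_
      split_ifs
      · exact meromorphicAt_Gamma_comp (by fun_prop) s
      · exact (meromorphicAt_Gamma_comp (by fun_prop) s).inv
    · refine MeromorphicAt.fun_prod fun j _ => ?_
      split_ifs
      · exact meromorphicAt_Gamma_comp (by fun_prop) s
      · exact (meromorphicAt_Gamma_comp (by fun_prop) s).inv

/-- A factor `Γ(b ± Bs)` contributes `πB/2` to the rate, and its reciprocal `-πB/2`. -/
theorem verticalRate_theta : VerticalRate P.theta (Real.pi / 2 * P.aStar) := by
  have hb := VerticalRate.prod Finset.univ (F := fun (j : Fin P.q) s =>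
      if (j : ℕ) < P.m then Complex.Gamma (P.b j - P.B j * s)
      else (Complex.Gamma (1 - P.b j + P.B j * s))⁻¹)
    (k := fun j => Real.pi / 2 * if (j : ℕ) < P.m then P.B j else -P.B j) (by
    intro j _
    have hB := P.B_pos j
    split_ifs
    · have := (VerticalRate.gamma.comp_affine (P.b j) (neg_ne_zero.2 hB.ne')).congr_rate
        (κ' := Real.pi / 2 * P.B j) (by rw [abs_neg, abs_of_pos hB]; ring)
      simpa [sub_eq_add_neg] using this
    · exact (VerticalRate.inv_gamma.comp_affine (1 - P.b j) hB.ne').congr_rate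
        (by rw [abs_of_pos hB]; ring))
  have ha := VerticalRate.prod Finset.univ (F := fun (j : Fin P.p) s =>
      if (j : ℕ) < P.n then Complex.Gamma (1 - P.a j + P.A j * s)
      else (Complex.Gamma (P.a j - P.A j * s))⁻¹)
    (k := fun j => Real.pi / 2 * if (j : ℕ) < P.n then P.A j else -P.A j) (by
    intro j _
    have hA := P.A_pos j
    split_ifs
    · exact (VerticalRate.gamma.comp_affine (1 - P.a j) hA.ne').congr_rate
        (by rw [abs_of_pos hA]; ring)
    · have := (VerticalRate.inv_gamma.comp_affine (P.a j) (neg_ne_zero.2 hA.ne')).congr_rate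
        (κ' := Real.pi / 2 * -P.A j) (by rw [abs_neg, abs_of_pos hA]; ring)
      simpa [sub_eq_add_neg] using this)
  refine (hb.mul ha).congr_rate ?_
  rw [← Finset.mul_sum, ← Finset.mul_sum, aStar]
  ring

/-- The terms `r log r` of the logarithms of the factors add up to `-Δ r log r`. Only the factors
`Γ(b_j - B_j s)` have poles in a right half-plane. -/
theorem horizontalRate_theta {A : Set ℂ} {H : ℝ} (hA : ∀ s ∈ A, |s.im| ≤ H)
    (hε : ∀ j : Fin P.q, (j : ℕ) < P.m → ∃ ε > 0, ∀ s ∈ A,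
      ε ≤ ‖Complex.sin (Real.pi * (P.b j - P.B j * s))‖) :
    HorizontalRate A P.theta P.bigDelta
      ((∑ j, (P.A j * Real.log (P.A j) - P.A j)) - ∑ j, (P.B j * Real.log (P.B j) - P.B j)) := by
  have hb := HorizontalRate.prod (A := A) Finset.univ (F := fun (j : Fin P.q) s =>
      if (j : ℕ) < P.m then Complex.Gamma (P.b j - P.B j * s)
      else (Complex.Gamma (1 - P.b j + P.B j * s))⁻¹)
    (d := fun j => P.B j) (k := fun j => -(P.B j * Real.log (P.B j) - P.B j)) (by
    intro j _
    have hB := P.B_pos j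
    split_ifs with hj
    · obtain ⟨ε, hε0, hε'⟩ := hε j hj
      exact HorizontalRate.gamma_sub hA (P.b j) hB hε0 hε'
    · exact HorizontalRate.inv_gamma hA (1 - P.b j) hB)
  have ha := HorizontalRate.prod (A := A) Finset.univ (F := fun (j : Fin P.p) s =>
      if (j : ℕ) < P.n then Complex.Gamma (1 - P.a j + P.A j * s)
      else (Complex.Gamma (P.a j - P.A j * s))⁻¹)
    (d := fun j => -P.A j) (k := fun j => P.A j * Real.log (P.A j) - P.A j) (by
    intro j _
    have hA' := P.A_pos j
    split_ifs with hj
    · exact HorizontalRate.gamma (1 - P.a j) hA'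
    · exact HorizontalRate.inv_gamma_sub hA (P.a j) hA')
  refine (hb.mul ha).congr_rate ?_ ?_
  · rw [Finset.sum_neg_distrib, bigDelta]
    ring
  · rw [Finset.sum_neg_distrib]
    ring

/-- For `Δ = 0` the bound `‖z‖ < δ` thus says that the exponential rate of `θ(s) z^s` is negative. -/
theorem log_smallDelta : Real.log P.smallDelta =
    (∑ j, P.B j * Real.log (P.B j)) - ∑ j, P.A j * Real.log (P.A j) := by
  have hA := fun j => Real.rpow_pos_of_pos (P.A_pos j) (-P.A j)
  have hB := fun j => Real.rpow_pos_of_pos (P.B_pos j) (P.B j)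
  rw [smallDelta, Real.log_mul (Finset.prod_pos fun j _ => hA j).ne'
    (Finset.prod_pos fun j _ => hB j).ne', Real.log_prod fun j _ => (hA j).ne',
    Real.log_prod fun j _ => (hB j).ne']
  simp only [Real.log_rpow (P.A_pos _), Real.log_rpow (P.B_pos _), neg_mul, Finset.sum_neg_distrib]
  ring

end FoxData

theorem HorizontalRate.isBigO_exp {A : Set ℂ} {f : ℂ → ℂ} {D κ : ℝ} (hf : HorizontalRate A f D κ)
    (h : 0 < D ∨ (D = 0 ∧ κ < 0)) :
    ∃ c > 0, f =O[rightFilter A] fun s => Real.exp (-c * s.re) := by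
  rcases h with hD | ⟨rfl, hκ⟩
  · refine ⟨1, one_pos, (hf (κ + 1) (by linarith)).trans (IsBigO.of_bound 1 ?_)⟩
    filter_upwards [(Real.tendsto_log_atTop.comp (tendsto_re_rightFilter A)).eventually_ge_atTop
      ((κ + 2) / D), (tendsto_re_rightFilter A).eventually_ge_atTop 0] with s hs hs0
    rw [Real.norm_eq_abs, Real.norm_eq_abs, Real.abs_exp, Real.abs_exp, one_mul, Real.exp_le_exp]
    rw [Function.comp, div_le_iff₀ hD] at hs
    nlinarith
  · refine ⟨-κ / 2, by linarith, (hf (κ / 2) (by linarith)).trans (IsBigO.of_bound 1 ?_)⟩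
    refine Eventually.of_forall fun s => le_of_eq ?_
    rw [one_mul]
    congr 2
    ring

namespace MBContour

theorem integrable_circle {κ : ContourKind} (L : MBContour κ) {f : ℂ → ℂ}
    (hc : ∀ s ∈ L.support, ContinuousAt f s) (i : Fin L.k) :
    IntegrableOn (fun x => L.speed (.inr i) x * f (L.path (.inr i) x)) (L.dom (.inr i)) := by
  have h : ContinuousOn (fun x => L.speed (.inr i) x * f (L.path (.inr i) x))
      (Icc 0 (2 * Real.pi)) := by
    intro x _
    refine ((L.continuous_speed _).continuousAt.mul ?_).continuousWithinAt
    refine ContinuousAt.comp (g := f) (hc _ ?_) (L.continuous_path _).continuousAt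
    exact Or.inr (mem_iUnion.2 ⟨i, circleMap_mem_sphere _ (L.radius_pos i).le _⟩)
  exact (h.integrableOn_compact isCompact_Icc).mono_set Ioc_subset_Icc_self

theorem integrable_of_verticalRate (L : MBContour .vertical) {f : ℂ → ℂ} {κ : ℝ}
    (hc : ∀ s ∈ L.support, ContinuousAt f s) (hf : VerticalRate f κ) (hκ : 0 < κ) :
    L.Integrable f := by
  rintro (j | i)
  · fin_cases j
    · have hcont : Continuous fun y : ℝ => Complex.I * f (L.c + y * Complex.I) := by
        refine continuous_const.mul (continuous_iff_continuousAt.2 fun y => ?_)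
        exact ContinuousAt.comp (g := f) (f := fun y : ℝ => (L.c + y * Complex.I : ℂ))
          (hc _ (Or.inl (by simp))) (by fun_prop)
      have hO : ∀ l : Filter ℝ, Tendsto (fun y => |y|) l atTop →
          (fun y : ℝ => Complex.I * f (L.c + y * Complex.I)) =O[l]
            fun y => Real.exp (-(κ / 2) * |y|) := by
        intro l hl
        have ht : Tendsto (fun y : ℝ => (L.c + y * Complex.I : ℂ)) l (stripFilter |L.c|) := by
          refine tendsto_inf.2 ⟨tendsto_comap_iff.2 ?_, tendsto_principal.2 ?_⟩
          · simpa [Function.comp_def] using hl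
          · exact Eventually.of_forall fun y => by simp
        refine ((hf |L.c| (κ / 2) (by linarith)).comp_tendsto ht).const_mul_left _ |>.congr_right
          fun y => ?_
        simp
      have := (hcont.locallyIntegrable (μ := volume)).integrable_of_isBigO_atBot_atTop
        (g := fun y => Real.exp (-(κ / 2) * |y|)) (g' := fun y => Real.exp (-(κ / 2) * |y|))
        (hO _ tendsto_abs_atBot_atTop) ?_ (hO _ tendsto_abs_atTop_atTop) ?_
      · simpa [dom, path, speed] using this
      · refine ⟨Iic 0, Iic_mem_atBot 0, ?_⟩
        refine (integrableOn_exp_mul_Iic (a := κ / 2) (by linarith) 0).congr_fun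
          (fun y (hy : y ≤ 0) => ?_) measurableSet_Iic
        simp [abs_of_nonpos hy]
      · refine ⟨Ioi 0, Ioi_mem_atTop 0, ?_⟩
        refine (integrableOn_exp_mul_Ioi (a := -(κ / 2)) (by linarith) 0).congr_fun
          (fun y (hy : 0 < y) => ?_) measurableSet_Ioi
        simp [abs_of_pos hy]
    · simp [dom]
    · simp [dom]
  · exact L.integrable_circle hc i

theorem integrable_of_isBigO_exp (L : MBContour .loop) {f : ℂ → ℂ} {c : ℝ} {A : Set ℂ}
    (hc : ∀ s ∈ L.support, ContinuousAt f s) (hA : ∀ s : ℂ, |s.im| = L.h → s ∈ A)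
    (hf : f =O[rightFilter A] fun s => Real.exp (-c * s.re)) (hc0 : 0 < c) : L.Integrable f := by
  have hh := L.h_pos
  have hhor : ∀ (y : ℝ) (ε : ℂ), |y| = L.h →
      IntegrableOn (fun r : ℝ => ε * f (r + y * Complex.I)) (Ioi L.c) := by
    intro y ε hy
    have hcont : ContinuousOn (fun r : ℝ => ε * f (r + y * Complex.I)) (Ici L.c) := by
      intro r hr
      refine (continuousAt_const.mul (ContinuousAt.comp (g := f)
        (f := fun r : ℝ => (r + y * Complex.I : ℂ)) (hc _ (Or.inl (Or.inr ?_)))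
        (by fun_prop))).continuousWithinAt
      simpa [hy] using hr
    have hO : (fun r : ℝ => ε * f (r + y * Complex.I)) =O[atTop] fun r => Real.exp (-c * r) := by
      have ht : Tendsto (fun r : ℝ => (r + y * Complex.I : ℂ)) atTop (rightFilter A) := by
        refine tendsto_inf.2 ⟨tendsto_comap_iff.2 ?_, tendsto_principal.2 ?_⟩
        · exact tendsto_id.congr fun r => by simp
        · exact Eventually.of_forall fun r => hA _ (by simpa using hy)
      refine (hf.comp_tendsto ht).const_mul_left _ |>.congr_right fun r => ?_
      simp
    exact integrableOn_Ici_iff_integrableOn_Ioi (by finiteness) |>.mp <|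
      (hcont.locallyIntegrableOn measurableSet_Ici).integrableOn_of_isBigO_atTop hO
        ⟨Ioi 0, Ioi_mem_atTop 0, integrableOn_exp_mul_Ioi (by linarith) 0⟩
  rintro (j | i)
  · fin_cases j
    · simpa [dom, path, speed, sub_eq_add_neg] using
        hhor (-L.h) (-1) (by rw [abs_neg, abs_of_pos hh])
    · have h : ContinuousOn (fun y : ℝ => Complex.I * f (L.c + y * Complex.I))
          (Icc (-L.h) L.h) := by
        intro y hy
        refine (continuousAt_const.mul (ContinuousAt.comp (g := f)
          (f := fun y : ℝ => (L.c + y * Complex.I : ℂ)) (hc _ (Or.inl (Or.inl ?_)))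
          (by fun_prop))).continuousWithinAt
        simpa using abs_le.2 hy
      exact (h.integrableOn_compact isCompact_Icc).mono_set Ioc_subset_Icc_self
    · simpa [dom, path, speed] using hhor L.h 1 (abs_of_pos hh)
  · exact L.integrable_circle hc i

end MBContour

end

/-! ### The H-function as an integral over any separating contour -/

section

open Filter Topology Asymptotics

namespace FoxData

variable {P : FoxData} {κ : ContourKind} {L : MBContour κ}

theorem Separates.notMem_support (hL : P.Separates L) {p : ℂ} (hp : p ∈ P.poles) :
    p ∉ L.support :=
  hp.elim (fun h => (hL.1 p h).1) fun h => (hL.2 p h).1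

theorem Separates.side_eq (hL : P.Separates L) {L' : MBContour κ} (hL' : P.Separates L') {p : ℂ}
    (hp : p ∈ P.poles) : L.side p = L'.side p :=
  hp.elim (fun h => (hL.1 p h).2.trans (hL'.1 p h).2.symm)
    fun h => (hL.2 p h).2.trans (hL'.2 p h).2.symm

theorem Separates.continuousAt (hL : P.Separates L) {z : ℂ} (hz : z ≠ 0) :
    ∀ s ∈ L.support, ContinuousAt (fun s => P.theta s * z ^ s) s := fun s hs =>
  ((P.hasPolesIn_theta hz).differentiableAt s fun h => hL.notMem_support h hs).continuousAt

/-- The poles on the right of a loop lie within its height, because each of the families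
`(b_j + k) / B_j` leaves all the circles. -/
theorem Separates.abs_im_lt {L : MBContour .loop} (hL : P.Separates L) (j : Fin P.q)
    (hj : (j : ℕ) < P.m) : |(P.b j).im / P.B j| < L.h := by
  obtain ⟨R₀, hR₀⟩ := L.exists_right
  obtain ⟨hc, hball⟩ := hR₀ R₀ le_rfl
  have hB := P.B_pos j
  obtain ⟨k, hk⟩ := exists_nat_ge (R₀ * P.B j - (P.b j).re)
  have h1 := (hL.1 ((P.b j + k) / P.B j) ⟨j, k, hj, rfl⟩).2
  have hre : R₀ ≤ ((P.b j + k) / P.B j : ℂ).re := by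
    rw [Complex.div_ofReal_re, le_div_iff₀ hB]
    simp
    linarith
  have him : ((P.b j + k) / P.B j : ℂ).im = (P.b j).im / P.B j := by
    simp [Complex.div_ofReal_im]
  rw [MBContour.side, Finset.sum_eq_zero fun i _ => if_neg fun hi =>
    (hball i _ hi).not_ge hre, add_zero] at h1
  have h2 : L.c < ((P.b j + k) / P.B j : ℂ).re ∧ |((P.b j + k) / P.B j : ℂ).im| < L.h := by
    by_contra h
    simp only [if_neg h, one_ne_zero] at h1
  rw [him] at h2
  exact h2.2

theorem verticalRate_integrand {z : ℂ} (hz : z ≠ 0) :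
    VerticalRate (fun s => P.theta s * z ^ s) (Real.pi / 2 * P.aStar - |z.arg|) :=
  (P.verticalRate_theta.mul (VerticalRate.cpow hz)).congr_rate (by ring)

/-- The integrand decays exponentially in every part of a horizontal half-strip that keeps away from
the poles. -/
theorem exists_isBigO_exp_of_sin {z : ℂ} (h : P.Exists .loop z) {A : Set ℂ} {H : ℝ}
    (hA : ∀ s ∈ A, |s.im| ≤ H) (hε : ∀ j : Fin P.q, (j : ℕ) < P.m → ∃ ε > 0, ∀ s ∈ A,
      ε ≤ ‖Complex.sin (Real.pi * (P.b j - P.B j * s))‖) :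
    ∃ c > 0, (fun s => P.theta s * z ^ s) =O[rightFilter A] fun s => Real.exp (-c * s.re) := by
  refine ((P.horizontalRate_theta hA hε).mul (HorizontalRate.cpow hA h.1)).isBigO_exp ?_
  rw [add_zero]
  rcases h.2.2 with h' | ⟨h', h''⟩
  · exact Or.inl h'
  · refine Or.inr ⟨h', ?_⟩
    have h3 := Real.log_lt_log (norm_pos_iff.2 h.1) h''
    rw [log_smallDelta] at h3
    rw [bigDelta] at h'
    rw [Finset.sum_sub_distrib, Finset.sum_sub_distrib]
    linarith

theorem exists_isBigO_exp {z : ℂ} (h : P.Exists .loop z) {h₀ h₁ : ℝ}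
    (hm : ∀ j : Fin P.q, (j : ℕ) < P.m → |(P.b j).im / P.B j| < h₀) :
    ∃ c > 0, (fun s => P.theta s * z ^ s) =O[rightFilter {s | |s.im| ∈ Icc h₀ h₁}]
      fun s => Real.exp (-c * s.re) := by
  refine exists_isBigO_exp_of_sin h (H := h₁) (fun s hs => hs.2) fun j hj => ?_
  have hB := P.B_pos j
  have h0 : 0 < P.B j * (h₀ - |(P.b j).im / P.B j|) := mul_pos hB (sub_pos.2 (hm j hj))
  refine ⟨Real.sinh (Real.pi * (P.B j * (h₀ - |(P.b j).im / P.B j|))),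
    Real.sinh_pos_iff.2 (mul_pos Real.pi_pos h0),
    fun s hs => (?_ : _ ≤ _).trans (abs_sinh_le_norm_sin _)⟩
  rw [Real.abs_sinh, Real.sinh_le_sinh, Complex.im_ofReal_mul, abs_mul, abs_of_pos Real.pi_pos]
  refine mul_le_mul_of_nonneg_left ?_ Real.pi_pos.le
  have e : (P.b j - P.B j * s).im = P.B j * ((P.b j).im / P.B j - s.im) := by
    rw [Complex.sub_im, Complex.im_ofReal_mul]
    field_simp
  rw [e, abs_mul, abs_of_pos hB]
  refine mul_le_mul_of_nonneg_left ?_ hB.le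
  have := abs_sub_abs_le_abs_sub s.im ((P.b j).im / P.B j)
  rw [abs_sub_comm] at this
  linarith [hs.1]

theorem Separates.integrable (hL : P.Separates L) {z : ℂ} (h : P.Exists κ z) :
    L.Integrable fun s => P.theta s * z ^ s := by
  cases κ
  · refine L.integrable_of_verticalRate (hL.continuousAt h.1) (verticalRate_integrand h.1) ?_
    exact sub_pos.2 h.2.2.2
  · obtain ⟨c, hc, hO⟩ := exists_isBigO_exp h (h₀ := L.h) (h₁ := L.h) hL.abs_im_lt
    exact L.integrable_of_isBigO_exp (hL.continuousAt h.1) (fun s hs => by simp [hs]) hO hc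

/-- The Mellin-Barnes integral does not depend on the separating contour. -/
theorem Separates.integral_eq (hL : P.Separates L) {L' : MBContour κ} (hL' : P.Separates L') {z : ℂ}
    (h : P.Exists κ z) :
    L.integral (fun s => P.theta s * z ^ s) = L'.integral fun s => P.theta s * z ^ s := by
  cases κ
  · refine L.integral_eq_of_vertical L' (P.hasPolesIn_theta h.1) (fun p => hL.notMem_support)
      (fun p => hL'.notMem_support) (fun p => hL.side_eq hL') ?_ (hL.integrable h)
      (hL'.integrable h) fun X ε hε => ?_
    · obtain ⟨Y, _, hY⟩ := P.exists_abs_im_lt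
      exact ⟨Y, fun p hp => (hY p hp).le⟩
    · have h0 : 0 < Real.pi / 2 * P.aStar - |z.arg| := sub_pos.2 h.2.2.2
      have h1 := verticalRate_integrand (P := P) h.1 X _ (half_lt_self h0)
      have h2 : Tendsto (fun s : ℂ => Real.exp (-((Real.pi / 2 * P.aStar - |z.arg|) / 2) * |s.im|))
          (stripFilter X) (𝓝 0) := Real.tendsto_exp_atBot.comp
        ((tendsto_abs_im_stripFilter X).const_mul_atTop_of_neg (by linarith))
      have h3 := (h1.trans_tendsto h2).norm.eventually_le_const (u := ε) (by simpa using hε)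
      rw [stripFilter, eventually_inf_principal, eventually_comap, eventually_atTop] at h3
      obtain ⟨T, hT⟩ := h3
      exact ⟨T, fun s hs hsT => hT _ hsT s rfl hs⟩
  · have hm : ∀ j : Fin P.q, (j : ℕ) < P.m → |(P.b j).im / P.B j| < min L.h L'.h := fun j hj =>
      lt_min (hL.abs_im_lt j hj) (hL'.abs_im_lt j hj)
    refine L.integral_eq_of_loop L' (P.hasPolesIn_theta h.1) (fun p => hL.notMem_support)
      (fun p => hL'.notMem_support) (fun p => hL.side_eq hL') (hL.integrable h)
      (hL'.integrable h) fun ε hε => ?_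
    obtain ⟨c, hc, h1⟩ := exists_isBigO_exp h (h₁ := max L.h L'.h) hm
    have h2 : Tendsto (fun s : ℂ => Real.exp (-c * s.re))
        (rightFilter {s | |s.im| ∈ Icc (min L.h L'.h) (max L.h L'.h)}) (𝓝 0) :=
      Real.tendsto_exp_atBot.comp ((tendsto_re_rightFilter _).const_mul_atTop_of_neg (by linarith))
    have h3 := (h1.trans_tendsto h2).norm.eventually_le_const (u := ε) (by simpa using hε)
    rw [rightFilter, eventually_inf_principal, eventually_comap, eventually_atTop] at h3
    obtain ⟨R, hR⟩ := h3
    exact ⟨R, fun s hsR hs => hR _ hsR s rfl hs⟩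

theorem Separates.foxH_eq (hL : P.Separates L) {z : ℂ} (h : P.Exists κ z) :
    foxH κ P z = (2 * Real.pi * Complex.I)⁻¹ * L.integral fun s => P.theta s * z ^ s := by
  have hex : ∃ L : MBContour κ, P.Separates L := ⟨L, hL⟩
  rw [foxH, dif_pos hex, hex.choose_spec.integral_eq hL h]

/-- Separating contours exist to the right of any vertical line that has all the poles of the first
family on its right. -/
theorem exists_separates (κ : ContourKind) (hd : Disjoint P.rightPoles P.leftPoles) {c₀ : ℝ}
    (hc₀ : ∀ s ∈ P.rightPoles, c₀ < s.re) :
    ∃ L : MBContour κ, P.Separates L ∧ ∀ s ∈ L.support, c₀ < s.re := by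
  classical
  obtain ⟨Y, hY0, hY⟩ := P.exists_abs_im_lt
  obtain ⟨c₁, hc₁, hc₁'⟩ : ∃ c₁, (∀ j : Fin P.q, (j : ℕ) < P.m → c₁ < (P.b j).re / P.B j) ∧
      c₁ ∈ Ioi c₀ := by
    refine (Eventually.and (f := 𝓝[>] c₀) (eventually_all.2 fun j => ?_)
      self_mem_nhdsWithin).exists
    by_cases hj : (j : ℕ) < P.m
    · have h1 := hc₀ ((P.b j + (0 : ℕ)) / P.B j) ⟨j, 0, hj, rfl⟩
      simp only [Nat.cast_zero, add_zero, Complex.div_ofReal_re] at h1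
      filter_upwards [mem_nhdsWithin_of_mem_nhds (Iio_mem_nhds h1)] with c hc _ using hc
    · exact Eventually.of_forall fun c h => absurd h hj
  obtain ⟨c, ⟨hc0, hc1⟩, hcS⟩ := (P.hasPolesIn_theta one_ne_zero).exists_re_ne hc₁'
  have hright : ∀ s ∈ P.rightPoles, c < s.re := by
    rintro s ⟨j, k, hj, rfl⟩
    have hB := P.B_pos j
    refine (hc1.trans (hc₁ j hj)).trans_le ?_
    rw [Complex.div_ofReal_re]
    simp only [Complex.add_re, Complex.natCast_re]
    gcongr
    linarith [(k.cast_nonneg : (0 : ℝ) ≤ k)]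
  -- The poles of the second family to the right of the line `Re s = c` are finite in number.
  have hfin : {p | p ∈ P.leftPoles ∧ c < p.re}.Finite := by
    refine (P.finite_poles (|c| + (∑ j, |(P.a j - 1).re / P.A j|) + Y)).subset ?_
    rintro p ⟨hp, hpc⟩
    refine ⟨Or.inr hp, ?_⟩
    have him := hY p (Or.inr hp)
    obtain ⟨j, k, hj, rfl⟩ := hp
    have hA := P.A_pos j
    have h1 := Finset.single_le_sum (fun j _ => abs_nonneg ((P.a j - 1).re / P.A j))
      (Finset.mem_univ j)
    have h2 : ((P.a j - 1 - k) / P.A j : ℂ).re ≤ (P.a j - 1).re / P.A j := by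
      rw [Complex.div_ofReal_re]
      refine div_le_div_of_nonneg_right ?_ hA.le
      rw [Complex.sub_re (P.a j - 1), Complex.natCast_re]
      linarith [(k.cast_nonneg : (0 : ℝ) ≤ k)]
    rw [mem_ball_zero_iff]
    refine (Complex.norm_le_abs_re_add_abs_im _).trans_lt ?_
    refine add_lt_add_of_le_of_lt (abs_le.2 ⟨?_, ?_⟩) him
    · have h3 : 0 ≤ ∑ j, |(P.a j - 1).re / P.A j| := by positivity
      linarith [neg_abs_le c]
    · linarith [le_abs_self ((P.a j - 1).re / P.A j), abs_nonneg c]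
  set F := hfin.toFinset with hF
  have hmemF : ∀ p, p ∈ F ↔ p ∈ P.leftPoles ∧ c < p.re := fun p => by simp [hF]
  obtain ⟨r, hr, hr0⟩ : ∃ r : ℝ, (∀ p ∈ F, r < p.re - c ∧ ∀ q ∈ P.poles, q ≠ p → r < dist q p) ∧
      r ∈ Ioi (0 : ℝ) := by
    refine (Eventually.and (f := 𝓝[>] (0 : ℝ)) ((eventually_all_finset F).2 fun p hp => ?_)
      self_mem_nhdsWithin).exists
    have h1 : ∀ᶠ r in 𝓝[>] (0 : ℝ), r < p.re - c := mem_nhdsWithin_of_mem_nhds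
      (Iio_mem_nhds (sub_pos.2 ((hmemF p).1 hp).2))
    have h2 : ∀ᶠ r in 𝓝[>] (0 : ℝ), r < 1 := mem_nhdsWithin_of_mem_nhds (Iio_mem_nhds one_pos)
    have h3 : ∀ᶠ r in 𝓝[>] (0 : ℝ), ∀ q ∈ P.poles ∩ Metric.ball 0 (‖p‖ + 1),
        q ≠ p → r < dist q p := by
      refine (eventually_all_finite (P.finite_poles _)).2 fun q _ => ?_
      by_cases hq : q = p
      · exact Eventually.of_forall fun r h => absurd hq h
      · filter_upwards [mem_nhdsWithin_of_mem_nhds (Iio_mem_nhds (dist_pos.2 hq))] with r hr _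
          using hr
    filter_upwards [h1, h2, h3] with r hr1 hr2 hr3
    refine ⟨hr1, fun q hq hqp => ?_⟩
    by_cases hqb : q ∈ Metric.ball 0 (‖p‖ + 1)
    · exact hr3 q ⟨hq, hqb⟩ hqp
    · rw [mem_ball_zero_iff, not_lt] at hqb
      rw [dist_eq_norm]
      linarith [norm_sub_norm_le q p]
  -- A small circle of multiplicity `1` around each of them takes it to the left side.
  set e := F.equivFin.symm
  let L : MBContour κ := ⟨c, Y, hY0, F.card, fun i => e i, fun _ => r, fun _ => hr0, fun _ => 1⟩
  have hsupp : ∀ q ∈ P.poles, q ∉ L.support := by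
    rintro q hq (h | h)
    · cases κ
      · exact hcS q hq h
      · rcases h with h | h
        · exact hcS q hq h.1
        · exact (hY q hq).ne h.2
    · obtain ⟨i, hi⟩ := mem_iUnion.1 h
      change dist q (e i : ℂ) = r at hi
      refine ((hr _ (e i).2).2 q hq ?_).ne hi.symm
      intro h0
      rw [h0, dist_self] at hi
      exact hr0.ne hi
  have hcirc : ∀ q ∈ P.poles, (∑ i, if q ∈ Metric.ball (L.center i) (L.radius i) then
      L.mult i else 0) = if q ∈ F then 1 else 0 := by
    intro q hq
    change (∑ i, if q ∈ Metric.ball (e i : ℂ) r then (1 : ℤ) else 0) = _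
    rw [e.sum_comp (fun p : F => if q ∈ Metric.ball (p : ℂ) r then (1 : ℤ) else 0),
      Finset.sum_coe_sort F (fun p => if q ∈ Metric.ball p r then (1 : ℤ) else 0),
      ← Finset.sum_ite_eq F q fun _ => (1 : ℤ)]
    refine Finset.sum_congr rfl fun p hp => if_congr ?_ rfl rfl
    constructor
    · intro h
      by_contra hqp
      exact ((hr p hp).2 q hq hqp).not_gt h
    · rintro rfl
      exact Metric.mem_ball_self hr0
  have hmain : ∀ q ∈ P.poles, L.side q = (if q.re < c then 1 else 0) + if q ∈ F then 1 else 0 := by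
    intro q hq
    cases κ
    · simp only [MBContour.side, hcirc q hq]
      rfl
    · simp only [MBContour.side, hcirc q hq]
      congr 1
      change (if c < q.re ∧ |q.im| < Y then 0 else 1) = _
      have := hcS q hq
      simp only [hY q hq, and_true]
      rcases lt_or_gt_of_ne this with h | h
      · rw [if_neg h.not_gt, if_pos h]
      · rw [if_pos h, if_neg h.not_gt]
  refine ⟨L, ⟨fun s hs => ⟨hsupp s (Or.inl hs), ?_⟩, fun s hs => ⟨hsupp s (Or.inr hs), ?_⟩⟩, ?_⟩
  · rw [hmain s (Or.inl hs), if_neg (hright s hs).not_gt, if_neg, add_zero]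
    exact fun h => disjoint_left.1 hd hs ((hmemF s).1 h).1
  · rw [hmain s (Or.inr hs)]
    rcases lt_or_gt_of_ne (hcS s (Or.inr hs)) with h | h
    · rw [if_pos h, if_neg fun h' => ((hmemF s).1 h').2.not_gt h, add_zero]
    · rw [if_neg h.not_gt, if_pos ((hmemF s).2 ⟨hs, h⟩), zero_add]
  · rintro s (h | h)
    · cases κ
      · have h' : s.re = c := h
        exact h' ▸ hc0
      · rcases h with h | h
        · have h' : s.re = c := h.1
          exact h' ▸ hc0
        · have h' : c ≤ s.re := h.1
          exact hc0.trans_le h'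
    · obtain ⟨i, hi⟩ := mem_iUnion.1 h
      change dist s (e i : ℂ) = r at hi
      have h1 := (hr _ (e i).2).1
      have h2 := Complex.abs_re_le_norm (s - (e i : ℂ))
      rw [← dist_eq_norm, hi, Complex.sub_re] at h2
      linarith [(abs_le.1 h2).1]

end FoxData

end

/-! ### The Mellin-Barnes representation of the binomial series -/

section

open Filter Topology Asymptotics

/-- The residue at a simple pole. -/
theorem HasResidues.res_eq {f : ℂ → ℂ} {U : Set ℂ} {F : Finset ℂ} {res : ℂ → ℂ}
    (H : HasResidues f U F res) (hU : IsOpen U) (hd : ∀ z ∈ U, z ∉ F → DifferentiableAt ℂ f z)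
    {p ℓ : ℂ} (hp : p ∈ F) (hpU : p ∈ U)
    (hℓ : Tendsto (fun z => (z - p) * f z) (𝓝[≠] p) (𝓝 ℓ)) : res p = ℓ := by
  classical
  obtain ⟨ρ, hρ, hρU⟩ := Metric.isOpen_iff.1 hU p hpU
  obtain ⟨r, ⟨hr1, hr2⟩, hr0⟩ : ∃ r : ℝ, (r < ρ ∧ ∀ q ∈ F, q ≠ p → r < dist q p) ∧
      r ∈ Ioi (0 : ℝ) := by
    refine (Eventually.and (f := 𝓝[>] (0 : ℝ)) (Eventually.and
      (mem_nhdsWithin_of_mem_nhds (Iio_mem_nhds hρ))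
      ((eventually_all_finset F).2 fun q _ => ?_)) self_mem_nhdsWithin).exists
    by_cases hq : q = p
    · exact Eventually.of_forall fun r h => absurd hq h
    · filter_upwards [mem_nhdsWithin_of_mem_nhds (Iio_mem_nhds (dist_pos.2 hq))] with r hr _
        using hr
  have hr0' : 0 < r := hr0
  have hsub : Metric.closedBall p r ⊆ U := (Metric.closedBall_subset_ball hr1).trans hρU
  have hdiff : ∀ z ∈ Metric.closedBall p r, z ≠ p → DifferentiableAt ℂ f z := fun z hz hzp =>
    hd z (hsub hz) fun hzF => (hr2 z hzF hzp).not_ge hz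
  have h1 := H.circle p r hr0' hsub fun q hq h => by
    by_cases hqp : q = p
    · rw [hqp, mem_sphere_iff_norm, sub_self, norm_zero] at h
      exact hr0'.ne h
    · exact (hr2 q hq hqp).ne' h
  have h2 := Complex.circleIntegral_sub_center_inv_smul_of_differentiable_on_off_countable_of_tendsto
    (f := fun z => (z - p) * f z) hr0' countable_empty
    (fun z hz => (ContinuousAt.mul (by fun_prop)
      (hdiff z hz.1 hz.2).continuousAt).continuousWithinAt)
    (fun z hz => DifferentiableAt.mul (by fun_prop)
      (hdiff z (Metric.ball_subset_closedBall hz.1.1) hz.1.2)) hℓ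
  have h3 : (∮ z in C(p, r), (z - p)⁻¹ • ((z - p) * f z)) = ∮ z in C(p, r), f z := by
    refine circleIntegral.integral_congr hr0'.le fun z hz => ?_
    have hz0 : z - p ≠ 0 := by
      intro h
      rw [mem_sphere_iff_norm, h, norm_zero] at hz
      exact hr0'.ne hz
    simp only [smul_eq_mul]
    field_simp
  have h4 : (∑ q ∈ F, if q ∈ Metric.ball p r then res q else 0) = res p := by
    rw [Finset.sum_eq_single_of_mem p hp]
    · rw [if_pos (Metric.mem_ball_self hr0')]
    · exact fun q hq hqp => if_neg fun h => (hr2 q hq hqp).not_gt h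
  rw [h3, h1, h4, smul_eq_mul] at h2
  exact mul_left_cancel₀ (Complex.two_pi_I_ne_zero) h2

theorem tendsto_sub_mul_Gamma_neg (n : ℕ) :
    Tendsto (fun z : ℂ => (z - n) * Complex.Gamma (-z)) (𝓝[≠] (n : ℂ))
      (𝓝 (-((-1) ^ n / n.factorial))) := by
  induction n with
  | zero =>
    have h : Tendsto (fun z : ℂ => -z) (𝓝[≠] (0 : ℂ)) (𝓝[≠] 0) := by
      refine tendsto_nhdsWithin_iff.2 ⟨?_, ?_⟩
      · exact (continuous_neg.tendsto' (0 : ℂ) 0 neg_zero).mono_left nhdsWithin_le_nhds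
      · filter_upwards [self_mem_nhdsWithin] with z hz
        simpa using hz
    have := (Complex.tendsto_self_mul_Gamma_nhds_zero.comp h).neg
    simpa [Function.comp_def] using this
  | succ n ih =>
    have h : Tendsto (fun z : ℂ => z - 1) (𝓝[≠] ((n + 1 : ℕ) : ℂ)) (𝓝[≠] (n : ℂ)) := by
      refine tendsto_nhdsWithin_iff.2 ⟨?_, ?_⟩
      · exact ((continuous_sub_right (1 : ℂ)).tendsto' _ _ (by simp)).mono_left nhdsWithin_le_nhds
      · filter_upwards [self_mem_nhdsWithin] with z hz hz'
        refine hz ?_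
        have hz'' : z - 1 = n := hz'
        simp only [Nat.cast_succ, mem_singleton_iff]
        rw [← hz'']
        ring
    have h2 : Tendsto (fun z : ℂ => (-z)⁻¹) (𝓝[≠] ((n + 1 : ℕ) : ℂ))
        (𝓝 (-((n + 1 : ℕ) : ℂ))⁻¹) := by
      refine Tendsto.mono_left (ContinuousAt.tendsto ?_) nhdsWithin_le_nhds
      refine ContinuousAt.inv₀ (by fun_prop) (neg_ne_zero.2 ?_)
      exact_mod_cast n.succ_ne_zero
    have h3 := (ih.comp h).mul h2
    have e : -((-1) ^ (n + 1) / ((n + 1).factorial : ℂ)) =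
        -((-1) ^ n / n.factorial) * (-((n + 1 : ℕ) : ℂ))⁻¹ := by
      have h4 : ((n : ℂ) + 1) ≠ 0 := by exact_mod_cast n.succ_ne_zero
      have h5 : (n.factorial : ℂ) ≠ 0 := by exact_mod_cast n.factorial_ne_zero
      rw [Nat.factorial_succ]
      push_cast
      field_simp
      ring
    rw [e]
    refine h3.congr' ?_
    have hz0 : ∀ᶠ z : ℂ in 𝓝[≠] ((n + 1 : ℕ) : ℂ), z ≠ 0 :=
      mem_nhdsWithin_of_mem_nhds (isOpen_ne.mem_nhds
        (show ((n + 1 : ℕ) : ℂ) ≠ 0 by exact_mod_cast n.succ_ne_zero))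
    filter_upwards [hz0] with z hz
    have h4 := Complex.Gamma_add_one (-z) (neg_ne_zero.2 hz)
    simp only [Function.comp]
    rw [show -(z - 1) = -z + 1 by ring, h4]
    push_cast
    field_simp
    ring

/-- The coefficients of the binomial series in terms of `Γ`. -/
theorem Gamma_add_nat_eq {b : ℂ} (hb : ∀ k : ℕ, b ≠ -k) (n : ℕ) :
    Complex.Gamma (b + n) = Complex.Gamma b * (n.factorial * Ring.choose (b + n - 1) n) := by
  rw [← Ring.multichoose_eq, ← nsmul_eq_mul, Ring.factorial_nsmul_multichoose_eq_ascPochhammer,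
    Polynomial.ascPochhammer_smeval_eq_eval]
  induction n with
  | zero => simp
  | succ n ih =>
    rw [ascPochhammer_succ_eval, Nat.cast_succ, ← add_assoc, Complex.Gamma_add_one, ih]
    · ring
    · exact fun h => hb n (eq_neg_of_add_eq_zero_left h)

theorem hasSum_Gamma_binomial {b : ℂ} (hb : ∀ k : ℕ, b ≠ -k) {y : ℂ} (hy : ‖y‖ < 1) :
    HasSum (fun n : ℕ => Complex.Gamma (b + n) * y ^ n / n.factorial)
      (Complex.Gamma b * (1 - y) ^ (-b)) := by
  have h := (Complex.one_div_one_sub_cpow_hasFPowerSeriesOnBall_zero b).hasSum (y := y)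
    (by
      rw [Metric.mem_eball, edist_zero_right, ← ofReal_norm]
      exact ENNReal.ofReal_lt_one.2 hy)
  rw [zero_add, one_div, ← Complex.cpow_neg] at h
  refine (h.mul_left (Complex.Gamma b)).congr_fun ?_
  intro n
  have h5 : (n.factorial : ℂ) ≠ 0 := by exact_mod_cast n.factorial_ne_zero
  simp only [FormalMultilinearSeries.ofScalars_apply_eq, smul_eq_mul]
  rw [Gamma_add_nat_eq hb]
  field_simp

namespace secondParams

variable {μ γ : ℂ}

theorem theta_eq (η : ℂ) : (secondParams μ γ).theta η =
    Complex.Gamma (-η) * Complex.Gamma (μ + γ + η) := by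
  change (∏ j : Fin 1, if (j : ℕ) < 1 then Complex.Gamma (0 - ((1 : ℝ) : ℂ) * η)
      else (Complex.Gamma (1 - 0 + ((1 : ℝ) : ℂ) * η))⁻¹) *
    (∏ j : Fin 1, if (j : ℕ) < 1 then Complex.Gamma (1 - (1 - μ - γ) + ((1 : ℝ) : ℂ) * η)
      else (Complex.Gamma (1 - μ - γ - ((1 : ℝ) : ℂ) * η))⁻¹) = _
  simp only [Fin.prod_univ_one, Fin.val_zero, zero_lt_one, if_true, Complex.ofReal_one, one_mul,
    zero_sub]
  congr 2
  ring

theorem mem_rightPoles {s : ℂ} : s ∈ (secondParams μ γ).rightPoles ↔ ∃ k : ℕ, s = k := by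
  simp [FoxData.rightPoles, secondParams]

theorem mem_leftPoles {s : ℂ} : s ∈ (secondParams μ γ).leftPoles ↔
    ∃ k : ℕ, s = -(μ + γ) - k := by
  simp only [FoxData.leftPoles, secondParams, mem_ofPred_eq, Complex.ofReal_one, div_one]
  constructor
  · rintro ⟨_, k, _, rfl⟩
    exact ⟨k, by ring⟩
  · rintro ⟨k, rfl⟩
    exact ⟨0, k, one_pos, by ring⟩

theorem exists_of_norm_lt_one (hre : -1 < (μ + γ).re) (h0 : μ + γ ≠ 0) {z : ℂ} (hz : z ≠ 0)
    (hz1 : ‖z‖ < 1) : (secondParams μ γ).Exists .loop z := by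
  refine ⟨hz, disjoint_left.2 fun s hs hs' => ?_, Or.inr ⟨?_, ?_⟩⟩
  · obtain ⟨k, rfl⟩ := mem_rightPoles.1 hs
    obtain ⟨l, hl⟩ := mem_leftPoles.1 hs'
    have h1 : μ + γ = -((k + l : ℕ) : ℂ) := by
      push_cast
      linear_combination hl
    rw [h1, Complex.neg_re, Complex.natCast_re, neg_lt_neg_iff] at hre
    have h2 : k + l < 1 := by exact_mod_cast hre
    rw [h1, show k + l = 0 by omega] at h0
    simp at h0
  · change (∑ _ : Fin 1, (1 : ℝ)) - ∑ _ : Fin 1, (1 : ℝ) = 0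
    exact sub_self _
  · change ‖z‖ < (∏ _ : Fin 1, (1 : ℝ) ^ (-1 : ℝ)) * ∏ _ : Fin 1, (1 : ℝ) ^ (1 : ℝ)
    simpa using hz1

open Filter Topology Asymptotics

theorem add_ne_neg_nat (hre : -1 < (μ + γ).re) (h0 : μ + γ ≠ 0) (k : ℕ) : μ + γ ≠ -k := by
  intro h
  rw [h, Complex.neg_re, Complex.natCast_re, neg_lt_neg_iff] at hre
  have h2 : k < 1 := by exact_mod_cast hre
  rw [h, show k = 0 by omega] at h0
  simp at h0

theorem tendsto_residue (hre : -1 < (μ + γ).re) (h0 : μ + γ ≠ 0) {y : ℂ} (hy0 : y ≠ 0) (n : ℕ) :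
    Tendsto (fun s : ℂ => (s - n) * ((secondParams μ γ).theta s * (-y) ^ s)) (𝓝[≠] (n : ℂ))
      (𝓝 (-(Complex.Gamma (μ + γ + n) * y ^ n / n.factorial))) := by
  have h1 : ContinuousAt (fun s : ℂ => Complex.Gamma (μ + γ + s)) (n : ℂ) := by
    refine ContinuousAt.comp (g := Complex.Gamma) (f := fun s : ℂ => μ + γ + s)
      (Complex.differentiableAt_Gamma _ fun m hm => ?_).continuousAt (by fun_prop)
    refine add_ne_neg_nat hre h0 (m + n) ?_
    push_cast
    linear_combination hm
  have h2 : ContinuousAt (fun s : ℂ => (-y) ^ s) (n : ℂ) :=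
    continuousAt_const_cpow (neg_ne_zero.2 hy0)
  have h3 := ((tendsto_sub_mul_Gamma_neg n).mul
    ((h1.tendsto.mono_left nhdsWithin_le_nhds).mul (h2.tendsto.mono_left nhdsWithin_le_nhds)))
  have e : -(Complex.Gamma (μ + γ + n) * y ^ n / n.factorial) =
      -((-1) ^ n / n.factorial) * (Complex.Gamma (μ + γ + n) * (-y) ^ (n : ℂ)) := by
    rw [Complex.cpow_natCast, neg_pow y n]
    have : ((-1 : ℂ) ^ n) * (-1) ^ n = 1 := by rw [← mul_pow]; simp
    linear_combination Complex.Gamma (μ + γ + n) * y ^ n / n.factorial * this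
  rw [e]
  refine h3.congr fun s => ?_
  rw [theta_eq]
  ring

/-- The integral over a long truncation of the loop. Only the poles `0, …, N` of `Γ(-η)` lie between
the contour and the line `Re η = N + 1/2` that closes it. -/
theorem boxIntegral_eq_sum (hre : -1 < (μ + γ).re) (h0 : μ + γ ≠ 0) {L : MBContour .loop}
    (hL : (secondParams μ γ).Separates L) {y : ℂ} (hy0 : y ≠ 0) {N : ℕ} (hN : 1 ≤ N)
    (hc : L.c < N + 1 / 2)
    (hball : ∀ i, ∀ p ∈ Metric.ball (L.center i) (L.radius i), p.re < (N + 1 / 2 : ℝ)) :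
    L.boxIntegral (N + 1 / 2) L.h (fun s => (secondParams μ γ).theta s * (-y) ^ s) =
      Complex.I * (∫ t in (-L.h)..L.h, (secondParams μ γ).theta ((N + 1 / 2 : ℝ) + t * Complex.I) *
        (-y) ^ ((N + 1 / 2 : ℝ) + t * Complex.I)) + 2 * Real.pi * Complex.I *
      ∑ n ∈ Finset.range (N + 1), Complex.Gamma (μ + γ + n) * y ^ n / n.factorial := by
  classical
  have H := (secondParams μ γ).hasPolesIn_theta (neg_ne_zero.2 hy0)
  set f : ℂ → ℂ := fun s => (secondParams μ γ).theta s * (-y) ^ s with hf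
  have hb : Bornology.IsBounded ((closedRect L.c (N + 1 / 2) (-L.h) L.h ∪
      ⋃ i, Metric.closedBall (L.center i) (L.radius i)) ∪
      ((Finset.range (N + 1)).image fun n : ℕ => (n : ℂ) : Finset ℂ)) := by
    refine ((isBounded_closedRect _ _ _ _).union ?_).union (Finset.finite_toSet _).isBounded
    exact Bornology.isBounded_iUnion.2 fun i => Metric.isBounded_closedBall
  obtain ⟨ρ, hρ⟩ := hb.subset_ball (0 : ℂ)
  simp only [union_subset_iff, iUnion_subset_iff] at hρ
  obtain ⟨res, hres⟩ := H.exists_residues ρ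
  have hmem : ∀ p ∈ (H.finite ρ).toFinset, p ∈ (secondParams μ γ).poles := fun p hp => by
    rw [Finite.mem_toFinset] at hp
    exact hp.1
  have hright : ∀ n : ℕ, (n : ℂ) ∈ (secondParams μ γ).rightPoles := fun n =>
    mem_rightPoles.2 ⟨n, rfl⟩
  have hlre : ∀ p ∈ (secondParams μ γ).leftPoles, p.re < (N + 1 / 2 : ℝ) := by
    intro p hp
    obtain ⟨k, rfl⟩ := mem_leftPoles.1 hp
    simp only [Complex.sub_re, Complex.neg_re, Complex.natCast_re]
    have : (1 : ℝ) ≤ N := by exact_mod_cast hN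
    linarith [(k.cast_nonneg : (0 : ℝ) ≤ k)]
  have hRne : ∀ p ∈ (secondParams μ γ).poles, p.re ≠ (N + 1 / 2 : ℝ) := by
    rintro p (hp | hp)
    · obtain ⟨k, rfl⟩ := mem_rightPoles.1 hp
      rw [Complex.natCast_re]
      intro h
      have : (2 * k : ℝ) = 2 * N + 1 := by linarith
      have : 2 * k = 2 * N + 1 := by exact_mod_cast this
      omega
    · exact (hlre p hp).ne
  have hdiff : ∀ z ∈ Metric.ball (0 : ℂ) ρ, z ∉ (H.finite ρ).toFinset → DifferentiableAt ℂ f z :=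
    fun z hz hzF => H.differentiableAt z fun hzS => hzF ((Finite.mem_toFinset _).2 ⟨hzS, hz⟩)
  rw [MBContour.boxIntegral_eq hres hc.le L.h_pos.le hρ.1.1 hρ.1.2]
  · congr 2
    rw [← Finset.sum_subset (s₁ := (Finset.range (N + 1)).image fun n : ℕ => (n : ℂ))]
    · rw [Finset.sum_image (Nat.cast_injective.injOn)]
      refine Finset.sum_congr rfl fun n hn => ?_
      have hnN : (n : ℝ) ≤ N := by exact_mod_cast Nat.lt_succ_iff.1 (Finset.mem_range.1 hn)
      have hnb : (n : ℂ) ∈ Metric.ball (0 : ℂ) ρ := hρ.2 (Finset.mem_image_of_mem _ hn)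
      rw [L.boxIndex_loop hball, (hL.1 _ (hright n)).2,
        if_pos (by rw [Complex.natCast_re]; linarith),
        hres.res_eq Metric.isOpen_ball hdiff ((Finite.mem_toFinset _).2 ⟨Or.inl (hright n), hnb⟩) hnb
          (tendsto_residue hre h0 hy0 n)]
      simp
    · intro p hp
      obtain ⟨n, hn, rfl⟩ := Finset.mem_image.1 hp
      exact (Finite.mem_toFinset _).2 ⟨Or.inl (hright n), hρ.2 hp⟩
    · intro p hp hpn
      rw [L.boxIndex_loop hball]
      rcases hmem p hp with h | h
      · obtain ⟨k, rfl⟩ := mem_rightPoles.1 h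
        rw [if_neg, Int.cast_zero, zero_mul]
        rw [Complex.natCast_re, not_lt]
        have hk : N + 1 ≤ k := by
          by_contra hk
          exact hpn (Finset.mem_image_of_mem _ (Finset.mem_range.2 (not_le.1 hk)))
        have : (N + 1 : ℝ) ≤ k := by exact_mod_cast hk
        linarith
      · rw [(hL.2 p h).2]
        simp
  · rintro p hp ⟨⟨h1, h2⟩, h3⟩
    have h4 := hL.notMem_support (hmem p hp)
    have h3' := abs_le.2 h3
    exact ⟨⟨lt_of_le_of_ne h1 fun e => h4 (Or.inl (Or.inl ⟨e.symm, h3'⟩)),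
      lt_of_le_of_ne h2 (hRne p (hmem p hp))⟩,
      abs_lt.1 (lt_of_le_of_ne h3' fun e => h4 (Or.inl (Or.inr ⟨h1, e⟩)))⟩
  · exact fun p hp i hpi => hL.notMem_support (hmem p hp) (Or.inr (mem_iUnion.2 ⟨i, hpi⟩))

/-- `(2πi)⁻¹ ∫ Γ(-η) Γ(b + η) (-y)^η dη = Γ(b) (1 - y)^{-b}` over a loop: the residues at the poles of
`Γ(-η)` are the terms of the binomial series. -/
theorem integral_theta (hre : -1 < (μ + γ).re) (h0 : μ + γ ≠ 0) {L : MBContour .loop}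
    (hL : (secondParams μ γ).Separates L) {y : ℂ} (hy0 : y ≠ 0) (hy : ‖y‖ < 1) :
    L.integral (fun s => (secondParams μ γ).theta s * (-y) ^ s) =
      2 * Real.pi * Complex.I * (Complex.Gamma (μ + γ) * (1 - y) ^ (-(μ + γ))) := by
  have hE : (secondParams μ γ).Exists .loop (-y) :=
    exists_of_norm_lt_one hre h0 (neg_ne_zero.2 hy0) (by rwa [norm_neg])
  have hlim : Tendsto (fun N : ℕ => (N + 1 / 2 : ℝ)) atTop atTop :=
    tendsto_atTop_add_const_right _ _ tendsto_natCast_atTop_atTop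
  have h1 := (L.tendsto_boxIntegral_loop (hL.integrable hE)).comp hlim
  have h2 := ((hasSum_Gamma_binomial (add_ne_neg_nat hre h0) hy).tendsto_sum_nat.comp
    (tendsto_add_atTop_nat 1)).const_mul (2 * Real.pi * Complex.I)
  have h3 : Tendsto (fun N : ℕ => Complex.I * (∫ t in (-L.h)..L.h,
      (secondParams μ γ).theta ((N + 1 / 2 : ℝ) + t * Complex.I) *
        (-y) ^ ((N + 1 / 2 : ℝ) + t * Complex.I))) atTop (𝓝 (Complex.I * 0)) := by
    refine Tendsto.const_mul _ ?_
    -- On the closing segments `Re η = N + 1/2`, so `|sin (πη)| ≥ 1` and the integrand decays.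
    obtain ⟨c, hc, hO⟩ := FoxData.exists_isBigO_exp_of_sin hE
      (A := {s : ℂ | |s.im| ≤ L.h ∧ ∃ N : ℕ, s.re = N + 1 / 2}) (H := L.h) (fun s hs => hs.1)
      fun j _ => ⟨1, one_pos, by
        rintro s ⟨_, N, hs⟩
        refine le_trans (le_of_eq ?_) (abs_sin_re_le_norm_sin _)
        change 1 = |Real.sin (((Real.pi : ℂ) * (0 - ((1 : ℝ) : ℂ) * s)).re)|
        rw [Complex.re_ofReal_mul]
        simp only [Complex.ofReal_one, one_mul, zero_sub, Complex.neg_re, hs]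
        rw [show Real.pi * -((N : ℝ) + 1 / 2) = -(Real.pi / 2 + N * Real.pi) by ring, Real.sin_neg,
          Real.sin_add_nat_mul_pi, Real.sin_pi_div_two, abs_neg, mul_one, abs_pow, abs_neg, abs_one,
          one_pow]⟩
    have h4 := hO.trans_tendsto (Real.tendsto_exp_atBot.comp
      ((tendsto_re_rightFilter _).const_mul_atTop_of_neg (neg_lt_zero.2 hc)))
    refine Metric.tendsto_atTop.2 fun ε hε => ?_
    have h5 := h4.norm.eventually_le_const (u := ε / (2 * L.h + 1))
      (by rw [norm_zero]; have := L.h_pos; positivity)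
    rw [rightFilter, eventually_inf_principal, eventually_comap, eventually_atTop] at h5
    obtain ⟨R, hR⟩ := h5
    obtain ⟨N₀, hN₀⟩ := exists_nat_ge R
    refine ⟨N₀, fun N hN => ?_⟩
    have hh := L.h_pos
    rw [dist_zero_right]
    refine (intervalIntegral.norm_integral_le_of_norm_le_const (C := ε / (2 * L.h + 1))
      fun t ht => ?_).trans_lt ?_
    · have hN' : (N₀ : ℝ) ≤ N := by exact_mod_cast hN
      refine hR (N + 1 / 2) (by linarith) _ (by simp) ⟨?_, N, by simp⟩
      rw [uIoc_of_le (by linarith)] at ht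
      simpa using abs_le.2 ⟨ht.1.le, ht.2⟩
    · rw [show L.h - -L.h = 2 * L.h by ring, abs_of_pos (by positivity), div_mul_eq_mul_div,
        div_lt_iff₀ (by positivity)]
      nlinarith
  refine tendsto_nhds_unique h1 ?_
  rw [mul_zero] at h3
  have h6 := h3.add h2
  rw [zero_add] at h6
  refine h6.congr' ?_
  obtain ⟨R₀, hR₀⟩ := L.exists_right
  filter_upwards [hlim.eventually_ge_atTop R₀, eventually_ge_atTop 1] with N hN hN1
  exact (boxIntegral_eq_sum hre h0 hL hy0 hN1 (hR₀ _ hN).1 (hR₀ _ hN).2).symm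

end secondParams

end

/-! ### The double Mellin-Barnes integral as an Euler integral of the H-function -/

theorem ofReal_mul_cpow {t : ℝ} (ht : 0 < t) (z s : ℂ) :
    ((t : ℂ) * z) ^ s = (t : ℂ) ^ s * z ^ s := by
  rcases eq_or_ne s 0 with rfl | hs
  · simp
  rcases eq_or_ne z 0 with rfl | hz
  · simp [hs]
  have ht' : (t : ℂ) ≠ 0 := by exact_mod_cast ht.ne'
  rw [Complex.cpow_def_of_ne_zero (mul_ne_zero ht' hz), Complex.cpow_def_of_ne_zero ht',
    Complex.cpow_def_of_ne_zero hz, Complex.log_ofReal_mul ht hz, Complex.ofReal_log ht.le,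
    add_mul, Complex.exp_add]

theorem norm_ofReal_cpow {t : ℝ} (ht : 0 < t) (s : ℂ) : ‖(t : ℂ) ^ s‖ = t ^ s.re :=
  Complex.norm_cpow_eq_rpow_re_of_pos ht s

theorem Gamma_mul_inv_eq_integral {s μ : ℂ} (hs : 0 < s.re) (hμ : 0 < μ.re) :
    Complex.Gamma s * (Complex.Gamma (s + μ))⁻¹ = (Complex.Gamma μ)⁻¹ *
      ∫ τ in Ioo (0 : ℝ) 1, (τ : ℂ) ^ (s - 1) * ((1 - τ : ℝ) : ℂ) ^ (μ - 1) := by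
  have h := Complex.Gamma_mul_Gamma_eq_betaIntegral hs hμ
  have h1 : Complex.Gamma μ ≠ 0 := Complex.Gamma_ne_zero_of_re_pos hμ
  have h2 : Complex.Gamma (s + μ) ≠ 0 := Complex.Gamma_ne_zero_of_re_pos (by simp; linarith)
  have h3 : Complex.betaIntegral s μ =
      ∫ τ in Ioo (0 : ℝ) 1, (τ : ℂ) ^ (s - 1) * ((1 - τ : ℝ) : ℂ) ^ (μ - 1) := by
    rw [Complex.betaIntegral, intervalIntegral.integral_of_le zero_le_one,
      integral_Ioc_eq_integral_Ioo]
    push_cast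
    rfl
  rw [← h3]
  field_simp
  linear_combination h

theorem integrableOn_beta {u v : ℝ} (hu : 0 < u) (hv : 0 < v) :
    IntegrableOn (fun τ : ℝ => τ ^ (u - 1) * (1 - τ) ^ (v - 1)) (Ioo 0 1) := by
  have h := (Complex.betaIntegral_convergent (u := u) (v := v) (by simpa) (by simpa)).norm
  rw [intervalIntegrable_iff_integrableOn_Ioo_of_le zero_le_one] at h
  refine h.congr_fun (fun τ hτ => ?_) measurableSet_Ioo
  have h1 : (1 - τ : ℂ) = ((1 - τ : ℝ) : ℂ) := by push_cast; rfl
  beta_reduce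
  rw [norm_mul, h1, norm_ofReal_cpow hτ.1, norm_ofReal_cpow (sub_pos.2 hτ.2)]
  simp

namespace MBContour

variable {κ : ContourKind} {L : MBContour κ}

/-- Fubini's theorem for an Euler integral under a contour integral. -/
theorem Integrable.integral_mul_beta {g e : ℂ → ℂ} (hg : L.Integrable g) (hgm : Measurable g)
    (he : Measurable e) {ε : ℝ} (hε : 0 < ε) (he' : ∀ s ∈ L.support, ε ≤ (e s).re) {μ : ℂ}
    (hμ : 0 < μ.re) {k : ℝ → ℂ} (hk : Measurable k) {C : ℝ} (hC : ∀ τ ∈ Ioo (0 : ℝ) 1, ‖k τ‖ ≤ C) :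
    L.integral (fun s => g s *
      ∫ τ in Ioo (0 : ℝ) 1, (τ : ℂ) ^ (e s - 1) * (((1 - τ : ℝ) : ℂ) ^ (μ - 1) * k τ)) =
    ∫ τ in Ioo (0 : ℝ) 1, ((1 - τ : ℝ) : ℂ) ^ (μ - 1) * k τ *
      L.integral fun s => g s * (τ : ℂ) ^ (e s - 1) := by
  simp only [← MeasureTheory.integral_const_mul, ← integral_const_mul']
  rw [integral_integral_swap (B := fun τ => τ ^ (ε - 1) * (1 - τ) ^ (μ.re - 1) * C) measurableSet_Ioo
    ?_ hg ((integrableOn_beta hε hμ).mul_const C)]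
  · refine setIntegral_congr_fun measurableSet_Ioo fun τ _ => ?_
    exact integral_congr fun s _ => by ring
  · intro s hs τ hτ
    rw [norm_mul, norm_mul, norm_mul, norm_ofReal_cpow hτ.1, norm_ofReal_cpow (sub_pos.2 hτ.2),
      Complex.sub_re, Complex.sub_re, Complex.one_re, mul_assoc]
    have h1 : τ ^ ((e s).re - 1) ≤ τ ^ (ε - 1) :=
      Real.rpow_le_rpow_of_exponent_ge hτ.1 hτ.2.le (by linarith [he' s hs])
    have h2 : 0 ≤ (1 - τ) ^ (μ.re - 1) := Real.rpow_nonneg (sub_pos.2 hτ.2).le _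
    have h3 : 0 ≤ τ ^ (ε - 1) := Real.rpow_nonneg hτ.1.le _
    have := hC τ hτ
    gcongr
  · have : Measurable fun z : ℂ × ℝ => (z.2 : ℂ) := by fun_prop
    simp only [Function.uncurry_def]
    fun_prop

/-- A loop with `s` on its right passes to the left of `s`. -/
theorem exists_re_le_of_side_eq_zero {L : MBContour .loop} {s : ℂ} (hs : L.side s = 0) :
    ∃ η ∈ L.support, η.re ≤ s.re := by
  by_cases hc : L.c ≤ s.re
  · exact ⟨L.c, Or.inl (Or.inl ⟨by simp, by simpa using L.h_pos.le⟩), by simpa using hc⟩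
  · by_cases hi : ∃ i, s ∈ Metric.ball (L.center i) (L.radius i)
    · obtain ⟨i, hi⟩ := hi
      refine ⟨L.center i - L.radius i, Or.inr (mem_iUnion.2 ⟨i, ?_⟩), ?_⟩
      · simp [abs_of_pos (L.radius_pos i)]
      · have h := Complex.abs_re_le_norm (s - L.center i)
        rw [Metric.mem_ball, dist_eq_norm] at hi
        simp only [Complex.sub_re, Complex.ofReal_re] at h ⊢
        linarith [(abs_le.1 h).1]
    · push Not at hi
      simp only [MBContour.side] at hs
      rw [Finset.sum_eq_zero fun i _ => if_neg (hi i), if_neg fun h => hc h.1.le] at hs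
      simp at hs

end MBContour

theorem couplingParams_theta_eq (μ β : ℂ) (α : ℝ) (hα : 0 < α) (ξ η : ℂ) :
    (couplingParams μ β α hα).theta ξ η =
      Complex.Gamma (β + α * ξ + η) * (Complex.Gamma (β + α * ξ + η + μ))⁻¹ := by
  change (∏ j : Fin 1, if (j : ℕ) < 1 then
      Complex.Gamma (1 - (1 - β) + (α : ℂ) * ξ + ((1 : ℝ) : ℂ) * η)
      else (Complex.Gamma (1 - β - (α : ℂ) * ξ - ((1 : ℝ) : ℂ) * η))⁻¹) *
    (∏ j : Fin 1, (Complex.Gamma (1 - (1 - μ - β) + (α : ℂ) * ξ + ((1 : ℝ) : ℂ) * η))⁻¹) = _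
  simp only [Fin.prod_univ_one, Fin.val_zero, zero_lt_one, if_true, Complex.ofReal_one, one_mul]
  congr 3 <;> ring

section EulerIntegral

variable {κ : ContourKind} {P : FoxData} {γ μ β : ℂ} {α : ℝ} {hα : 0 < α}

theorem admissible_couplingParams_iff {L₁ : MBContour κ} {L₂ : MBContour .loop} :
    (couplingParams μ β α hα).Admissible P (secondParams μ γ) L₁ L₂ ↔
      P.Separates L₁ ∧ (secondParams μ γ).Separates L₂ ∧
        ∀ ξ ∈ L₁.support, ∀ η ∈ L₂.support, 0 < (β + α * ξ + η).re := by
  have h : ∀ ξ η : ℂ, 1 - (1 - β) + α * ξ + ((1 : ℝ) : ℂ) * η = β + α * ξ + η := fun ξ η => by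
    push_cast; ring
  refine and_congr_right fun _ => and_congr_right fun _ => ?_
  refine forall₂_congr fun ξ _ => forall₂_congr fun η _ => ?_
  rw [← h]
  exact ⟨fun H => H (0 : Fin 1) one_pos, fun H j _ => H⟩

/-- The line `Re ξ = c₀` has the poles of the first family on its right and lies in the half-plane
`Re (β + α ξ) > 0`. -/
theorem exists_line_of_re_pos (hα : 0 < α)
    (hb : ∀ j : Fin P.q, (j : ℕ) < P.m → 0 < β.re + (α * P.b j / P.B j).re) :
    ∃ c₀ : ℝ, 0 < β.re + α * c₀ ∧ ∀ s ∈ P.rightPoles, c₀ < s.re := by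
  open Filter Topology in
  obtain ⟨c₀, h1, h2⟩ : ∃ c₀, (∀ j : Fin P.q, (j : ℕ) < P.m → c₀ < (P.b j).re / P.B j) ∧
      c₀ ∈ Ioi (-β.re / α) := by
    refine (Eventually.and (f := 𝓝[>] (-β.re / α)) (eventually_all.2 fun j => ?_)
      self_mem_nhdsWithin).exists
    by_cases hj : (j : ℕ) < P.m
    · have h := hb j hj
      rw [Complex.div_ofReal_re, Complex.re_ofReal_mul, mul_div_assoc] at h
      have h1 : -β.re / α < (P.b j).re / P.B j := by
        rw [div_lt_iff₀ hα]
        linarith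
      filter_upwards [mem_nhdsWithin_of_mem_nhds (Iio_mem_nhds h1)] with c hc _ using hc
    · exact Eventually.of_forall fun c h => absurd h hj
  refine ⟨c₀, ?_, ?_⟩
  · have h3 : -β.re / α < c₀ := h2
    rw [div_lt_iff₀ hα] at h3
    linarith
  · rintro s ⟨j, k, hj, rfl⟩
    have hB := P.B_pos j
    refine (h1 j hj).trans_le ?_
    rw [Complex.div_ofReal_re]
    simp only [Complex.add_re, Complex.natCast_re]
    gcongr
    linarith [(k.cast_nonneg : (0 : ℝ) ≤ k)]

theorem exists_admissible (hb : ∀ j : Fin P.q, (j : ℕ) < P.m → 0 < β.re + (α * P.b j / P.B j).re)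
    (hd : Disjoint P.rightPoles P.leftPoles)
    (hd₂ : Disjoint (secondParams μ γ).rightPoles (secondParams μ γ).leftPoles) :
    ∃ L : MBContour κ × MBContour .loop,
      (couplingParams μ β α hα).Admissible P (secondParams μ γ) L.1 L.2 := by
  obtain ⟨c₀, hc, hc₀⟩ := exists_line_of_re_pos hα hb
  obtain ⟨L₁, h₁, h₁'⟩ := FoxData.exists_separates κ hd hc₀
  -- The poles `0, 1, …` of `Γ(-η)` leave room for a second contour with `Re η > -(Re β + α c₀)`.
  obtain ⟨L₂, h₂, h₂'⟩ := FoxData.exists_separates (c₀ := -(β.re + α * c₀)) .loop hd₂ fun s hs => by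
    obtain ⟨k, rfl⟩ := secondParams.mem_rightPoles.1 hs
    rw [Complex.natCast_re]
    linarith [(k.cast_nonneg : (0 : ℝ) ≤ k)]
  refine ⟨(L₁, L₂), admissible_couplingParams_iff.2 ⟨h₁, h₂, fun ξ hξ η hη => ?_⟩⟩
  have h3 := mul_lt_mul_of_pos_left (h₁' ξ hξ) hα
  have h4 := h₂' η hη
  rw [Complex.add_re, Complex.add_re, Complex.re_ofReal_mul]
  linarith

/-- `H(z₁, -v) = Γ(μ + γ) / Γ(μ) ∫₀¹ τ^{β-1} (1-τ)^{μ-1} (1-vτ)^{-μ-γ} H(z₁ τ^α) dτ`: the quotient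
`Γ(β + αξ + η) / Γ(μ + β + αξ + η)` is an Euler integral, and the integration over `η` then gives a
power of `1 - vτ`. -/
theorem foxH₂_eq_integral (hγ : -1 < γ.re) (hμ : 0 < μ.re) (hμγ : μ + γ ≠ 0)
    (hb : ∀ j : Fin P.q, (j : ℕ) < P.m → 0 < β.re + (α * P.b j / P.B j).re)
    {z : ℂ} (hz : ∀ τ ∈ Ioc (0 : ℝ) 1, P.Exists κ (z * ((τ ^ α : ℝ) : ℂ)))
    {v : ℝ} (hv0 : 0 < v) (hv1 : v < 1) :
    foxH₂ κ .loop (couplingParams μ β α hα) P (secondParams μ γ) z ((-v : ℝ) : ℂ) =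
      Complex.Gamma (μ + γ) / Complex.Gamma μ *
        ∫ τ in Ioo (0 : ℝ) 1, (τ : ℂ) ^ (β - 1) * ((1 - τ : ℝ) : ℂ) ^ (μ - 1) *
          ((1 - v * τ : ℝ) : ℂ) ^ (-(μ + γ)) * foxH κ P (z * ((τ ^ α : ℝ) : ℂ)) := by
  have hre : -1 < (μ + γ).re := by rw [Complex.add_re]; linarith
  have hz1 : P.Exists κ z := by simpa using hz 1 ⟨one_pos, le_rfl⟩
  have hE₂ : ∀ τ ∈ Ioc (0 : ℝ) 1, (secondParams μ γ).Exists .loop (-((v * τ : ℝ) : ℂ)) := by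
    intro τ hτ
    have h1 : 0 < v * τ := mul_pos hv0 hτ.1
    refine secondParams.exists_of_norm_lt_one hre hμγ (neg_ne_zero.2 (by exact_mod_cast h1.ne')) ?_
    rw [norm_neg, Complex.norm_of_nonneg h1.le]
    exact (mul_le_of_le_one_right hv0.le hτ.2).trans_lt hv1
  have hE₂v : (secondParams μ γ).Exists .loop (-(v : ℂ)) := by
    simpa using hE₂ 1 ⟨one_pos, le_rfl⟩
  have hex := exists_admissible (κ := κ) (hα := hα) hb hz1.2.1 hE₂v.2.1
  rw [foxH₂, dif_pos hex]
  obtain ⟨hL₁, hL₂, hpos⟩ := admissible_couplingParams_iff.1 hex.choose_spec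
  set L₁ := hex.choose.1
  set L₂ := hex.choose.2
  -- A common lower bound `ε > 0` of `Re (β + αξ + η)` and `Re (β + αξ)` on the contours.
  obtain ⟨ξ₀, hξ₀, hmin₁⟩ := L₁.exists_re_le
  obtain ⟨η₀, hη₀, hmin₂⟩ := L₂.exists_re_le
  obtain ⟨η₁, hη₁, hη₁0⟩ := MBContour.exists_re_le_of_side_eq_zero
    (hL₂.1 0 (secondParams.mem_rightPoles.2 ⟨0, by simp⟩)).2
  have hη₀0 : η₀.re ≤ 0 := (hmin₂ η₁ hη₁).trans (by simpa using hη₁0)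
  set ε : ℝ := (β + α * ξ₀ + η₀).re with hεdef
  have hε : 0 < ε := hpos ξ₀ hξ₀ η₀ hη₀
  have hε₁ : ∀ ξ ∈ L₁.support, ∀ η : ℂ, η₀.re ≤ η.re → ε ≤ (β + α * ξ + η).re := by
    intro ξ hξ η hη
    simp only [hεdef, Complex.add_re, Complex.re_ofReal_mul]
    have := mul_le_mul_of_nonneg_left (hmin₁ ξ hξ) hα.le
    linarith
  set g₁ : ℂ → ℂ := fun ξ => P.theta ξ * z ^ ξ with hg₁
  set g₂ : ℂ → ℂ := fun η => (secondParams μ γ).theta η * (-(v : ℂ)) ^ η with hg₂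
  have hpow : ∀ c : ℂ, Measurable fun s : ℂ => c ^ s := fun c => by fun_prop
  have hg₁m : Measurable g₁ := P.measurable_theta.mul (hpow z)
  have hg₂m : Measurable g₂ := (secondParams μ γ).measurable_theta.mul (hpow _)
  have hkm : Measurable fun τ : ℝ => ((1 - v * τ : ℝ) : ℂ) ^ (-(μ + γ)) := by fun_prop
  have hkC : ∀ τ ∈ Ioo (0 : ℝ) 1, ‖((1 - v * τ : ℝ) : ℂ) ^ (-(μ + γ))‖ ≤
      1 + (1 - v) ^ (-(μ + γ).re) := by
    intro τ hτ
    have h1 : v * τ < v := mul_lt_of_lt_one_right hv0 hτ.2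
    have h2 : 0 < v * τ := mul_pos hv0 hτ.1
    have h3 : 0 < 1 - v := by linarith
    rw [norm_ofReal_cpow (by linarith), Complex.neg_re]
    have h4 : 0 ≤ (1 - v) ^ (-(μ + γ).re) := Real.rpow_nonneg h3.le _
    rcases le_total 0 (μ + γ).re with h | h
    · have := Real.rpow_le_rpow_of_nonpos h3 (by linarith : 1 - v ≤ 1 - v * τ) (neg_nonpos.2 h)
      linarith
    · have := Real.rpow_le_one (by linarith : 0 ≤ 1 - v * τ) (by linarith) (neg_nonneg.2 h)
      linarith
  have hinner : ∀ ξ ∈ L₁.support, L₂.integral (fun η => (couplingParams μ β α hα).theta ξ η *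
      P.theta ξ * (secondParams μ γ).theta η * z ^ ξ * ((-v : ℝ) : ℂ) ^ η) =
      (2 * Real.pi * Complex.I * (Complex.Gamma (μ + γ) / Complex.Gamma μ)) * (g₁ ξ *
        ∫ τ in Ioo (0 : ℝ) 1, (τ : ℂ) ^ (β + α * ξ - 1) *
          (((1 - τ : ℝ) : ℂ) ^ (μ - 1) * ((1 - v * τ : ℝ) : ℂ) ^ (-(μ + γ)))) := by
    intro ξ hξ
    have e1 : L₂.integral (fun η => (couplingParams μ β α hα).theta ξ η *
        P.theta ξ * (secondParams μ γ).theta η * z ^ ξ * ((-v : ℝ) : ℂ) ^ η) =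
        (g₁ ξ * (Complex.Gamma μ)⁻¹) * L₂.integral (fun η => g₂ η * ∫ τ in Ioo (0 : ℝ) 1,
          (τ : ℂ) ^ (β + α * ξ + η - 1) * (((1 - τ : ℝ) : ℂ) ^ (μ - 1) * 1)) := by
      rw [← MBContour.integral_const_mul']
      refine MBContour.integral_congr fun η hη => ?_
      rw [couplingParams_theta_eq, Gamma_mul_inv_eq_integral (hpos ξ hξ η hη) hμ]
      simp only [hg₁, hg₂, mul_one, Complex.ofReal_neg]
      ring
    rw [e1, MBContour.Integrable.integral_mul_beta (hL₂.integrable hE₂v) hg₂m (by fun_prop) hε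
      (fun η hη => hε₁ ξ hξ η (hmin₂ η hη)) hμ measurable_const (C := 1) (by simp)]
    have e2 : ∀ τ ∈ Ioo (0 : ℝ) 1, ((1 - τ : ℝ) : ℂ) ^ (μ - 1) * 1 *
        L₂.integral (fun η => g₂ η * (τ : ℂ) ^ (β + α * ξ + η - 1)) =
        (2 * Real.pi * Complex.I * Complex.Gamma (μ + γ)) * ((τ : ℂ) ^ (β + α * ξ - 1) *
          (((1 - τ : ℝ) : ℂ) ^ (μ - 1) * ((1 - v * τ : ℝ) : ℂ) ^ (-(μ + γ)))) := by
      intro τ hτ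
      have h1 : 0 < v * τ := mul_pos hv0 hτ.1
      have hτ0 : (τ : ℂ) ≠ 0 := by exact_mod_cast hτ.1.ne'
      have e3 : L₂.integral (fun η => g₂ η * (τ : ℂ) ^ (β + α * ξ + η - 1)) =
          (τ : ℂ) ^ (β + α * ξ - 1) * L₂.integral (fun η =>
            (secondParams μ γ).theta η * (-((v * τ : ℝ) : ℂ)) ^ η) := by
        rw [← MBContour.integral_const_mul']
        refine MBContour.integral_congr fun η hη => ?_
        rw [show β + α * ξ + η - 1 = (β + α * ξ - 1) + η by ring, Complex.cpow_add _ _ hτ0,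
          show -((v * τ : ℝ) : ℂ) = (τ : ℂ) * (-(v : ℂ)) by push_cast; ring,
          ofReal_mul_cpow hτ.1]
        simp only [hg₂]
        ring
      rw [e3, secondParams.integral_theta hre hμγ hL₂ (by exact_mod_cast h1.ne') (by
        rw [Complex.norm_of_nonneg h1.le]
        exact (mul_lt_of_lt_one_right hv0 hτ.2).trans hv1)]
      push_cast
      ring
    rw [setIntegral_congr_fun measurableSet_Ioo e2, MeasureTheory.integral_const_mul]
    ring
  rw [MBContour.integral_congr hinner, MBContour.integral_const_mul',
    MBContour.Integrable.integral_mul_beta (hL₁.integrable hz1) hg₁m (by fun_prop) hε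
      (fun ξ hξ => by simpa using hε₁ ξ hξ 0 (by simpa using hη₀0)) hμ hkm hkC]
  have houter : ∀ τ ∈ Ioo (0 : ℝ) 1,
      ((1 - τ : ℝ) : ℂ) ^ (μ - 1) * ((1 - v * τ : ℝ) : ℂ) ^ (-(μ + γ)) *
        L₁.integral (fun ξ => g₁ ξ * (τ : ℂ) ^ (β + α * ξ - 1)) =
      (2 * Real.pi * Complex.I) * ((τ : ℂ) ^ (β - 1) * ((1 - τ : ℝ) : ℂ) ^ (μ - 1) *
          ((1 - v * τ : ℝ) : ℂ) ^ (-(μ + γ)) * foxH κ P (z * ((τ ^ α : ℝ) : ℂ))) := by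
    intro τ hτ
    have hτ0 : (τ : ℂ) ≠ 0 := by exact_mod_cast hτ.1.ne'
    rw [hL₁.foxH_eq (hz τ ⟨hτ.1, hτ.2.le⟩)]
    have e3 : L₁.integral (fun ξ => g₁ ξ * (τ : ℂ) ^ (β + α * ξ - 1)) =
        (τ : ℂ) ^ (β - 1) * L₁.integral (fun ξ =>
          P.theta ξ * (z * ((τ ^ α : ℝ) : ℂ)) ^ ξ) := by
      rw [← MBContour.integral_const_mul']
      refine MBContour.integral_congr fun ξ hξ => ?_
      rw [show β + α * ξ - 1 = (β - 1) + α * ξ by ring, Complex.cpow_add _ _ hτ0, mul_comm z,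
        ofReal_mul_cpow (Real.rpow_pos_of_pos hτ.1 α), ← Complex.cpow_mul_ofReal_nonneg hτ.1.le]
      simp only [hg₁]
      ring
    rw [e3]
    have := Complex.two_pi_I_ne_zero
    field_simp
  rw [setIntegral_congr_fun measurableSet_Ioo houter, MeasureTheory.integral_const_mul]
  have := Complex.two_pi_I_ne_zero
  rw [← mul_assoc, ← mul_assoc]
  congr 1
  field_simp

end EulerIntegral

/-! ### The kernel of the H-function operator -/

section FoxKernel

variable {κ : ContourKind} {P : FoxData} {w β : ℂ} {α a x : ℝ}

theorem exists_stronglyMeasurable_foxKernel {L : MBContour κ} (hL : P.Separates L)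
    (hH : ∀ t ∈ Ico a x, P.Exists κ (w * (((x - t) ^ α : ℝ) : ℂ))) :
    ∃ K : ℝ → ℂ, StronglyMeasurable K ∧ ∀ t ∈ Ico a x, foxKernel κ P w α β x t = K t := by
  refine ⟨fun t => ((x - t : ℝ) : ℂ) ^ (β - 1) * ((2 * Real.pi * Complex.I)⁻¹ *
    L.integral fun s => P.theta s * (w * (((x - t) ^ α : ℝ) : ℂ)) ^ s), ?_, fun t ht => ?_⟩
  · refine StronglyMeasurable.mul (Measurable.stronglyMeasurable (by fun_prop))
      (StronglyMeasurable.const_mul (MBContour.stronglyMeasurable_integral ?_) _)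
    have h := P.measurable_theta
    simp only [Function.uncurry_def]
    fun_prop
  · rw [foxKernel, hL.foxH_eq (hH t ht)]

/-- On a contour to the right of `Re s = c₀` the integrand at `t` is dominated by the one at `a`. -/
theorem exists_norm_foxKernel_le (hax : a < x) (hα : 0 < α) {L : MBContour κ} (hL : P.Separates L)
    {c₀ : ℝ} (hc₀ : ∀ s ∈ L.support, c₀ < s.re)
    (hH : ∀ t ∈ Ico a x, P.Exists κ (w * (((x - t) ^ α : ℝ) : ℂ))) :
    ∃ C, 0 ≤ C ∧ ∀ t ∈ Ico a x,
      ‖foxKernel κ P w α β x t‖ ≤ C * (x - t) ^ (β.re + α * c₀ - 1) := by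
  have hxa : 0 < x - a := sub_pos.2 hax
  have hHa := hH a ⟨le_rfl, hax⟩
  set G := L.normIntegral fun s => P.theta s * (w * (((x - a) ^ α : ℝ) : ℂ)) ^ s with hG
  have hG0 : 0 ≤ G := L.normIntegral_nonneg _
  refine ⟨‖(2 * Real.pi * Complex.I : ℂ)⁻¹‖ * (G * (x - a) ^ (-(α * c₀))), by positivity,
    fun t ht => ?_⟩
  have hxt : 0 < x - t := sub_pos.2 ht.2
  have hr0 : 0 < (x - t) / (x - a) := div_pos hxt hxa
  have hr1 : (x - t) / (x - a) ≤ 1 := (div_le_one hxa).2 (by linarith [ht.1])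
  have h1 : ‖L.integral fun s => P.theta s * (w * (((x - t) ^ α : ℝ) : ℂ)) ^ s‖ ≤
      G * ((x - t) / (x - a)) ^ (α * c₀) := by
    refine MBContour.norm_integral_le (hL.integrable hHa) fun s hs => ?_
    have e : w * (((x - t) ^ α : ℝ) : ℂ) =
        ((((x - t) / (x - a)) ^ α : ℝ) : ℂ) * (w * (((x - a) ^ α : ℝ) : ℂ)) := by
      rw [Real.div_rpow hxt.le hxa.le]
      have : (((x - a) ^ α : ℝ) : ℂ) ≠ 0 := by exact_mod_cast (Real.rpow_pos_of_pos hxa α).ne'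
      push_cast at this ⊢
      field_simp
    rw [e, ofReal_mul_cpow (Real.rpow_pos_of_pos hr0 α), norm_mul, norm_mul, norm_mul,
      norm_ofReal_cpow (Real.rpow_pos_of_pos hr0 α), ← Real.rpow_mul hr0.le, mul_left_comm,
      mul_comm]
    refine mul_le_mul_of_nonneg_left ?_ (by positivity)
    exact Real.rpow_le_rpow_of_exponent_ge hr0 hr1 (mul_le_mul_of_nonneg_left (hc₀ s hs).le hα.le)
  rw [foxKernel, hL.foxH_eq (hH t ht), norm_mul, norm_mul, norm_ofReal_cpow hxt, Complex.sub_re,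
    Complex.one_re]
  calc (x - t) ^ (β.re - 1) * (‖(2 * Real.pi * Complex.I : ℂ)⁻¹‖ *
        ‖L.integral fun s => P.theta s * (w * (((x - t) ^ α : ℝ) : ℂ)) ^ s‖)
      ≤ (x - t) ^ (β.re - 1) * (‖(2 * Real.pi * Complex.I : ℂ)⁻¹‖ *
        (G * ((x - t) / (x - a)) ^ (α * c₀))) := by
        gcongr
    _ = ‖(2 * Real.pi * Complex.I : ℂ)⁻¹‖ * (G * (x - a) ^ (-(α * c₀))) *
        (x - t) ^ (β.re + α * c₀ - 1) := by
        rw [Real.div_rpow hxt.le hxa.le, Real.rpow_neg hxa.le,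
          show β.re + α * c₀ - 1 = (β.re - 1) + α * c₀ by ring, Real.rpow_add hxt]
        ring

end FoxKernel

/-! ### The composition -/

section Composition

variable {κ : ContourKind} {P : FoxData} {γ μ β w : ℂ} {α a x : ℝ}

/-- The substitution `t = x - (x - u) τ` in the Euler integral. -/
theorem integral_foxKernel_eq (hα : 0 < α) (hγ : -1 < γ.re) (hμ : 0 < μ.re) (hμγ : μ + γ ≠ 0)
    (hb : ∀ j : Fin P.q, (j : ℕ) < P.m → 0 < β.re + (α * P.b j / P.B j).re)
    (hH : ∀ t ∈ Ico a x, P.Exists κ (w * (((x - t) ^ α : ℝ) : ℂ))) {u : ℝ} (hu : u ∈ Ioo a x) :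
    ∫ t in Ioo u x, foxKernel κ P w α β x t * ((t - a : ℝ) : ℂ) ^ (-μ - γ) /
        ((t - u : ℝ) : ℂ) ^ (1 - μ) =
      Complex.Gamma μ * (((x - u : ℝ) : ℂ) ^ (μ + β - 1) *
        (((x - a : ℝ) : ℂ) ^ (-μ - γ) / Complex.Gamma (μ + γ)) *
        foxH₂ κ .loop (couplingParams μ β α hα) P (secondParams μ γ)
          (w * (((x - u) ^ α : ℝ) : ℂ)) ((-((x - u) / (x - a)) : ℝ) : ℂ)) := by
  have hxu : 0 < x - u := sub_pos.2 hu.2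
  have hxa : 0 < x - a := by linarith [hu.1, hu.2]
  have hv0 : 0 < (x - u) / (x - a) := div_pos hxu hxa
  have hv1 : (x - u) / (x - a) < 1 := (div_lt_one hxa).2 (by linarith [hu.1])
  have hΓμ : Complex.Gamma μ ≠ 0 := Complex.Gamma_ne_zero_of_re_pos hμ
  have hΓ : Complex.Gamma (μ + γ) ≠ 0 := Complex.Gamma_ne_zero
    (secondParams.add_ne_neg_nat (by rw [Complex.add_re]; linarith) hμγ)
  have hpow : ∀ τ : ℝ, 0 < τ → w * (((x - u) ^ α : ℝ) : ℂ) * ((τ ^ α : ℝ) : ℂ) =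
      w * ((((x - u) * τ) ^ α : ℝ) : ℂ) := fun τ hτ => by
    rw [Real.mul_rpow hxu.le hτ.le]
    push_cast
    ring
  rw [foxH₂_eq_integral hγ hμ hμγ hb (fun τ hτ => ?_) hv0 hv1]
  · have h1 := intervalIntegral.integral_comp_sub_mul (a := 0) (b := 1)
      (fun t : ℝ => foxKernel κ P w α β x t * ((t - a : ℝ) : ℂ) ^ (-μ - γ) /
        ((t - u : ℝ) : ℂ) ^ (1 - μ)) hxu.ne' x
    rw [mul_one, mul_zero, sub_zero, sub_sub_cancel, intervalIntegral.integral_of_le zero_le_one,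
      intervalIntegral.integral_of_le hu.2.le, integral_Ioc_eq_integral_Ioo,
      integral_Ioc_eq_integral_Ioo, eq_inv_smul_iff₀ hxu.ne'] at h1
    rw [← h1, Complex.real_smul, ← MeasureTheory.integral_const_mul]
    have h2 : ∀ τ ∈ Ioo (0 : ℝ) 1, ((x - u : ℝ) : ℂ) *
        (foxKernel κ P w α β x (x - (x - u) * τ) *
          ((x - (x - u) * τ - a : ℝ) : ℂ) ^ (-μ - γ) /
            ((x - (x - u) * τ - u : ℝ) : ℂ) ^ (1 - μ)) =
        (((x - u : ℝ) : ℂ) ^ (μ + β - 1) * ((x - a : ℝ) : ℂ) ^ (-μ - γ)) *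
          ((τ : ℂ) ^ (β - 1) * ((1 - τ : ℝ) : ℂ) ^ (μ - 1) *
          ((1 - (x - u) / (x - a) * τ : ℝ) : ℂ) ^ (-(μ + γ)) *
          foxH κ P (w * (((x - u) ^ α : ℝ) : ℂ) * ((τ ^ α : ℝ) : ℂ))) := by
      intro τ hτ
      have h1τ : 0 < 1 - τ := sub_pos.2 hτ.2
      have h3 : 0 < 1 - (x - u) / (x - a) * τ := by
        have := mul_lt_of_lt_one_right hv0 hτ.2
        linarith
      have h4 : ((1 - τ : ℝ) : ℂ) ≠ 0 := by exact_mod_cast h1τ.ne'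
      have h5 : ((x - u : ℝ) : ℂ) ≠ 0 := by exact_mod_cast hxu.ne'
      rw [hpow τ hτ.1, foxKernel, show x - (x - (x - u) * τ) = (x - u) * τ by ring,
        show x - (x - u) * τ - u = (x - u) * (1 - τ) by ring,
        show x - (x - u) * τ - a = (x - a) * (1 - (x - u) / (x - a) * τ) by field_simp; ring,
        Complex.ofReal_mul, Complex.ofReal_mul (x - a), Complex.ofReal_mul (x - u) (1 - τ),
        ofReal_mul_cpow hxu, ofReal_mul_cpow hxu, ofReal_mul_cpow hxa,
        show 1 - μ = -(μ - 1) by ring, Complex.cpow_neg, Complex.cpow_neg,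
        show μ + β - 1 = (μ - 1) + (β - 1) + 1 by ring, Complex.cpow_add _ _ h5,
        Complex.cpow_add _ _ h5, Complex.cpow_one, show -μ - γ = -(μ + γ) by ring]
      have h6 : ((x - u : ℝ) : ℂ) ^ (μ - 1) ≠ 0 := fun h =>
        h5 ((Complex.cpow_eq_zero_iff _ _).1 h).1
      have h7 : ((1 - τ : ℝ) : ℂ) ^ (μ - 1) ≠ 0 := fun h =>
        h4 ((Complex.cpow_eq_zero_iff _ _).1 h).1
      rw [← mul_inv, div_inv_eq_mul]
      ring
    rw [setIntegral_congr_fun measurableSet_Ioo h2, MeasureTheory.integral_const_mul]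
    generalize (∫ τ in Ioo (0 : ℝ) 1, _ : ℂ) = J
    field_simp
  · rw [hpow τ hτ.1, show (x - u) * τ = x - (x - (x - u) * τ) by ring]
    refine hH _ ⟨?_, ?_⟩
    · have := mul_le_of_le_one_right hxu.le hτ.2
      linarith [hu.1]
    · have := mul_pos hxu hτ.1
      linarith

/-- The `t` for which the slice is integrable accumulate at `x`, and each of them gives measurability
on `(a, t)`. -/
theorem aestronglyMeasurable_of_ae_integrableOn {g : ℝ → ℂ} (hax : a < x)
    (h : ∀ᵐ t ∂(volume.restrict (Ioo a x)),
      IntegrableOn (fun u : ℝ => g u / ((t - u : ℝ) : ℂ) ^ (1 - μ)) (Ioo a t)) :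
    AEStronglyMeasurable g (volume.restrict (Ioo a x)) := by
  have hex : ∀ n : ℕ, ∃ t, x - 1 / (n + 1) < t ∧
      AEStronglyMeasurable g (volume.restrict (Ioo a (min t x))) := by
    intro n
    have hn : (0 : ℝ) < 1 / (n + 1) := by positivity
    have hlt : max a (x - 1 / (n + 1)) < x := max_lt hax (by linarith)
    have h1 : ∀ᵐ t ∂(volume.restrict (Ioo (max a (x - 1 / (n + 1))) x)),
        IntegrableOn (fun u : ℝ => g u / ((t - u : ℝ) : ℂ) ^ (1 - μ)) (Ioo a t) :=
      ae_restrict_of_ae_restrict_of_subset (Ioo_subset_Ioo_left (le_max_left _ _)) h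
    have : (ae (volume.restrict (Ioo (max a (x - 1 / (n + 1))) x))).NeBot := by
      rw [ae_neBot, Ne, Measure.restrict_eq_zero, Real.volume_Ioo]
      simpa using hlt
    obtain ⟨t, ht, ht'⟩ := (h1.and (ae_restrict_mem measurableSet_Ioo)).exists
    refine ⟨t, (le_max_right _ _).trans_lt ht'.1, ?_⟩
    rw [min_eq_left ht'.2.le]
    have hm : Measurable fun u : ℝ => ((t - u : ℝ) : ℂ) ^ (1 - μ) := by fun_prop
    refine (ht.aestronglyMeasurable.mul hm.aestronglyMeasurable).congr ?_
    filter_upwards [ae_restrict_mem measurableSet_Ioo] with u hu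
    have : ((t - u : ℝ) : ℂ) ≠ 0 := by exact_mod_cast (sub_pos.2 hu.2).ne'
    exact div_mul_cancel₀ _ fun h => this ((Complex.cpow_eq_zero_iff _ _).1 h).1
  choose t ht htm using hex
  refine (aestronglyMeasurable_iUnion_iff.2 htm).mono_set fun u hu => ?_
  obtain ⟨n, hn⟩ := exists_nat_one_div_lt (sub_pos.2 hu.2)
  exact mem_iUnion.2 ⟨n, hu.1, lt_min (by linarith [ht n]) hu.2⟩

/-- The integrand of the iterated integral on the triangle `a < u < t < x`. -/
theorem integrable_triangle (hax : a < x) {k g : ℝ → ℂ}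
    (hk : AEStronglyMeasurable k (volume.restrict (Ioo a x)))
    (h1 : ∀ᵐ t ∂(volume.restrict (Ioo a x)),
      IntegrableOn (fun u : ℝ => g u / ((t - u : ℝ) : ℂ) ^ (1 - μ)) (Ioo a t))
    (h2 : IntegrableOn (fun t : ℝ => k t *
      ((∫ u in a..t, ‖g u / ((t - u : ℝ) : ℂ) ^ (1 - μ)‖ : ℝ) : ℂ)) (Ioo a x)) :
    Integrable (fun z : ℝ × ℝ => {z : ℝ × ℝ | z.2 < z.1}.indicator
      (fun z => k z.1 * (g z.2 / ((z.1 - z.2 : ℝ) : ℂ) ^ (1 - μ))) z)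
      ((volume.restrict (Ioo a x)).prod (volume.restrict (Ioo a x))) := by
  have hS : MeasurableSet {z : ℝ × ℝ | z.2 < z.1} := measurableSet_lt measurable_snd measurable_fst
  have hg := aestronglyMeasurable_of_ae_integrableOn hax h1
  have hslice : ∀ t, (fun u => {z : ℝ × ℝ | z.2 < z.1}.indicator
      (fun z => k z.1 * (g z.2 / ((z.1 - z.2 : ℝ) : ℂ) ^ (1 - μ))) (t, u)) =
      (Iio t).indicator fun u => k t * (g u / ((t - u : ℝ) : ℂ) ^ (1 - μ)) := fun t => rfl
  have hset : ∀ t ∈ Ioo a x, Iio t ∩ Ioo a x = Ioo a t := fun t ht => by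
    rw [inter_comm, Ioo_inter_Iio, min_eq_right ht.2.le]
  have hm : Measurable fun z : ℝ × ℝ => ((z.1 - z.2 : ℝ) : ℂ) ^ (1 - μ) := by fun_prop
  refine (integrable_prod_iff ?_).2 ⟨?_, ?_⟩
  · refine AEStronglyMeasurable.indicator ?_ hS
    exact hk.comp_fst.mul (hg.comp_snd.mul hm.inv.aestronglyMeasurable)
  · filter_upwards [h1, ae_restrict_mem measurableSet_Ioo] with t ht ht'
    rw [hslice, integrable_indicator_iff measurableSet_Iio, IntegrableOn,
      Measure.restrict_restrict measurableSet_Iio, hset t ht']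
    exact ht.const_mul _
  · refine h2.norm.congr ?_
    filter_upwards [ae_restrict_mem measurableSet_Ioo] with t ht'
    change _ = ∫ u in Ioo a x, ‖(Iio t).indicator
      (fun u => k t * (g u / ((t - u : ℝ) : ℂ) ^ (1 - μ))) u‖
    simp only [norm_indicator_eq_indicator_norm]
    rw [integral_indicator measurableSet_Iio, Measure.restrict_restrict measurableSet_Iio,
      hset t ht', intervalIntegral.integral_of_le ht'.1.le, integral_Ioc_eq_integral_Ioo]
    simp only [norm_mul]
    rw [MeasureTheory.integral_const_mul, Complex.norm_real, Real.norm_of_nonneg]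
    exact integral_nonneg fun u => norm_nonneg _

/-- Both sides are iterated integrals over the triangle, up to the factor `Γ(μ)`. -/
theorem intervalIntegrable_and_foxOperator_saxenaIntegral_eq (hα : 0 < α) (hax : a < x)
    (hγ : -1 < γ.re) (hμ : 0 < μ.re) (hμγ : μ + γ ≠ 0)
    (hb : ∀ j : Fin P.q, (j : ℕ) < P.m → 0 < β.re + (α * P.b j / P.B j).re)
    (hH : ∀ t ∈ Ico a x, P.Exists κ (w * (((x - t) ^ α : ℝ) : ℂ))) {φ : ℝ → ℂ}
    (hφ : CompositionConverges κ P w α β γ μ a x φ) :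
    IntervalIntegrable (fun u => compositionKernel κ P w α hα β γ μ a x u * φ u) volume a x ∧
      foxOperator κ P w α β a (saxenaIntegral a γ μ φ) x =
        ∫ u in a..x, compositionKernel κ P w α hα β γ μ a x u * φ u := by
  obtain ⟨c₀, -, hc₀⟩ := exists_line_of_re_pos (β := β) hα hb
  obtain ⟨L, hL, -⟩ := FoxData.exists_separates κ (hH a ⟨le_rfl, hax⟩).2.1 hc₀
  obtain ⟨K, hK, hK'⟩ := exists_stronglyMeasurable_foxKernel (β := β) hL hH
  have hk : AEStronglyMeasurable (fun t : ℝ => foxKernel κ P w α β x t *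
      ((t - a : ℝ) : ℂ) ^ (-μ - γ)) (volume.restrict (Ioo a x)) := by
    have hm : Measurable fun t : ℝ => ((t - a : ℝ) : ℂ) ^ (-μ - γ) := by fun_prop
    refine AEStronglyMeasurable.mul (hK.aestronglyMeasurable.congr ?_) hm.aestronglyMeasurable
    filter_upwards [ae_restrict_mem measurableSet_Ioo] with t ht
    exact (hK' t (Ioo_subset_Ico_self ht)).symm
  have hint := integrable_triangle hax hk (g := fun u : ℝ => (u : ℂ) ^ γ * φ u) hφ.1 hφ.2
  have hΓμ : Complex.Gamma μ ≠ 0 := Complex.Gamma_ne_zero_of_re_pos hμ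
  -- The two iterated integrals over the triangle.
  have hleft : ∀ t ∈ Ioo a x, ∫ u in Ioo a x, {z : ℝ × ℝ | z.2 < z.1}.indicator
      (fun z => foxKernel κ P w α β x z.1 * ((z.1 - a : ℝ) : ℂ) ^ (-μ - γ) *
        ((z.2 : ℂ) ^ γ * φ z.2 / ((z.1 - z.2 : ℝ) : ℂ) ^ (1 - μ))) (t, u) =
      Complex.Gamma μ * (foxKernel κ P w α β x t * saxenaIntegral a γ μ φ t) := by
    intro t ht
    change ∫ u in Ioo a x, (Iio t).indicator (fun u : ℝ => foxKernel κ P w α β x t *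
      ((t - a : ℝ) : ℂ) ^ (-μ - γ) * ((u : ℂ) ^ γ * φ u / ((t - u : ℝ) : ℂ) ^ (1 - μ))) u = _
    rw [integral_indicator measurableSet_Iio, Measure.restrict_restrict measurableSet_Iio,
      inter_comm, Ioo_inter_Iio, min_eq_right ht.2.le, MeasureTheory.integral_const_mul,
      saxenaIntegral, intervalIntegral.integral_of_le ht.1.le, integral_Ioc_eq_integral_Ioo]
    field_simp
  have hright : ∀ u ∈ Ioo a x, ∫ t in Ioo a x, {z : ℝ × ℝ | z.2 < z.1}.indicator
      (fun z => foxKernel κ P w α β x z.1 * ((z.1 - a : ℝ) : ℂ) ^ (-μ - γ) *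
        ((z.2 : ℂ) ^ γ * φ z.2 / ((z.1 - z.2 : ℝ) : ℂ) ^ (1 - μ))) (t, u) =
      Complex.Gamma μ * (compositionKernel κ P w α hα β γ μ a x u * φ u) := by
    intro u hu
    change ∫ t in Ioo a x, (Ioi u).indicator (fun t : ℝ => foxKernel κ P w α β x t *
      ((t - a : ℝ) : ℂ) ^ (-μ - γ) * ((u : ℂ) ^ γ * φ u / ((t - u : ℝ) : ℂ) ^ (1 - μ))) t = _
    rw [integral_indicator measurableSet_Ioi, Measure.restrict_restrict measurableSet_Ioi,
      inter_comm, Ioo_inter_Ioi, max_eq_right hu.1.le]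
    have e : ∀ t : ℝ, foxKernel κ P w α β x t * ((t - a : ℝ) : ℂ) ^ (-μ - γ) *
        ((u : ℂ) ^ γ * φ u / ((t - u : ℝ) : ℂ) ^ (1 - μ)) = ((u : ℂ) ^ γ * φ u) *
        (foxKernel κ P w α β x t * ((t - a : ℝ) : ℂ) ^ (-μ - γ) / ((t - u : ℝ) : ℂ) ^ (1 - μ)) :=
      fun t => by ring
    simp only [e]
    rw [MeasureTheory.integral_const_mul, integral_foxKernel_eq hα hγ hμ hμγ hb hH hu,
      compositionKernel]
    ring
  have hcomp : IntegrableOn (fun u => compositionKernel κ P w α hα β γ μ a x u * φ u)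
      (Ioo a x) := by
    have h1 := (hint.integral_prod_right.const_mul (Complex.Gamma μ)⁻¹)
    refine h1.congr ?_
    filter_upwards [ae_restrict_mem measurableSet_Ioo] with u hu
    rw [hright u hu, inv_mul_cancel_left₀ hΓμ]
  refine ⟨(intervalIntegrable_iff_integrableOn_Ioo_of_le hax.le).2 hcomp, ?_⟩
  have hswap := (integral_prod _ hint).symm.trans (integral_prod_symm _ hint)
  rw [setIntegral_congr_fun measurableSet_Ioo hleft, setIntegral_congr_fun measurableSet_Ioo hright,
    MeasureTheory.integral_const_mul, MeasureTheory.integral_const_mul] at hswap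
  rw [foxOperator, intervalIntegral.integral_of_le hax.le, intervalIntegral.integral_of_le hax.le,
    integral_Ioc_eq_integral_Ioo, integral_Ioc_eq_integral_Ioo]
  exact mul_left_cancel₀ hΓμ hswap

end Composition

/-! ### Convergence of the composition -/

section Convergence

theorem integrableOn_and_integral_sub_rpow_mul_sub_rpow {u x p q : ℝ} (hux : u < x) (hp : 0 < p)
    (hq : 0 < q) :
    IntegrableOn (fun t => (x - t) ^ (p - 1) * (t - u) ^ (q - 1)) (Ioo u x) ∧
      ∫ t in Ioo u x, (x - t) ^ (p - 1) * (t - u) ^ (q - 1) =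
        (x - u) ^ (p + q - 1) * ∫ τ in Ioo (0 : ℝ) 1, τ ^ (p - 1) * (1 - τ) ^ (q - 1) := by
  have hxu : 0 < x - u := sub_pos.2 hux
  have h0 := integrableOn_beta hp hq
  rw [← intervalIntegrable_iff_integrableOn_Ioo_of_le zero_le_one] at h0
  have h1 := ((h0.comp_mul_left (c := (x - u)⁻¹)).comp_sub_left x).symm
  simp only [zero_div, sub_zero, one_div, inv_inv, sub_sub_cancel] at h1
  rw [intervalIntegrable_iff_integrableOn_Ioo_of_le hux.le] at h1
  have hpow : (x - u) ^ (p + q - 1) = (x - u) * ((x - u) ^ (p - 1) * (x - u) ^ (q - 1)) := by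
    rw [show p + q - 1 = 1 + ((p - 1) + (q - 1)) by ring, Real.rpow_add hxu, Real.rpow_add hxu,
      Real.rpow_one]
  constructor
  · refine IntegrableOn.congr_fun (h1.const_mul ((x - u) ^ (p - 1) * (x - u) ^ (q - 1)))
      (fun t ht => ?_) measurableSet_Ioo
    have h2 : 0 < x - t := sub_pos.2 ht.2
    have h3 : 0 < t - u := sub_pos.2 ht.1
    have h4 : 1 - (x - u)⁻¹ * (x - t) = (x - u)⁻¹ * (t - u) := by field_simp; ring
    rw [h4, Real.mul_rpow (by positivity) h2.le, Real.mul_rpow (by positivity) h3.le,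
      Real.inv_rpow hxu.le, Real.inv_rpow hxu.le]
    have := (Real.rpow_pos_of_pos hxu (p - 1)).ne'
    have := (Real.rpow_pos_of_pos hxu (q - 1)).ne'
    field_simp
  · have h2 := intervalIntegral.integral_comp_sub_mul (a := 0) (b := 1)
      (fun t : ℝ => (x - t) ^ (p - 1) * (t - u) ^ (q - 1)) hxu.ne' x
    rw [mul_one, mul_zero, sub_zero, sub_sub_cancel, intervalIntegral.integral_of_le zero_le_one,
      intervalIntegral.integral_of_le hux.le, integral_Ioc_eq_integral_Ioo,
      integral_Ioc_eq_integral_Ioo, eq_inv_smul_iff₀ hxu.ne', smul_eq_mul] at h2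
    rw [← h2, hpow, mul_assoc, ← MeasureTheory.integral_const_mul (_ * _)]
    congr 1
    refine setIntegral_congr_fun measurableSet_Ioo fun τ hτ => ?_
    have h3 : 0 < 1 - τ := sub_pos.2 hτ.2
    rw [show x - (x - (x - u) * τ) = (x - u) * τ by ring,
      show x - (x - u) * τ - u = (x - u) * (1 - τ) by ring, Real.mul_rpow hxu.le hτ.1.le,
      Real.mul_rpow hxu.le h3.le]
    ring

variable {μ : ℂ} {a x : ℝ}

/-- The converse of `integrable_triangle`, for a weight without zeros. -/
theorem ae_integrableOn_of_integrable_triangle {k g : ℝ → ℂ} (hk0 : ∀ t ∈ Ioo a x, k t ≠ 0)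
    (h : Integrable (fun z : ℝ × ℝ => {z : ℝ × ℝ | z.2 < z.1}.indicator
      (fun z => k z.1 * (g z.2 / ((z.1 - z.2 : ℝ) : ℂ) ^ (1 - μ))) z)
      ((volume.restrict (Ioo a x)).prod (volume.restrict (Ioo a x)))) :
    (∀ᵐ t ∂(volume.restrict (Ioo a x)),
      IntegrableOn (fun u : ℝ => g u / ((t - u : ℝ) : ℂ) ^ (1 - μ)) (Ioo a t)) ∧
    IntegrableOn (fun t : ℝ => ‖k t‖ *
      ∫ u in a..t, ‖g u / ((t - u : ℝ) : ℂ) ^ (1 - μ)‖) (Ioo a x) := by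
  have hset : ∀ t ∈ Ioo a x, Iio t ∩ Ioo a x = Ioo a t := fun t ht => by
    rw [inter_comm, Ioo_inter_Iio, min_eq_right ht.2.le]
  obtain ⟨h1, h2⟩ := (integrable_prod_iff h.aestronglyMeasurable).1 h
  constructor
  · filter_upwards [h1, ae_restrict_mem measurableSet_Ioo] with t ht ht'
    change Integrable ((Iio t).indicator
      fun u => k t * (g u / ((t - u : ℝ) : ℂ) ^ (1 - μ))) _ at ht
    rw [integrable_indicator_iff measurableSet_Iio, IntegrableOn,
      Measure.restrict_restrict measurableSet_Iio, hset t ht'] at ht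
    refine (ht.const_mul (k t)⁻¹).congr (ae_of_all _ fun u => ?_)
    exact inv_mul_cancel_left₀ (hk0 t ht') _
  · refine h2.congr ?_
    filter_upwards [ae_restrict_mem measurableSet_Ioo] with t ht'
    change ∫ u in Ioo a x, ‖(Iio t).indicator
      (fun u => k t * (g u / ((t - u : ℝ) : ℂ) ^ (1 - μ))) u‖ = _
    simp only [norm_indicator_eq_indicator_norm]
    rw [integral_indicator measurableSet_Iio, Measure.restrict_restrict measurableSet_Iio,
      hset t ht', intervalIntegral.integral_of_le ht'.1.le, integral_Ioc_eq_integral_Ioo]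
    simp only [norm_mul]
    rw [MeasureTheory.integral_const_mul]

/-- The function `s ↦ (t - s) / (x - s)` decreases, which bounds a power of `t - a` by one of `t - u`
without a loss near `x`. -/
theorem sub_rpow_neg_le {u t δ ρ c : ℝ} (hau : a < u) (hut : u < t) (htx : t < x) (hδ : 0 ≤ δ)
    (hρ : 0 ≤ ρ) (hc : c ≤ δ + ρ) :
    (t - a) ^ (-c) ≤ (x - a) ^ (δ - c) * ((u - a) ^ (-δ) * ((x - u) ^ ρ * (t - u) ^ (-ρ))) := by
  have h1 : 0 < u - a := by linarith
  have h2 : 0 < t - a := by linarith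
  have h3 : 0 < x - a := by linarith
  have h4 : 0 < t - u := by linarith
  have h5 : 0 < x - u := by linarith
  have h6 : (t - u) / (x - u) ≤ (t - a) / (x - a) := by
    rw [div_le_div_iff₀ h5 h3]
    nlinarith [mul_nonneg h1.le (sub_pos.2 htx).le]
  have h7 := Real.rpow_le_rpow_of_nonpos (div_pos h4 h5) h6 (neg_nonpos.2 hρ)
  have h8 := Real.rpow_le_rpow_of_nonpos h1 (by linarith : u - a ≤ t - a) (neg_nonpos.2 hδ)
  have h9 : (t - a) ^ (δ + ρ - c) ≤ (x - a) ^ (δ + ρ - c) :=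
    Real.rpow_le_rpow h2.le (by linarith) (by linarith)
  rw [Real.div_rpow h2.le h3.le, Real.div_rpow h4.le h5.le] at h7
  have e1 : (t - a) ^ (-c) = (t - a) ^ (δ + ρ - c) * ((t - a) ^ (-δ) * (t - a) ^ (-ρ)) := by
    rw [← Real.rpow_add h2, ← Real.rpow_add h2]
    congr 1
    ring
  have e2 : (x - a) ^ (δ - c) = (x - a) ^ (δ + ρ - c) * (x - a) ^ (-ρ) := by
    rw [← Real.rpow_add h3]
    congr 1
    ring
  have e3 : (x - u) ^ ρ * (x - u) ^ (-ρ) = 1 := by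
    rw [← Real.rpow_add h5, add_neg_cancel, Real.rpow_zero]
  have h10 : (t - a) ^ (-ρ) ≤ (x - a) ^ (-ρ) * ((x - u) ^ ρ * (t - u) ^ (-ρ)) := by
    have h11 : (x - u) ^ ρ * (t - u) ^ (-ρ) = (t - u) ^ (-ρ) / (x - u) ^ (-ρ) := by
      rw [eq_div_iff (Real.rpow_pos_of_pos h5 _).ne']
      linear_combination (t - u) ^ (-ρ) * e3
    rw [h11]
    have := mul_le_mul_of_nonneg_left h7 (Real.rpow_pos_of_pos h3 (-ρ)).le
    rwa [mul_div_cancel₀ _ (Real.rpow_pos_of_pos h3 (-ρ)).ne'] at this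
  rw [e1, e2]
  calc (t - a) ^ (δ + ρ - c) * ((t - a) ^ (-δ) * (t - a) ^ (-ρ))
      ≤ (x - a) ^ (δ + ρ - c) * ((u - a) ^ (-δ) *
        ((x - a) ^ (-ρ) * ((x - u) ^ ρ * (t - u) ^ (-ρ)))) := by gcongr
    _ = _ := by ring

/-- The majorant of the integrand of the composition on the triangle `a < u < t < x`. -/
theorem integrable_majorant {g : ℝ → ℝ} {δ ρ ε m : ℝ} (hε : 0 < ε) (hm : ρ < m)
    (hg : IntegrableOn (fun u => (x - u) ^ (m - 1) * ((u - a) ^ (-δ) * g u)) (Ioo a x))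
    (hgm : AEStronglyMeasurable g (volume.restrict (Ioo a x))) :
    Integrable (fun z : ℝ × ℝ => {z : ℝ × ℝ | z.2 < z.1}.indicator (fun z =>
      ((x - z.2) ^ ρ * ((z.2 - a) ^ (-δ) * g z.2)) *
        ((x - z.1) ^ (ε - 1) * (z.1 - z.2) ^ (m - ρ - 1))) z)
      ((volume.restrict (Ioo a x)).prod (volume.restrict (Ioo a x))) := by
  have hS : MeasurableSet {z : ℝ × ℝ | z.2 < z.1} := measurableSet_lt measurable_snd measurable_fst
  have hset : ∀ u ∈ Ioo a x, Ioi u ∩ Ioo a x = Ioo u x := fun u hu => by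
    rw [inter_comm, Ioo_inter_Ioi, max_eq_right hu.1.le]
  have hm1 : Measurable fun u : ℝ => (x - u) ^ ρ := by fun_prop
  have hm2 : Measurable fun u : ℝ => (u - a) ^ (-δ) := by fun_prop
  have hm3 : Measurable fun z : ℝ × ℝ => (x - z.1) ^ (ε - 1) * (z.1 - z.2) ^ (m - ρ - 1) := by
    fun_prop
  have hG : AEStronglyMeasurable (fun u => (x - u) ^ ρ * ((u - a) ^ (-δ) * g u))
      (volume.restrict (Ioo a x)) :=
    hm1.aestronglyMeasurable.mul (hm2.aestronglyMeasurable.mul hgm)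
  refine (integrable_prod_iff' ?_).2 ⟨?_, ?_⟩
  · exact (hG.comp_snd.mul hm3.aestronglyMeasurable).indicator hS
  · filter_upwards [ae_restrict_mem measurableSet_Ioo] with u hu
    change Integrable ((Ioi u).indicator fun t => ((x - u) ^ ρ * ((u - a) ^ (-δ) * g u)) *
        ((x - t) ^ (ε - 1) * (t - u) ^ (m - ρ - 1))) _
    rw [integrable_indicator_iff measurableSet_Ioi, IntegrableOn,
      Measure.restrict_restrict measurableSet_Ioi, hset u hu]
    exact (integrableOn_and_integral_sub_rpow_mul_sub_rpow hu.2 hε (sub_pos.2 hm)).1.const_mul _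
  · have hm4 : Measurable fun u : ℝ => (x - u) ^ ε := by fun_prop
    have h1 : IntegrableOn (fun u => (x - u) ^ ε * ‖(x - u) ^ (m - 1) * ((u - a) ^ (-δ) * g u)‖)
        (Ioo a x) := by
      refine Integrable.bdd_mul (c := (x - a) ^ ε) hg.norm hm4.aestronglyMeasurable ?_
      filter_upwards [ae_restrict_mem measurableSet_Ioo] with u hu
      have := sub_pos.2 hu.2
      rw [Real.norm_of_nonneg (by positivity)]
      exact Real.rpow_le_rpow this.le (by linarith [hu.1]) hε.le
    refine (h1.const_mul
      (∫ τ in Ioo (0 : ℝ) 1, τ ^ (ε - 1) * (1 - τ) ^ (m - ρ - 1))).congr ?_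
    filter_upwards [ae_restrict_mem measurableSet_Ioo] with u hu
    change _ = ∫ t in Ioo a x, ‖(Ioi u).indicator
      (fun t => ((x - u) ^ ρ * ((u - a) ^ (-δ) * g u)) *
        ((x - t) ^ (ε - 1) * (t - u) ^ (m - ρ - 1))) t‖
    simp only [norm_indicator_eq_indicator_norm]
    have hxu : 0 < x - u := sub_pos.2 hu.2
    rw [integral_indicator measurableSet_Ioi, Measure.restrict_restrict measurableSet_Ioi,
      hset u hu]
    have e : ∀ t ∈ Ioo u x, ‖((x - u) ^ ρ * ((u - a) ^ (-δ) * g u)) *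
        ((x - t) ^ (ε - 1) * (t - u) ^ (m - ρ - 1))‖ =
        ‖(x - u) ^ ρ * ((u - a) ^ (-δ) * g u)‖ *
          ((x - t) ^ (ε - 1) * (t - u) ^ (m - ρ - 1)) := by
      intro t ht
      have := sub_pos.2 ht.1
      have := sub_pos.2 ht.2
      rw [norm_mul, Real.norm_of_nonneg (by positivity : 0 ≤ (x - t) ^ (ε - 1) * _)]
    rw [setIntegral_congr_fun measurableSet_Ioo e, MeasureTheory.integral_const_mul,
      (integrableOn_and_integral_sub_rpow_mul_sub_rpow hu.2 hε (sub_pos.2 hm)).2,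
      norm_mul ((x - u) ^ (m - 1)), norm_mul ((x - u) ^ ρ),
      Real.norm_of_nonneg (Real.rpow_nonneg hxu.le _),
      Real.norm_of_nonneg (Real.rpow_nonneg hxu.le _)]
    have e2 : (x - u) ^ ε * (x - u) ^ (m - 1) = (x - u) ^ ρ * (x - u) ^ (ε + (m - ρ) - 1) := by
      rw [← Real.rpow_add hxu, ← Real.rpow_add hxu]
      congr 1
      ring
    linear_combination (∫ τ in Ioo (0 : ℝ) 1, τ ^ (ε - 1) * (1 - τ) ^ (m - ρ - 1)) *
      ‖(u - a) ^ (-δ) * g u‖ * e2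

/-- The integrand is dominated on the triangle, because the kernel of the H-function operator is
`O((x - t)^{ε - 1})` for some `ε > 0`. -/
theorem compositionConverges_of_integrableOn {κ : ContourKind} {P : FoxData} {γ β w : ℂ} {α : ℝ}
    (hα : 0 < α) (hax : a < x) (hμ : 0 < μ.re)
    (hb : ∀ j : Fin P.q, (j : ℕ) < P.m → 0 < β.re + (α * P.b j / P.B j).re)
    (hH : ∀ t ∈ Ico a x, P.Exists κ (w * (((x - t) ^ α : ℝ) : ℂ))) {φ : ℝ → ℂ} {δ : ℝ}
    (hδ : 0 ≤ δ) (hγδ : γ.re < δ)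
    (hφ : IntegrableOn (fun u : ℝ => (u : ℂ) ^ γ * (((u - a) ^ (-δ) : ℝ) : ℂ) *
      ((x - u : ℝ) : ℂ) ^ (μ - 1) * φ u) (Ioo a x)) :
    CompositionConverges κ P w α β γ μ a x φ := by
  obtain ⟨c₀, hc, hc₀⟩ := exists_line_of_re_pos hα hb
  obtain ⟨L, hL, hL'⟩ := FoxData.exists_separates κ (hH a ⟨le_rfl, hax⟩).2.1 hc₀
  obtain ⟨K, hK, hK'⟩ := exists_stronglyMeasurable_foxKernel (β := β) hL hH
  obtain ⟨C, hC0, hC⟩ := exists_norm_foxKernel_le (β := β) hax hα hL hL' hH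
  set ε := β.re + α * c₀ with hε
  -- The weight `k` majorizes the factors that depend on `t` only, and it has no zeros.
  set g : ℝ → ℂ := fun u => (u : ℂ) ^ γ * φ u with hg
  set k : ℝ → ℂ := fun t => (((x - t) ^ (ε - 1) * (t - a) ^ (-(μ + γ).re) : ℝ) : ℂ) with hk
  have hkpos : ∀ t ∈ Ioo a x, 0 < (x - t) ^ (ε - 1) * (t - a) ^ (-(μ + γ).re) := fun t ht =>
    mul_pos (Real.rpow_pos_of_pos (sub_pos.2 ht.2) _) (Real.rpow_pos_of_pos (sub_pos.2 ht.1) _)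
  have hk0 : ∀ t ∈ Ioo a x, k t ≠ 0 := fun t ht => Complex.ofReal_ne_zero.2 (hkpos t ht).ne'
  have hknorm : ∀ t ∈ Ioo a x, ‖k t‖ = (x - t) ^ (ε - 1) * (t - a) ^ (-(μ + γ).re) := fun t ht => by
    rw [hk, Complex.norm_of_nonneg (hkpos t ht).le]
  have hkm : Measurable k := by fun_prop
  have hgm : AEStronglyMeasurable g (volume.restrict (Ioo a x)) := by
    have hm : Measurable fun u : ℝ =>
        ((((u - a) ^ (-δ) : ℝ) : ℂ) * ((x - u : ℝ) : ℂ) ^ (μ - 1))⁻¹ := by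
      fun_prop
    refine (hφ.aestronglyMeasurable.mul hm.aestronglyMeasurable).congr ?_
    filter_upwards [ae_restrict_mem measurableSet_Ioo] with u hu
    have h1 : (((u - a) ^ (-δ) : ℝ) : ℂ) ≠ 0 := by
      exact_mod_cast (Real.rpow_pos_of_pos (sub_pos.2 hu.1) _).ne'
    have h2 : ((x - u : ℝ) : ℂ) ≠ 0 := by exact_mod_cast (sub_pos.2 hu.2).ne'
    have h3 : ((x - u : ℝ) : ℂ) ^ (μ - 1) ≠ 0 := fun h => h2 ((Complex.cpow_eq_zero_iff _ _).1 h).1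
    simp only [Pi.mul_apply, hg]
    field_simp
  have hφ' : IntegrableOn (fun u => (x - u) ^ (μ.re - 1) * ((u - a) ^ (-δ) * ‖g u‖)) (Ioo a x) := by
    refine hφ.norm.congr ?_
    filter_upwards [ae_restrict_mem measurableSet_Ioo] with u hu
    rw [norm_mul, norm_mul, norm_mul, norm_ofReal_cpow (sub_pos.2 hu.2), Complex.norm_real,
      Real.norm_of_nonneg (Real.rpow_nonneg (sub_pos.2 hu.1).le _), hg, norm_mul, Complex.sub_re,
      Complex.one_re]
    ring
  -- The exponent `ρ` is the part of `Re (μ + γ)` that `δ` does not compensate.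
  set ρ := max ((μ + γ).re - δ) 0 with hρ
  have hρ0 : 0 ≤ ρ := le_max_right _ _
  have hρμ : ρ < μ.re := max_lt (by rw [Complex.add_re]; linarith) hμ
  have hmaj := (integrable_majorant (ε := ε) hc hρμ hφ' hgm.norm).const_mul
    ((x - a) ^ (δ - (μ + γ).re))
  have hS : MeasurableSet {z : ℝ × ℝ | z.2 < z.1} := measurableSet_lt measurable_snd measurable_fst
  have hm : Measurable fun z : ℝ × ℝ => ((z.1 - z.2 : ℝ) : ℂ) ^ (1 - μ) := by fun_prop
  have hT : Integrable (fun z : ℝ × ℝ => {z : ℝ × ℝ | z.2 < z.1}.indicator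
      (fun z => k z.1 * (g z.2 / ((z.1 - z.2 : ℝ) : ℂ) ^ (1 - μ))) z)
      ((volume.restrict (Ioo a x)).prod (volume.restrict (Ioo a x))) := by
    refine hmaj.mono' ?_ ?_
    · exact (hkm.aestronglyMeasurable.comp_fst.mul
        (hgm.comp_snd.mul hm.inv.aestronglyMeasurable)).indicator hS
    · rw [Measure.prod_restrict]
      filter_upwards [ae_restrict_mem (measurableSet_Ioo.prod measurableSet_Ioo)] with z hz
      by_cases hz' : z ∈ {z : ℝ × ℝ | z.2 < z.1}
      · have hlt : z.2 < z.1 := hz'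
        have h1 : 0 < z.1 - z.2 := sub_pos.2 hlt
        rw [indicator_of_mem hz', indicator_of_mem hz', norm_mul, norm_div, hknorm _ hz.1,
          norm_ofReal_cpow h1, Complex.sub_re, Complex.one_re, div_eq_mul_inv,
          ← Real.rpow_neg h1.le]
        have h2 := sub_rpow_neg_le hz.2.1 hlt hz.1.2 hδ hρ0 (c := (μ + γ).re)
          (by linarith [le_max_left ((μ + γ).re - δ) 0])
        have h3 : 0 ≤ (x - z.1) ^ (ε - 1) := Real.rpow_nonneg (sub_pos.2 hz.1.2).le _
        have h4 : (z.1 - z.2) ^ (μ.re - ρ - 1) = (z.1 - z.2) ^ (-ρ) * (z.1 - z.2) ^ (-(1 - μ.re)) := by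
          rw [← Real.rpow_add h1]
          congr 1
          ring
        have h5 : 0 ≤ (z.1 - z.2) ^ (-(1 - μ.re)) := Real.rpow_nonneg h1.le _
        rw [h4]
        calc (x - z.1) ^ (ε - 1) * (z.1 - a) ^ (-(μ + γ).re) *
              (‖g z.2‖ * (z.1 - z.2) ^ (-(1 - μ.re)))
            ≤ (x - z.1) ^ (ε - 1) * ((x - a) ^ (δ - (μ + γ).re) * ((z.2 - a) ^ (-δ) *
              ((x - z.2) ^ ρ * (z.1 - z.2) ^ (-ρ)))) *
              (‖g z.2‖ * (z.1 - z.2) ^ (-(1 - μ.re))) := by gcongr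
          _ = _ := by ring
      · rw [indicator_of_notMem hz', indicator_of_notMem hz', norm_zero, mul_zero]
  obtain ⟨h1, h2⟩ := ae_integrableOn_of_integrable_triangle hk0 hT
  have h2' : IntegrableOn (fun t : ℝ => ((‖k t‖ *
      ∫ u in a..t, ‖g u / ((t - u : ℝ) : ℂ) ^ (1 - μ)‖ : ℝ) : ℂ)) (Ioo a x) := h2.ofReal
  refine ⟨h1, ?_⟩
  have hq : AEStronglyMeasurable (fun t : ℝ => foxKernel κ P w α β x t *
      ((t - a : ℝ) : ℂ) ^ (-μ - γ) * (k t)⁻¹) (volume.restrict (Ioo a x)) := by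
    have hm : Measurable fun t : ℝ => ((t - a : ℝ) : ℂ) ^ (-μ - γ) := by fun_prop
    refine AEStronglyMeasurable.mul (AEStronglyMeasurable.mul (hK.aestronglyMeasurable.congr ?_)
      hm.aestronglyMeasurable) hkm.inv.aestronglyMeasurable
    filter_upwards [ae_restrict_mem measurableSet_Ioo] with t ht
    exact (hK' t (Ioo_subset_Ico_self ht)).symm
  refine (Integrable.bdd_mul (c := C) h2' hq ?_).congr ?_
  · filter_upwards [ae_restrict_mem measurableSet_Ioo] with t ht
    have h3 := hC t (Ioo_subset_Ico_self ht)
    have h4 := sub_pos.2 ht.1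
    rw [norm_mul, norm_mul, norm_inv, hknorm t ht, norm_ofReal_cpow h4, ← div_eq_mul_inv,
      div_le_iff₀ (hkpos t ht), ← mul_assoc,
      show (-μ - γ).re = -(μ + γ).re by simp; ring]
    gcongr
  · filter_upwards [ae_restrict_mem measurableSet_Ioo] with t ht
    have h3 := hk0 t ht
    have h4 : ((‖k t‖ : ℝ) : ℂ) = k t := by rw [hknorm t ht]
    rw [Complex.ofReal_mul, h4, mul_assoc _ (k t)⁻¹, inv_mul_cancel_left₀ h3]

end Convergence

end

theorem theorem1 (κ : ContourKind) (P : FoxData) (hm : 1 ≤ P.m)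
    (γ μ β w : ℂ) (α a x : ℝ) (hax : a < x) (hα : 0 < α)
    (hγ : -1 < γ.re) (hμ : 0 < μ.re) (hβ : 0 < β.re) (hw : w ≠ 0)
    (hb : ∀ j : Fin P.q, (j : ℕ) < P.m → 0 < β.re + (α * P.b j / P.B j).re)
    (hμγ : μ + γ ≠ 0)
    (hH : ∀ t ∈ Set.Ico a x, P.Exists κ (w * (((x - t) ^ α : ℝ) : ℂ))) :
    (∀ φ : ℝ → ℂ, CompositionConverges κ P w α β γ μ a x φ →
      IntervalIntegrable (fun u => compositionKernel κ P w α hα β γ μ a x u * φ u)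
        MeasureTheory.volume a x ∧
      foxOperator κ P w α β a (saxenaIntegral a γ μ φ) x =
        ∫ u in a..x, compositionKernel κ P w α hα β γ μ a x u * φ u) ∧
    (∀ φ : ℝ → ℂ,
      (∃ δ : ℝ, 0 ≤ δ ∧ γ.re < δ ∧
        MeasureTheory.IntegrableOn (fun u : ℝ => (u : ℂ) ^ γ * (((u - a) ^ (-δ) : ℝ) : ℂ) *
          ((x - u : ℝ) : ℂ) ^ (μ - 1) * φ u) (Set.Ioo a x)) →
      CompositionConverges κ P w α β γ μ a x φ) :=
  ⟨fun _ hφ => intervalIntegrable_and_foxOperator_saxenaIntegral_eq hα hax hγ hμ hμγ hb hH hφ,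
    fun _ ⟨_, hδ, hγδ, hφ⟩ => compositionConverges_of_integrableOn hα hax hμ hb hH hδ hγδ hφ⟩
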